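/- Let $\mathcal X,\mathcal X_1$ be finite alphabets and $\mathcal H^{B_1},\mathcal H^{B}$ finite-dimensional Hilbert spaces. A classical-quantum relay channel assigns to each pair of input symbols $(x,x_1)\in\mathcal X\times\mathcal X_1$ (of the Source and of the Relay) a density operator $\rho_{x,x_1}^{B_1B}$ on $\mathcal H^{B_1}\otimes\mathcal H^{B}$, where $B_1$ is the output at the Relay and $B$ the output at the Destination. **Codes.** A partial decode-and-forward code with $b+1$ blocks of $n$ channel uses has finite message sets $\mathcal M,\mathcal L$ with fixed elements $m_\circ\in\mathcal M$, $\ell_\circ\in\mathcal L$, and conveys message pairs $(m_j,\ell_j)\in\mathcal M\times\mathcal L$, $j=1,\dots,b$; by convention $\ell_0=\ell_{b+1}=\ell_\circ$ and $m_{b+1}=m_\circ$. In block $j$ the Source sends a codeword $x_j^n(m_j,\ell_j,\ell_{j-1})$ and the Relay sends $x_{1,j}^n(\hat\ell_{j-1})$, where $\hat\ell_0=\ell_\circ$ and, for $j\le b$, $\hat\ell_j$ is the outcome of a POVM $\{\Gamma^{(j)}_{\ell|\hat\ell_{j-1}}\}_{\ell\in\mathcal L}$ that the Relay applies to its output $B_1^n$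 of block $j$. For $j=1,\dots,b$ in this order, the Destination applies to its outputs $B^nB^n$ of blocks $j$ and $j+1$ a measurement with outcomes in $\mathcal M\times\mathcal L$, which may depend on its previous estimate of $\ell_{j-1}$ (which is $\ell_\circ$ for $j=1$); it is given by measurement operators $K_{m,\ell}$ with $\sum K_{m,\ell}^\dagger K_{m,\ell}=I$ (POVM elements $\Lambda_{m,\ell}=K_{m,\ell}^\dagger K_{m,\ell}$), and its outcome is the estimate of $(m_j,\ell_j)$. For uniformly distributed messages, let $\bar p_e^R$ be the probability that $\hat\ell_j\ne\ell_j$ for some $j\le b$, and $\bar p_e^D$ the probability that the Destination's estimate of $(m_j,\ell_j)$ is wrong for some $j\le b$. The error of the code is $\bar p_e^R+\bar p_e^D$, and its rate is $\frac{b\log_2(|\mathcal M||\mathcal L|)}{(b+1)n}$. A rate $R\in\mathbb R$ is *achievable* if for all $\epsilon,\delta>0$, for all sufficiently large $b$, and then for all sufficiently large $n$, there is such a code with rate at least $R-\delta$ and error at most $\epsilon$. **Theorem (partial decode-forward inner bound).** Every rate $R$ with $$R\le\max_{p(u,x,x_1)}\min\bigl\{\,I(XX_1;B)_\theta,\ I(U;B_1|X_1)_\theta+I(X;B|X_1U)_\theta\,\bigr\}$$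 is achievable. Here the maximum (read as a supremum) is over all finite alphabets $\mathcal U$ and all joint probability distributions $p(u,x,x_1)$ on $\mathcal U\times\mathcal X\times\mathcal X_1$. The information quantities are built from von Neumann entropies with base-2 logarithm, $I(A;C)=H(A)+H(C)-H(AC)$ and $I(A;C|D)=H(AD)+H(CD)-H(ACD)-H(D)$, evaluated on the state $$\theta^{UXX_1B_1B}=\sum_{u,x,x_1}p(u,x,x_1)\,|u\rangle\langle u|^U\otimes|x\rangle\langle x|^X\otimes|x_1\rangle\langle x_1|^{X_1}\otimes\rho_{x,x_1}^{B_1B}.$$ -/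

import Mathlib

open scoped ComplexOrder Kronecker Matrix

namespace QRelay

noncomputable section

/-! ### Finite-dimensional quantum systems, marginals and entropies -/

/-- The partial trace of `A` over the subsystem with index set `κ`. The function `f` says how the
full index is put together from the index of the subsystem that is kept and that of the
subsystem that is traced out. -/
def marginal {ι α κ : Type*} [Fintype κ] (f : α → κ → ι) (A : Matrix ι ι ℂ) : Matrix α α ℂ :=
  Matrix.of fun i j => ∑ k, A (f i k) (f j k)

/-- The von Neumann entropy `-Tr (A log₂ A)`, in bits (with `0 log 0 = 0`), of a Hermitian matrix;
it is only used for density matrices. -/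
def entropy {ι : Type*} [Fintype ι] [DecidableEq ι] (A : Matrix ι ι ℂ) : ℝ :=
  open scoped Classical in
  if h : A.IsHermitian then ∑ i, Real.negMulLog (h.eigenvalues i) / Real.log 2 else 0

/-- `I(A;B) = H(A) + H(B) - H(AB)` for a state of the bipartite system `AB`. -/
def mutualInfo {α β : Type*} [Fintype α] [Fintype β] [DecidableEq α] [DecidableEq β]
    (σ : Matrix (α × β) (α × β) ℂ) : ℝ :=
  entropy (marginal (fun (a : α) (b : β) => (a, b)) σ)
    + entropy (marginal (fun (b : β) (a : α) => (a, b)) σ)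
    - entropy σ

/-- `I(A;B|C) = H(AC) + H(BC) - H(ABC) - H(C)` for a state of the tripartite system `ABC`. -/
def condMutualInfo {α β γ : Type*} [Fintype α] [Fintype β] [Fintype γ]
    [DecidableEq α] [DecidableEq β] [DecidableEq γ]
    (σ : Matrix (α × β × γ) (α × β × γ) ℂ) : ℝ :=
  entropy (marginal (fun (i : α × γ) (b : β) => (i.1, b, i.2)) σ)
    + entropy (marginal (fun (i : β × γ) (a : α) => (a, i.1, i.2)) σ)
    - entropy σ
    - entropy (marginal (fun (c : γ) (i : α × β) => (i.1, i.2, c)) σ)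

/-! ### The channel and the rate bound -/

/-- A classical-quantum relay channel: for every pair of input symbols `(x, x₁)` of the source and
of the relay, a density matrix on the tensor product of the relay output `B₁` and the destination
output `B`. The systems are `ℂ^B₁` and `ℂ^B` for finite index sets `B₁` and `B`. -/
structure RelayChannel (X X₁ B₁ B : Type*) [Fintype B₁] [Fintype B] where
  state : X → X₁ → Matrix (B₁ × B) (B₁ × B) ℂ
  posSemidef : ∀ x x₁, (state x x₁).PosSemidef
  trace_eq_one : ∀ x x₁, (state x x₁).trace = 1

section Bound

variable {U X X₁ B₁ B : Type*} [Fintype U] [Fintype X] [Fintype X₁] [Fintype B₁] [Fintype B]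
  [DecidableEq U] [DecidableEq X] [DecidableEq X₁] [DecidableEq B₁] [DecidableEq B]

/-- The code state
`θ = ∑ p(u,x,x₁) |u⟩⟨u| ⊗ |x⟩⟨x| ⊗ |x₁⟩⟨x₁| ⊗ ρ_{x,x₁}` on the systems `U X X₁ B₁ B`. -/
def codeState (N : RelayChannel X X₁ B₁ B) (p : U × X × X₁ → ℝ) :
    Matrix (U × X × X₁ × B₁ × B) (U × X × X₁ × B₁ × B) ℂ :=
  Matrix.of fun i j =>
    if i.1 = j.1 ∧ i.2.1 = j.2.1 ∧ i.2.2.1 = j.2.2.1 then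
      (p (i.1, i.2.1, i.2.2.1) : ℂ) * N.state i.2.1 i.2.2.1 i.2.2.2 j.2.2.2
    else 0

/-- `I(X X₁; B)_θ`. -/
def infoXX₁B (N : RelayChannel X X₁ B₁ B) (p : U × X × X₁ → ℝ) : ℝ :=
  mutualInfo (marginal
    (fun (i : (X × X₁) × B) (k : U × B₁) => (k.1, i.1.1, i.1.2, k.2, i.2)) (codeState N p))

/-- `I(U; B₁ | X₁)_θ`. -/
def infoUB₁ (N : RelayChannel X X₁ B₁ B) (p : U × X × X₁ → ℝ) : ℝ :=
  condMutualInfo (marginal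
    (fun (i : U × B₁ × X₁) (k : X × B) => (i.1, k.1, i.2.2, i.2.1, k.2)) (codeState N p))

/-- `I(X; B | X₁ U)_θ`. -/
def infoXB (N : RelayChannel X X₁ B₁ B) (p : U × X × X₁ → ℝ) : ℝ :=
  condMutualInfo (marginal
    (fun (i : X × B × (X₁ × U)) (k : B₁) => (i.2.2.2, i.1, i.2.2.1, k, i.2.1)) (codeState N p))

/-- `min {I(X X₁; B), I(U; B₁ | X₁) + I(X; B | X₁ U)}`, evaluated on the code state. -/
def pdfBound (N : RelayChannel X X₁ B₁ B) (p : U × X × X₁ → ℝ) : ℝ :=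
  min (infoXX₁B N p) (infoUB₁ N p + infoXB N p)

end Bound

/-! ### Partial decode-and-forward codes -/

section Codes

variable {X X₁ B₁ B : Type*} [Fintype B₁] [Fintype B] [DecidableEq B₁] [DecidableEq B]

/-- The output state of `n` uses of the channel on the input words `x` and `x₁`, on the systems
`B₁ⁿ` and `Bⁿ`. -/
def blockState (N : RelayChannel X X₁ B₁ B) {n : ℕ} (x : Fin n → X) (x₁ : Fin n → X₁) :
    Matrix ((Fin n → B₁) × (Fin n → B)) ((Fin n → B₁) × (Fin n → B)) ℂ :=
  Matrix.of fun s t => ∏ i, N.state (x i) (x₁ i) (s.1 i, s.2 i) (t.1 i, t.2 i)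

/-- The unnormalized state `Tr_{B₁} [(E ⊗ 1) ω]` of the system `B` when a measurement of the system
`B₁` has the outcome with POVM element `E`; its trace is the probability of that outcome. -/
def afterRelay {α β : Type*} [Fintype α] [Fintype β] [DecidableEq β]
    (E : Matrix α α ℂ) (ω : Matrix (α × β) (α × β) ℂ) : Matrix β β ℂ :=
  marginal (fun (b : β) (a : α) => (a, b)) ((E ⊗ₖ (1 : Matrix β β ℂ)) * ω)

/-- The tensor product of one matrix for each block. -/
def tensorBlocks {k : ℕ} {β : Type*} (A : Fin k → Matrix β β ℂ) :
    Matrix (Fin k → β) (Fin k → β) ℂ :=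
  Matrix.of fun s t => ∏ j, A j (s j) (t j)

/-- The operator that acts as `A` on the two consecutive blocks `j` and `j + 1`, and as the
identity on all the other blocks. -/
def windowOp {b : ℕ} {β : Type*} [DecidableEq β] (j : Fin b)
    (A : Matrix (β × β) (β × β) ℂ) : Matrix (Fin (b + 1) → β) (Fin (b + 1) → β) ℂ :=
  Matrix.of fun s t =>
    if ∀ i, i ≠ j.castSucc → i ≠ j.succ → s i = t i then
      A (s j.castSucc, s j.succ) (t j.castSucc, t j.succ)
    else 0

/-- A partial decode-and-forward code with `b + 1` blocks of `n` channel uses each. In each of the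
blocks `0, …, b - 1` the source has a fresh message pair `(m, ℓ)`; the last block carries no new
message.

* `sourceWord j m ℓ ℓ'` is the word sent by the source in block `j` when `(m, ℓ)` is the message
  pair of block `j` and `ℓ'` is the `ℓ`-part of the message of the block before;
* `relayWord j ℓ'` is the word sent by the relay in block `j` when `ℓ'` is its estimate of the
  `ℓ`-part of the message of the block before;
* `relayPOVM j ℓ'` is the POVM by which the relay decodes `ℓ` from its output of block `j`, given
  its estimate `ℓ'` from the block before;
* `destKraus j ℓ'` is the measurement by which the destination decodes `(m, ℓ)`, the message pair
  of block `j`, from its outputs of the two consecutive blocks `j` and `j + 1`, given its estimate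
  `ℓ'` from the block before. As the windows overlap, the measurement is given by its measurement
  operators `K`, with POVM elements `Λ = Kᴴ * K`, so that its effect on the state is determined
  (for a given POVM one may take `K = √Λ`).

The convention for the block before block `0` and for the messages of the last block is that they
are the fixed values `m₀`, `ℓ₀`, known to everyone. -/
structure PDFCode (X X₁ B₁ B : Type*) [Fintype B₁] [Fintype B] [DecidableEq B₁] [DecidableEq B]
    (n b : ℕ) where
  cardM : ℕ
  cardL : ℕ
  m₀ : Fin cardM
  ℓ₀ : Fin cardL
  sourceWord : Fin (b + 1) → Fin cardM → Fin cardL → Fin cardL → Fin n → X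
  relayWord : Fin (b + 1) → Fin cardL → Fin n → X₁
  relayPOVM : Fin b → Fin cardL → Fin cardL → Matrix (Fin n → B₁) (Fin n → B₁) ℂ
  relayPOVM_posSemidef : ∀ j ℓ' ℓ, (relayPOVM j ℓ' ℓ).PosSemidef
  relayPOVM_sum : ∀ j ℓ', ∑ ℓ, relayPOVM j ℓ' ℓ = 1
  destKraus : Fin b → Fin cardL → Fin cardM × Fin cardL →
    Matrix ((Fin n → B) × (Fin n → B)) ((Fin n → B) × (Fin n → B)) ℂ
  destKraus_sum : ∀ j ℓ', ∑ d, (destKraus j ℓ' d)ᴴ * destKraus j ℓ' d = 1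

namespace PDFCode

variable {n b : ℕ} (N : RelayChannel X X₁ B₁ B) (c : PDFCode X X₁ B₁ B n b)

/-- The sequence `ℓ₀, l 0, …, l (b - 1)`: what is known about the previous block in each block. -/
def prevL (l : Fin b → Fin c.cardL) : Fin (b + 1) → Fin c.cardL :=
  Fin.cons c.ℓ₀ l

/-- The sequence `l 0, …, l (b - 1), ℓ₀`: the `ℓ`-parts sent in the blocks. -/
def curL (l : Fin b → Fin c.cardL) : Fin (b + 1) → Fin c.cardL :=
  Fin.snoc (α := fun _ => Fin c.cardL) l c.ℓ₀

/-- The sequence `m 0, …, m (b - 1), m₀`: the `m`-parts sent in the blocks. -/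
def curM (m : Fin b → Fin c.cardM) : Fin (b + 1) → Fin c.cardM :=
  Fin.snoc (α := fun _ => Fin c.cardM) m c.m₀

/-- The POVM elements of the relay that belong to its sequence of estimates `lhat`; it does not
measure the last block. -/
def relayEffect (lhat : Fin b → Fin c.cardL) :
    Fin (b + 1) → Matrix (Fin n → B₁) (Fin n → B₁) ℂ :=
  Fin.snoc (α := fun _ => Matrix (Fin n → B₁) (Fin n → B₁) ℂ)
    (fun j => c.relayPOVM j (c.prevL lhat j.castSucc) (lhat j)) 1

/-- The unnormalized joint state of all the outputs at the destination when the source sends the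
messages `(m, l)` and the relay obtains the estimates `lhat`. In every block the relay sends
the word that belongs to its own estimate from the block before, whether it is correct or not. -/
def destState (m : Fin b → Fin c.cardM) (l lhat : Fin b → Fin c.cardL) :
    Matrix (Fin (b + 1) → Fin n → B) (Fin (b + 1) → Fin n → B) ℂ :=
  tensorBlocks fun j => afterRelay (c.relayEffect lhat j)
    (blockState N (c.sourceWord j (c.curM m j) (c.curL l j) (c.prevL l j))
      (c.relayWord j (c.prevL lhat j)))

/-- The product of the measurement operators of the destination that belong to its sequence of
estimates `d`; the window `(0, 1)` is measured first, then `(1, 2)`, and so on. -/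
def destOp (d : Fin b → Fin c.cardM × Fin c.cardL) :
    Matrix (Fin (b + 1) → Fin n → B) (Fin (b + 1) → Fin n → B) ℂ :=
  (List.ofFn fun j : Fin b =>
    windowOp j (c.destKraus j (c.prevL (fun i => (d i).2) j.castSucc) (d j))).reverse.prod

/-- The joint probability that the relay obtains the estimates `lhat` and the destination obtains
the estimates `d`, when the source sends the messages `(m, l)`. -/
def outcomeProb (m : Fin b → Fin c.cardM) (l lhat : Fin b → Fin c.cardL)
    (d : Fin b → Fin c.cardM × Fin c.cardL) : ℝ :=
  (c.destOp d * c.destState N m l lhat * (c.destOp d)ᴴ).trace.re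

/-- The average probability, over uniform messages, that the relay has an error in some block. -/
def relayError : ℝ :=
  1 - (∑ m : Fin b → Fin c.cardM, ∑ l : Fin b → Fin c.cardL, ∑ d, c.outcomeProb N m l l d)
    / ((c.cardM : ℝ) * c.cardL) ^ b

/-- The average probability, over uniform messages, that the destination has an error in the
message pair of some block. -/
def destError : ℝ :=
  1 - (∑ m : Fin b → Fin c.cardM, ∑ l : Fin b → Fin c.cardL, ∑ lhat,
      c.outcomeProb N m l lhat fun j => (m j, l j))
    / ((c.cardM : ℝ) * c.cardL) ^ b

/-- The sum of the average error probabilities at the relay and at the destination. -/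
def error : ℝ := c.relayError N + c.destError N

end PDFCode

/-- `R` is achievable: for all `ε, δ > 0`, for all large enough numbers of blocks and then for all
large enough block lengths `n`, there is a code with error at most `ε` that conveys at least
`R - δ` bits per channel use. All the `(b + 1) * n` channel uses are counted, and
`b * log₂ (|M| |L|)` is the total number of message bits. -/
def Achievable (N : RelayChannel X X₁ B₁ B) (R : ℝ) : Prop :=
  ∀ ε > 0, ∀ δ > 0, ∃ b₀ : ℕ, ∀ b ≥ b₀, ∃ n₀ : ℕ, ∀ n ≥ n₀, ∃ c : PDFCode X X₁ B₁ B n b,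
    (R - δ) * (((b : ℝ) + 1) * n) ≤ b * Real.logb 2 ((c.cardM : ℝ) * c.cardL) ∧
    c.error N ≤ ε

end Codes

end

end QRelay

/-! The code is a random superposition code with an independent codebook for every block: relay
words `x₁(ℓ')` are drawn from `p(x₁)`, auxiliary words `u(ℓ,ℓ')` from `p(u|x₁)`, source words
`x(m,ℓ,ℓ')` from `p(x|x₁,u)`. The relay decodes `ℓ` alone by testing `u`; a wrong `ℓ` comes with an
auxiliary word that is independent given `x₁`, hence the exponent `I(U;B₁|X₁)`. The destination
decodes `(m,ℓ)` by testing the words of block `j` and, simultaneously, the relay word `x₁(ℓ)` in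
block `j + 1`. A wrong `m` with the right `ℓ` has exponent `I(X;B|X₁U)`. A wrong `ℓ` has to pass
both tests; the codebooks are independent, so the exponents `I(UX;B|X₁)` and `I(X₁;B)` add up to
`I(XX₁;B)`. A rate below the bound splits into rates of `m` and `ℓ` below these exponents
(`exists_rate_split`).

The tests are built from spectral projections of product states: a lower cut on the eigenvalues of
the candidate's state, surrounded by upper cuts for averaged states. The sent words pass because the
logarithm of an eigenvalue is a sum of independent variables (`eventually_typical`, by Chebyshev);
wrong words pass with probability at most a ratio of thresholds. The Hayashi-Nagaoka inequality
turns such tests into POVMs (`exists_povm`), and averaging over codebooks gives the packing bounds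
`exists_relayDecoder` and `exists_destDecoder`.

Consecutive windows of the destination overlap, so every measurement acts on a state already
disturbed. With the positive square roots of the POVM elements as measurement operators,
`gentle_sequence` bounds the total loss by a sum of square roots of the single errors on undisturbed
states, and `le_outcomeProb` reduces the whole protocol to these. This is harmless because `b` is
fixed while `n` grows. The loss of the factor `b / (b + 1)` in the rate is absorbed by a large `b`.
-/

namespace QRelay
noncomputable section

/-! ### Functional calculus of Hermitian matrices -/

section SpectralCalculus

variable {ι : Type*} [Fintype ι] [DecidableEq ι] {A : Matrix ι ι ℂ}

/-- The matrix with the same eigenvectors as `A` and with `f` applied to the eigenvalues. -/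
def specFun (hA : A.IsHermitian) (f : ℝ → ℝ) : Matrix ι ι ℂ := hA.cfc f

lemma specFun_mul (hA : A.IsHermitian) (f g : ℝ → ℝ) :
    specFun hA f * specFun hA g = specFun hA (fun t => f t * g t) := by
  unfold specFun Matrix.IsHermitian.cfc
  rw [← map_mul, Matrix.diagonal_mul_diagonal]
  congr 2; ext i; simp

lemma specFun_sub (hA : A.IsHermitian) (f g : ℝ → ℝ) :
    specFun hA f - specFun hA g = specFun hA (fun t => f t - g t) := by
  unfold specFun Matrix.IsHermitian.cfc
  rw [← map_sub, Matrix.diagonal_sub]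
  congr 2; ext i; simp

lemma specFun_one (hA : A.IsHermitian) : specFun hA (fun _ => 1) = 1 := by
  unfold specFun Matrix.IsHermitian.cfc
  rw [← map_one (Unitary.conjStarAlgAut ℂ _ hA.eigenvectorUnitary), ← Matrix.diagonal_one]
  congr 2

lemma specFun_id (hA : A.IsHermitian) : specFun hA (fun t => t) = A := by
  conv_rhs => rw [hA.spectral_theorem]
  rfl

lemma specFun_posSemidef (hA : A.IsHermitian) {f : ℝ → ℝ} (hf : ∀ i, 0 ≤ f (hA.eigenvalues i)) :
    (specFun hA f).PosSemidef := by
  unfold specFun Matrix.IsHermitian.cfc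
  rw [Unitary.conjStarAlgAut_apply, Matrix.star_eq_conjTranspose]
  refine Matrix.PosSemidef.mul_mul_conjTranspose_same (Matrix.PosSemidef.diagonal fun i => ?_) _
  simpa using hf i

lemma specFun_isHermitian (hA : A.IsHermitian) (f : ℝ → ℝ) : (specFun hA f).IsHermitian := by
  unfold specFun Matrix.IsHermitian.cfc
  rw [Unitary.conjStarAlgAut_apply, Matrix.star_eq_conjTranspose]
  refine Matrix.isHermitian_mul_mul_conjTranspose _ ?_
  rw [Matrix.isHermitian_diagonal_iff]
  intro i; simp [isSelfAdjoint_iff]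

lemma trace_specFun (hA : A.IsHermitian) (f : ℝ → ℝ) :
    (specFun hA f).trace = ∑ i, ((f (hA.eigenvalues i) : ℝ) : ℂ) := by
  unfold specFun Matrix.IsHermitian.cfc
  rw [Unitary.conjStarAlgAut_apply, Matrix.trace_mul_cycle]
  simp [Matrix.trace]

lemma specFun_congr (hA : A.IsHermitian) {f g : ℝ → ℝ}
    (h : ∀ i, f (hA.eigenvalues i) = g (hA.eigenvalues i)) : specFun hA f = specFun hA g := by
  unfold specFun Matrix.IsHermitian.cfc
  congr 2; ext i; simp [h]

lemma specFun_smul (hA : A.IsHermitian) (r : ℝ) (f : ℝ → ℝ) :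
    r • specFun hA f = specFun hA (fun t => r * f t) := by
  have : r • specFun hA f = specFun hA (fun _ => r) * specFun hA f := by
    have h : specFun hA (fun _ => r) = (r : ℂ) • 1 := by
      rw [← specFun_one hA]
      unfold specFun Matrix.IsHermitian.cfc
      rw [← map_smul]
      congr 1; ext i j; by_cases hij : i = j <;> simp [Matrix.diagonal, hij]
    rw [h]; simp
  rw [this, specFun_mul]

/-- A symmetric function of the eigenvalues can be read off from any diagonalization. -/
lemma sum_eigenvalues_eq (hA : A.IsHermitian) (V W : Matrix ι ι ℂ) (hWV : W * V = 1) (d : ι → ℝ)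
    (h : A = V * Matrix.diagonal (fun i => (d i : ℂ)) * W) (f : ℝ → ℝ) :
    ∑ i, f (hA.eigenvalues i) = ∑ i, f (d i) := by
  -- Similar matrices have the same characteristic polynomial. Its roots are compared as multisets,
  -- since the two lists of eigenvalues need not be ordered alike.
  have hc : A.charpoly = (Matrix.diagonal (fun i => (d i : ℂ))).charpoly := by
    rw [h, Matrix.charpoly_mul_comm, ← mul_assoc, hWV, one_mul]
  have hr := hA.roots_charpoly_eq_eigenvalues
  rw [hc, Matrix.charpoly_diagonal, Polynomial.roots_prod _ _
    (Finset.prod_ne_zero_iff.2 fun i _ => Polynomial.X_sub_C_ne_zero _)] at hr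
  simp only [Polynomial.roots_X_sub_C, Multiset.bind_singleton] at hr
  have := congrArg (fun s => (s.map (fun z : ℂ => f z.re)).sum) hr
  rw [Multiset.map_map, Multiset.map_map] at this
  exact this.symm

end SpectralCalculus

/-! ### Trace pairing and effects -/

section TracePairing

variable {ι κ : Type*} [Fintype ι] [Fintype κ]

/-- The real trace pairing `Re Tr (A B)`. -/
def pair (A B : Matrix ι ι ℂ) : ℝ := (A * B).trace.re

lemma pair_comm (A B : Matrix ι ι ℂ) : pair A B = pair B A := by
  unfold pair; rw [Matrix.trace_mul_comm]

lemma pair_add_left (A A' B : Matrix ι ι ℂ) : pair (A + A') B = pair A B + pair A' B := by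
  simp [pair, add_mul]

lemma pair_sub_left (A A' B : Matrix ι ι ℂ) : pair (A - A') B = pair A B - pair A' B := by
  simp [pair, sub_mul]

lemma pair_smul_left (r : ℝ) (A B : Matrix ι ι ℂ) : pair (r • A) B = r * pair A B := by
  simp [pair]

lemma pair_smul_right (r : ℝ) (A B : Matrix ι ι ℂ) : pair A (r • B) = r * pair A B := by
  simp [pair]

lemma pair_sum_left {α : Type*} (s : Finset α) (A : α → Matrix ι ι ℂ) (B : Matrix ι ι ℂ) :
    pair (∑ a ∈ s, A a) B = ∑ a ∈ s, pair (A a) B := by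
  simp [pair, Finset.sum_mul, Matrix.trace_sum]

lemma pair_sum_right {α : Type*} (s : Finset α) (A : α → Matrix ι ι ℂ) (B : Matrix ι ι ℂ) :
    pair B (∑ a ∈ s, A a) = ∑ a ∈ s, pair B (A a) := by
  simp [pair, Finset.mul_sum, Matrix.trace_sum]

lemma pair_add_right (A B B' : Matrix ι ι ℂ) : pair A (B + B') = pair A B + pair A B' := by
  simp [pair, mul_add]

lemma pair_sub_right (A B B' : Matrix ι ι ℂ) : pair A (B - B') = pair A B - pair A B' := by
  simp [pair, mul_sub]

lemma pair_one_left [DecidableEq ι] (A : Matrix ι ι ℂ) : pair 1 A = A.trace.re := by simp [pair]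

lemma pair_conj_left (K : Matrix κ ι ℂ) (A : Matrix κ κ ℂ) (B : Matrix ι ι ℂ) :
    pair (Kᴴ * A * K) B = pair A (K * B * Kᴴ) := by
  unfold pair
  rw [Matrix.mul_assoc, Matrix.mul_assoc, Matrix.trace_mul_comm]
  simp only [Matrix.mul_assoc]

/-- Cyclicity gives `Tr (A B) = Tr (√B A √B)`, the trace of a positive semidefinite matrix. -/
lemma pair_nonneg {A B : Matrix ι ι ℂ} (hA : A.PosSemidef) (hB : B.PosSemidef) : 0 ≤ pair A B := by
  classical
  have h : specFun hB.1 Real.sqrt * specFun hB.1 Real.sqrt = B := by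
    rw [specFun_mul]; conv_rhs => rw [← specFun_id hB.1]
    exact specFun_congr _ fun i => Real.mul_self_sqrt (hB.eigenvalues_nonneg i)
  have h2 := (hA.conjTranspose_mul_mul_same (specFun hB.1 Real.sqrt)).trace_nonneg
  rw [(specFun_isHermitian _ _).eq, mul_assoc, Matrix.trace_mul_comm, mul_assoc, h] at h2
  exact (Complex.le_def.1 h2).1

lemma pair_mono_left {A A' B : Matrix ι ι ℂ} (h : (A' - A).PosSemidef) (hB : B.PosSemidef) :
    pair A B ≤ pair A' B := by
  have := pair_nonneg h hB
  rw [pair_sub_left] at this; linarith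

lemma pair_mono_right {A B B' : Matrix ι ι ℂ} (hA : A.PosSemidef) (h : (B' - B).PosSemidef) :
    pair A B ≤ pair A B' := by
  have := pair_nonneg hA h
  rw [pair_sub_right] at this; linarith

lemma pair_kronecker (A B : Matrix ι ι ℂ) (C D : Matrix κ κ ℂ) (hA : A.IsHermitian)
    (hB : B.IsHermitian) : pair (A ⊗ₖ C) (B ⊗ₖ D) = pair A B * pair C D := by
  unfold pair
  rw [← Matrix.mul_kronecker_mul, Matrix.trace_kronecker, Complex.mul_re]
  -- The real part of a product factors only if one of the factors is real; the trace of a product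
  -- of two Hermitian matrices is.
  have : ((A * B).trace).im = 0 := by
    rw [← Complex.conj_eq_iff_im, starRingEnd_apply, ← Matrix.trace_conjTranspose,
      Matrix.conjTranspose_mul, hA.eq, hB.eq, Matrix.trace_mul_comm]
  rw [this]; ring

end TracePairing

lemma posSemidef_kronecker {ι κ : Type*} [Finite ι] [Finite κ] {A : Matrix ι ι ℂ} {C : Matrix κ κ ℂ} (hA : A.PosSemidef)
    (hC : C.PosSemidef) : (A ⊗ₖ C).PosSemidef := hA.kronecker hC

lemma sub_kronecker' {ι κ : Type*} (A B : Matrix ι ι ℂ) (C : Matrix κ κ ℂ) :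
    (A - B) ⊗ₖ C = A ⊗ₖ C - B ⊗ₖ C := by
  ext i j; simp [sub_mul]

lemma kronecker_sub' {ι κ : Type*} (A : Matrix ι ι ℂ) (B C : Matrix κ κ ℂ) :
    A ⊗ₖ (B - C) = A ⊗ₖ B - A ⊗ₖ C := by
  ext i j; simp [mul_sub]

/-- `0 ≤ A ≤ 1` in the positive semidefinite order. -/
structure IsEffect {ι : Type*} [Fintype ι] [DecidableEq ι] (A : Matrix ι ι ℂ) : Prop where
  posSemidef : A.PosSemidef
  le_one : (1 - A).PosSemidef

section Effects

variable {ι κ : Type*} [Fintype ι] [DecidableEq ι] [Fintype κ] [DecidableEq κ]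

lemma exists_posSemidef_sqrt {A : Matrix ι ι ℂ} (hA : A.PosSemidef) :
    ∃ K : Matrix ι ι ℂ, K.PosSemidef ∧ K * K = A := by
  refine ⟨specFun hA.1 Real.sqrt, specFun_posSemidef _ fun i => Real.sqrt_nonneg _, ?_⟩
  rw [specFun_mul]; conv_rhs => rw [← specFun_id hA.1]
  exact specFun_congr _ fun i => Real.mul_self_sqrt (hA.eigenvalues_nonneg i)

lemma IsEffect.exists_sqrt {A : Matrix ι ι ℂ} (hA : IsEffect A) :
    ∃ K : Matrix ι ι ℂ, IsEffect K ∧ K * K = A := by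
  obtain ⟨K, hK, hKA⟩ := exists_posSemidef_sqrt hA.posSemidef
  refine ⟨K, ⟨hK, ?_⟩, hKA⟩
  -- `1 - K = ½ (1 - K²) + ½ (1 - K)²`
  have h1 : (1 - K) = (1 / 2 : ℝ) • ((1 - A) + (1 - K)ᴴ * (1 - K)) := by
    rw [← hKA, Matrix.conjTranspose_sub, Matrix.conjTranspose_one, hK.1.eq]
    have : (1 - K * K) + (1 - K) * (1 - K) = (2 : ℝ) • (1 - K) := by
      rw [two_smul]; noncomm_ring
    rw [this, smul_smul]; norm_num
  rw [h1]
  exact (hA.le_one.add (Matrix.posSemidef_conjTranspose_mul_self _)).smul (by norm_num)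

lemma IsEffect.one : IsEffect (1 : Matrix ι ι ℂ) :=
  ⟨Matrix.PosSemidef.one, by simpa using Matrix.PosSemidef.zero⟩

lemma isEffect_of_proj {P : Matrix ι ι ℂ} (hP : P.IsHermitian) (hPP : P * P = P) : IsEffect P := by
  constructor
  · have := Matrix.posSemidef_conjTranspose_mul_self P
    rwa [hP.eq, hPP] at this
  · have := Matrix.posSemidef_conjTranspose_mul_self (1 - P)
    rw [Matrix.conjTranspose_sub, hP.eq, Matrix.conjTranspose_one] at this
    convert this using 1
    rw [mul_sub, sub_mul, sub_mul, hPP]; simp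

lemma IsEffect.conj {A K : Matrix ι ι ℂ} (hA : IsEffect A) (hK : (1 - Kᴴ * K).PosSemidef) :
    IsEffect (Kᴴ * A * K) := by
  refine ⟨hA.posSemidef.conjTranspose_mul_mul_same K, ?_⟩
  have := hK.add (hA.le_one.conjTranspose_mul_mul_same K)
  convert this using 1
  noncomm_ring

lemma IsEffect.sq {K : Matrix ι ι ℂ} (hK : IsEffect K) : (1 - Kᴴ * K).PosSemidef := by
  rw [hK.posSemidef.1.eq]
  -- `1 - K² = (1 - K) + √K (1 - K) √K`
  obtain ⟨R, hR, hRK⟩ := exists_posSemidef_sqrt hK.posSemidef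
  have := hK.le_one.add (hK.le_one.conjTranspose_mul_mul_same R)
  convert this using 1
  rw [hR.1.eq, ← hRK]; noncomm_ring

lemma IsEffect.kronecker {A : Matrix ι ι ℂ} {C : Matrix κ κ ℂ} (hA : IsEffect A) (hC : IsEffect C) :
    IsEffect (A ⊗ₖ C) := by
  refine ⟨posSemidef_kronecker hA.posSemidef hC.posSemidef, ?_⟩
  have := (posSemidef_kronecker hA.le_one (Matrix.PosSemidef.one (n := κ) (R := ℂ))).add
    (posSemidef_kronecker hA.posSemidef hC.le_one)
  convert this using 1
  rw [kronecker_sub', sub_kronecker', Matrix.one_kronecker_one]; abel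

lemma IsEffect.pair_le_trace {A B : Matrix ι ι ℂ} (hA : IsEffect A) (hB : B.PosSemidef) :
    pair A B ≤ B.trace.re := by
  rw [← pair_one_left]; exact pair_mono_left hA.le_one hB

end Effects

/-! ### Gentle sequential measurement -/

section GentleSequence

variable {ι : Type*} [Fintype ι]

-- Applied to `A = K √ρ`, this makes the probability of passing `K` a squared norm, so that the
-- disturbance by a sequence of measurements is controlled by the triangle inequality.
attribute [local instance] Matrix.frobeniusNormedAddCommGroup in
lemma frobenius_norm_sq (A : Matrix ι ι ℂ) : ‖A‖ ^ 2 = (A * Aᴴ).trace.re := by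
  rw [Matrix.frobenius_norm_def, ← Real.sqrt_eq_rpow, Real.sq_sqrt (by positivity)]
  simp [Matrix.trace, Matrix.mul_apply, Complex.mul_conj, Complex.normSq_eq_norm_sq,
    -Complex.ofReal_pow]

attribute [local instance] Matrix.frobeniusNormedAddCommGroup in
/-- If every one of a sequence of effects `K` has a square that is likely to be passed by `ρ`, then
the sequence is likely to be passed. -/
lemma gentle_sequence [DecidableEq ι] (l : List (Matrix ι ι ℂ)) (hl : ∀ K ∈ l, IsEffect K) {ρ : Matrix ι ι ℂ}
    (hρ : ρ.PosSemidef) (hρ1 : ρ.trace.re ≤ 1) :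
    ρ.trace.re - 2 * (l.map fun K => √(pair (1 - K * K) ρ)).sum
      ≤ (l.prod * ρ * l.prodᴴ).trace.re := by
  obtain ⟨R, hR, hRρ⟩ := exists_posSemidef_sqrt hρ
  have hn : ∀ K : Matrix ι ι ℂ, ‖K * R‖ ^ 2 = pair (Kᴴ * K) ρ := by
    intro K
    rw [frobenius_norm_sq, Matrix.conjTranspose_mul, hR.1.eq]
    have := pair_conj_left K 1 ρ
    rw [mul_one, pair_one_left] at this
    rw [this, ← hRρ]; simp only [mul_assoc]
  have hcontr : ∀ K : Matrix ι ι ℂ, IsEffect K → ∀ Z : Matrix ι ι ℂ, ‖K * Z‖ ≤ ‖Z‖ := by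
    intro K hK Z
    rw [← sq_le_sq₀ (norm_nonneg _) (norm_nonneg _), frobenius_norm_sq, frobenius_norm_sq]
    have := pair_conj_left K 1 (Z * Zᴴ)
    rw [mul_one, pair_one_left] at this
    have h2 := pair_nonneg hK.sq (Matrix.posSemidef_self_mul_conjTranspose Z)
    rw [pair_sub_left, pair_one_left, this] at h2
    rw [Matrix.conjTranspose_mul]
    simp only [mul_assoc] at h2 ⊢
    linarith
  have hstep : ∀ K : Matrix ι ι ℂ, IsEffect K → ‖K * R - R‖ ≤ √(pair (1 - K * K) ρ) := by
    intro K hK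
    apply Real.le_sqrt_of_sq_le
    have : K * R - R = (K - 1) * R := by noncomm_ring
    rw [this, hn]
    apply pair_mono_left _ hρ
    -- `(1 - K²) - (1 - K)² = 2 √K (1 - K) √K`
    obtain ⟨S, hS, hSK⟩ := exists_posSemidef_sqrt hK.posSemidef
    have h := hK.le_one.conjTranspose_mul_mul_same S
    convert h.add h using 1
    rw [Matrix.conjTranspose_sub, hK.posSemidef.1.eq, hS.1.eq, Matrix.conjTranspose_one, ← hSK]
    noncomm_ring
  have hmain : ‖l.prod * R - R‖ ≤ (l.map fun K => √(pair (1 - K * K) ρ)).sum := by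
    induction l with
    | nil => simp
    | cons K l ih =>
      rw [List.prod_cons, List.map_cons, List.sum_cons]
      have h1 : K * l.prod * R - R = (K * R - R) + K * (l.prod * R - R) := by noncomm_ring
      rw [h1]
      refine (norm_add_le _ _).trans (add_le_add (hstep K (hl K (by simp))) ?_)
      exact (hcontr K (hl K (by simp)) _).trans (ih fun K' h => hl K' (by simp [h]))
  have hR1 : ‖R‖ ^ 2 = ρ.trace.re := by rw [frobenius_norm_sq, hR.1.eq, hRρ]
  have hL : ‖l.prod * R‖ ^ 2 = (l.prod * ρ * l.prodᴴ).trace.re := by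
    rw [frobenius_norm_sq, Matrix.conjTranspose_mul, hR.1.eq, ← hRρ]; simp only [mul_assoc]
  rw [← hL, ← hR1]
  have h3 : ‖R‖ ≤ ‖l.prod * R‖ + ‖l.prod * R - R‖ := by
    have := norm_sub_le (l.prod * R) (l.prod * R - R)
    simpa using this
  have hRle : ‖R‖ ≤ 1 := by
    rw [← sq_le_one_iff₀ (norm_nonneg _), hR1]; exact hρ1
  set σ := (l.map fun K => √(pair (1 - K * K) ρ)).sum
  have hσ : 0 ≤ σ := (norm_nonneg _).trans hmain
  -- Squaring `‖R‖ - σ` loses at most `2 σ` because `‖R‖ ≤ 1`. If `σ` exceeds `‖R‖`, the lower bound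
  -- is negative and there is nothing to prove.
  by_cases h : σ ≤ ‖R‖
  · have : (‖R‖ - σ) ^ 2 ≤ ‖l.prod * R‖ ^ 2 :=
      pow_le_pow_left₀ (by linarith) (by linarith) 2
    nlinarith [mul_nonneg hσ (sub_nonneg.2 hRle)]
  · push Not at h
    nlinarith [sq_nonneg ‖l.prod * R‖, norm_nonneg R, mul_nonneg hσ (sub_nonneg.2 hRle)]

end GentleSequence


/-! ### Hayashi-Nagaoka inequality and square-root measurement -/

section SquareRootMeasurement

lemma eq_zero_of_trace_mul_self {ι : Type*} [Fintype ι] (A : Matrix ι ι ℂ) (hA : A.IsHermitian)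
    (h : (A * A).trace.re = 0) : A = 0 := by
  have h2 := Matrix.posSemidef_conjTranspose_mul_self A
  have h3 : (Aᴴ * A).trace = 0 := by
    rw [hA.eq]
    apply Complex.ext h
    have h4 := h2.trace_nonneg
    rw [hA.eq] at h4
    exact (Complex.le_def.1 h4).2.symm
  exact Matrix.trace_conjTranspose_mul_self_eq_zero_iff.1 h3

variable {ι : Type*} [Fintype ι] [DecidableEq ι]

/-- Operator monotonicity of the square root. -/
lemma posSemidef_sub_of_mul_self {X S : Matrix ι ι ℂ} (hX : X.PosSemidef) (hS : S.PosSemidef)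
    (h : (X * X - S * S).PosSemidef) : (X - S).PosSemidef := by
  have hD : (X - S).IsHermitian := hX.1.sub hS.1
  -- `N` is the negative part of `X - S` and `P` the projection onto its support; the aim is `N =
  -- 0`.
  set N := specFun hD (fun t => max (-t) 0) with hN
  set P := specFun hD (fun t => if t < 0 then 1 else 0) with hP
  have hNp : N.PosSemidef := specFun_posSemidef _ fun i => le_max_right _ _
  have hPp : P.PosSemidef := specFun_posSemidef _ fun i => by split_ifs <;> norm_num
  have hPD : P * (X - S) = -N := by
    rw [hP, hN]
    nth_rewrite 2 [← specFun_id hD]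
    rw [specFun_mul, ← neg_one_smul ℝ (specFun hD fun t => max (-t) 0), specFun_smul]
    refine specFun_congr _ fun i => ?_
    split_ifs with h0
    · rw [max_eq_left (by linarith)]; ring
    · rw [max_eq_right (by linarith)]; ring
  have hDP : (X - S) * P = -N := by
    have := congrArg Matrix.conjTranspose hPD
    rwa [Matrix.conjTranspose_mul, hD.eq, hPp.1.eq, Matrix.conjTranspose_neg, hNp.1.eq] at this
  -- `X² - S²` is half the anticommutator of `X - S` and `X + S`, and `P` cuts `X - S` down to `-N`.
  have h1 : pair P (X * X - S * S) = - pair N (X + S) := by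
    have e : X * X - S * S = (1 / 2 : ℝ) • ((X - S) * (X + S) + (X + S) * (X - S)) := by
      have : (X - S) * (X + S) + (X + S) * (X - S) = (2 : ℝ) • (X * X - S * S) := by
        rw [two_smul]; noncomm_ring
      rw [this, smul_smul]; norm_num
    rw [e, pair_smul_right, pair_add_right]
    have e1 : pair P ((X - S) * (X + S)) = - pair N (X + S) := by
      unfold pair; rw [← mul_assoc, hPD]; simp
    have e2 : pair P ((X + S) * (X - S)) = - pair N (X + S) := by
      rw [pair_comm]; unfold pair
      rw [mul_assoc, hDP, Matrix.trace_mul_comm]; simp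
    rw [e1, e2]; ring
  have h2 := pair_nonneg hPp h
  have hNX := pair_nonneg hNp hX
  have hNS := pair_nonneg hNp hS
  rw [h1, pair_add_right] at h2
  -- `Tr N X` and `Tr N S` are nonnegative with nonpositive sum, so both vanish. As `N (X - S) =
  -- -N²`, this forces `Tr N² = 0`.
  have h3 : pair N (X - S) = 0 := by rw [pair_sub_right]; linarith
  have hND : N * (X - S) = -(N * N) := by
    rw [hN]
    nth_rewrite 2 [← specFun_id hD]
    rw [specFun_mul, specFun_mul, ← neg_one_smul ℝ, specFun_smul]
    refine specFun_congr _ fun i => ?_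
    rcases le_total (hD.eigenvalues i) 0 with h0 | h0
    · rw [max_eq_left (by linarith)]; ring
    · rw [max_eq_right (by linarith)]; ring
  have hN0 : N = 0 := by
    apply eq_zero_of_trace_mul_self _ hNp.1
    have : pair N (X - S) = -(N * N).trace.re := by unfold pair; rw [hND]; simp
    linarith
  have : X - S = specFun hD (fun t => max t 0) := by
    have e : specFun hD (fun t => max t 0) - N = X - S := by
      rw [hN, specFun_sub]
      conv_rhs => rw [← specFun_id hD]
      refine specFun_congr _ fun i => ?_
      rcases le_total (hD.eigenvalues i) 0 with h0 | h0
      · rw [max_eq_left (by linarith : 0 ≤ -hD.eigenvalues i), max_eq_right h0]; ring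
      · rw [max_eq_right (by linarith : -hD.eigenvalues i ≤ 0), max_eq_left h0]; ring
    rw [hN0, sub_zero] at e
    exact e.symm
  rw [this]
  exact specFun_posSemidef _ fun i => le_max_right _ _

/-- The Hayashi-Nagaoka inequality. -/
lemma hayashi_nagaoka {S T W : Matrix ι ι ℂ} (hS : IsEffect S) (hT : T.PosSemidef)
    (hW : W.PosSemidef) (hWdef : W = S + T) :
    let G := specFun hW.1 (fun t => (√t)⁻¹)
    (((2 : ℝ) • (1 - S) + (4 : ℝ) • T) - (1 - G * S * G)).PosSemidef := by
  -- As `(√0)⁻¹ = 0`, `G` inverts `√W` on the support of `W` only, and `G W G` is the projection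
  -- onto this support. The quantity to bound is `(1 - G W G) + G T G`.
  intro G
  set R := specFun hW.1 Real.sqrt with hR
  have hGh : G.IsHermitian := specFun_isHermitian _ _
  have hRp : R.PosSemidef := specFun_posSemidef _ fun i => Real.sqrt_nonneg _
  have hRR : R * R = W := by
    rw [hR, specFun_mul]; conv_rhs => rw [← specFun_id hW.1]
    exact specFun_congr _ fun i => Real.mul_self_sqrt (hW.eigenvalues_nonneg i)
  have hGR : G * W = R := by
    conv_lhs => rw [← specFun_id hW.1]
    rw [specFun_mul]
    refine specFun_congr _ fun i => ?_
    rw [mul_comm, ← div_eq_mul_inv, Real.div_sqrt]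
  have hRG : W * G = R := by
    have := congrArg Matrix.conjTranspose hGR
    rwa [Matrix.conjTranspose_mul, hGh.eq, hW.1.eq, hRp.1.eq] at this
  have hPi : (1 - G * W * G).PosSemidef := by
    rw [hGR, specFun_mul, ← specFun_one hW.1, specFun_sub]
    refine specFun_posSemidef _ fun i => ?_
    rw [sub_nonneg]
    exact mul_inv_le_one
  -- `S² ≤ S ≤ W = R²`, and the square root is monotone.
  have h1 : (R - S).PosSemidef := by
    refine posSemidef_sub_of_mul_self hRp hS.posSemidef ?_
    rw [hRR, hWdef]
    obtain ⟨Q, hQ, hQS⟩ := exists_posSemidef_sqrt hS.posSemidef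
    have := hT.add (hS.le_one.conjTranspose_mul_mul_same Q)
    convert this using 1
    rw [hQ.1.eq, ← hQS]; noncomm_ring
  -- The parallelogram bound for `G = 1 + (G - 1)`; the difference is `(G - 2) T (G - 2)`.
  have h2 : (((2 : ℝ) • T + (2 : ℝ) • ((G - 1) * T * (G - 1))) - G * T * G).PosSemidef := by
    have := hT.conjTranspose_mul_mul_same (G - 2)
    convert this using 1
    rw [Matrix.conjTranspose_sub, hGh.eq, show (2 : Matrix ι ι ℂ)ᴴ = 2 by
      rw [← one_add_one_eq_two]; simp, two_smul, two_smul]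
    noncomm_ring
  have h3 : ((G - 1) * W * (G - 1) - (G - 1) * T * (G - 1)).PosSemidef := by
    have := hS.posSemidef.conjTranspose_mul_mul_same (G - 1)
    convert this using 1
    rw [Matrix.conjTranspose_sub, hGh.eq, Matrix.conjTranspose_one, hWdef]; noncomm_ring
  have h4 : (G - 1) * W * (G - 1) = G * W * G - (2 : ℝ) • R + W := by
    rw [two_smul]; nth_rewrite 1 [← hGR]; rw [← hRG]; noncomm_ring
  -- The weight 2 cancels `(G - 1) T (G - 1)` and the weight 4 cancels `R`; the rest follows from `W
  -- = S + T`.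
  have key := ((hPi.add h2).add (h3.smul (zero_le_two (α := ℝ)))).add
    (h1.smul (zero_le_four (α := ℝ)))
  convert key using 1
  rw [h4, show G * S * G = G * W * G - G * T * G by rw [hWdef]; noncomm_ring, hWdef]
  have : (4 : ℝ) = 2 + 2 := by norm_num
  rw [this]
  simp only [add_smul, two_smul, smul_add, smul_sub]
  abel

/-- The square-root measurement of a family of tests, completed to a POVM. -/
lemma exists_povm {D : Type*} [Fintype D] [DecidableEq D] [Nonempty D] (T : D → Matrix ι ι ℂ)
    (hT : ∀ d, IsEffect (T d)) :
    ∃ E : D → Matrix ι ι ℂ, (∀ d, (E d).PosSemidef) ∧ ∑ d, E d = 1 ∧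
      ∀ d (ρ : Matrix ι ι ℂ), ρ.PosSemidef →
        pair (1 - E d) ρ ≤ 2 * pair (1 - T d) ρ + 4 * ∑ d' ∈ Finset.univ.erase d, pair (T d') ρ := by
  obtain ⟨W, hWT⟩ : ∃ W, W = ∑ d, T d := ⟨_, rfl⟩
  have hW : W.PosSemidef := by
    rw [hWT]; exact Matrix.posSemidef_sum _ fun d _ => (hT d).posSemidef
  set G := specFun hW.1 (fun t => (√t)⁻¹) with hG
  have hGh : G.IsHermitian := specFun_isHermitian _ _
  set E₀ : D → Matrix ι ι ℂ := fun d => G * T d * G with hE₀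
  have hE₀p : ∀ d, (E₀ d).PosSemidef := fun d => by
    have := (hT d).posSemidef.conjTranspose_mul_mul_same G
    rwa [hGh.eq] at this
  have hres : (1 - ∑ d, E₀ d).PosSemidef := by
    have : ∑ d, E₀ d = G * W * G := by
      simp only [hWT, hE₀, Finset.mul_sum, Finset.sum_mul]
    rw [this]
    have : G * W * G = G * specFun hW.1 (fun t => t) * G := by rw [specFun_id]
    rw [this, hG, specFun_mul, specFun_mul, ← specFun_one hW.1, specFun_sub]
    refine specFun_posSemidef _ fun i => ?_
    rw [sub_nonneg, mul_comm _ (hW.1.eigenvalues i), ← div_eq_mul_inv (hW.1.eigenvalues i),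
      Real.div_sqrt]
    exact mul_inv_le_one
  -- The defect `1 - ∑ E₀` is given to one arbitrary outcome, which can only increase the
  -- probability of that outcome.
  obtain ⟨d₀⟩ := ‹Nonempty D›
  refine ⟨fun d => E₀ d + if d = d₀ then 1 - ∑ d, E₀ d else 0, fun d => ?_, ?_, fun d ρ hρ => ?_⟩
  · refine (hE₀p d).add ?_
    split_ifs
    · exact hres
    · exact Matrix.PosSemidef.zero
  · rw [Finset.sum_add_distrib, Finset.sum_ite_eq' Finset.univ d₀]; simp
  · have hO : (∑ d' ∈ Finset.univ.erase d, T d').PosSemidef :=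
      Matrix.posSemidef_sum _ fun d _ => (hT d).posSemidef
    have hsum : W = T d + ∑ d' ∈ Finset.univ.erase d, T d' := by
      rw [hWT, Finset.add_sum_erase _ _ (Finset.mem_univ d)]
    have h := hayashi_nagaoka (hT d) hO hW hsum
    have h1 : pair (1 - (E₀ d + if d = d₀ then 1 - ∑ d, E₀ d else 0)) ρ ≤ pair (1 - E₀ d) ρ := by
      refine pair_mono_left ?_ hρ
      have : (if d = d₀ then 1 - ∑ d, E₀ d else 0).PosSemidef := by
        split_ifs
        · exact hres
        · exact Matrix.PosSemidef.zero
      convert this using 1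
      abel
    refine h1.trans ((pair_mono_left h hρ).trans (le_of_eq ?_))
    rw [pair_add_left, pair_smul_left, pair_smul_left, pair_sum_left]

end SquareRootMeasurement

/-! ### Spectral projections and sandwiched tests -/

section SpectralProjections

lemma pair_conj {ι : Type*} [Fintype ι] {P A ρ : Matrix ι ι ℂ} (hP : P.IsHermitian) :
    pair (P * A * P) ρ = pair A (P * ρ * P) := by
  have := pair_conj_left P A ρ
  rwa [hP.eq] at this

variable {ι : Type*} [Fintype ι] [DecidableEq ι]

open scoped Classical in
/-- The spectral projection of a Hermitian matrix that belongs to a set of eigenvalues. -/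
def specProj (S : Matrix ι ι ℂ) (s : Set ℝ) : Matrix ι ι ℂ :=
  if h : S.IsHermitian then specFun h (s.indicator 1) else 0

lemma specProj_eq {S : Matrix ι ι ℂ} (hS : S.IsHermitian) (s : Set ℝ) :
    specProj S s = specFun hS (s.indicator 1) := dif_pos hS

lemma specProj_isHermitian (S : Matrix ι ι ℂ) (s : Set ℝ) : (specProj S s).IsHermitian := by
  unfold specProj
  split_ifs
  · exact specFun_isHermitian _ _
  · exact Matrix.isHermitian_zero

lemma specProj_mul_self (S : Matrix ι ι ℂ) (s : Set ℝ) :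
    specProj S s * specProj S s = specProj S s := by
  unfold specProj
  split_ifs
  · rw [specFun_mul]
    refine specFun_congr _ fun i => ?_
    by_cases h : (‹S.IsHermitian›.eigenvalues i) ∈ s <;> simp [h]
  · simp

lemma specProj_isEffect (S : Matrix ι ι ℂ) (s : Set ℝ) : IsEffect (specProj S s) :=
  isEffect_of_proj (specProj_isHermitian S s) (specProj_mul_self S s)

/-- As in Markov's inequality, the indicator of `t ≤ x` is at most `x / t` on the nonnegative
spectrum of `S`. -/
lemma pair_specProj_Ici_le {S ρ : Matrix ι ι ℂ} (hS : S.PosSemidef) (hρ : ρ.PosSemidef) {t : ℝ}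
    (ht : 0 < t) : pair (specProj S (Set.Ici t)) ρ ≤ t⁻¹ * pair S ρ := by
  rw [← pair_smul_left]
  refine pair_mono_left ?_ hρ
  rw [specProj_eq hS.1]
  nth_rewrite 1 [← specFun_id hS.1]
  rw [specFun_smul, specFun_sub]
  refine specFun_posSemidef _ fun i => ?_
  by_cases h : t ≤ hS.1.eigenvalues i
  · simp only [Set.indicator, Set.mem_Ici, h, if_true, Pi.one_apply, sub_nonneg]
    rw [inv_mul_eq_div, one_le_div ht]; exact h
  · simp only [Set.indicator, Set.mem_Ici, h, if_false, sub_zero]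
    have := hS.eigenvalues_nonneg i
    positivity

lemma specProj_Iic_conj_le {S : Matrix ι ι ℂ} (hS : S.IsHermitian) {t : ℝ} (ht : 0 ≤ t) :
    (t • (1 : Matrix ι ι ℂ) - specProj S (Set.Iic t) * S * specProj S (Set.Iic t)).PosSemidef := by
  rw [specProj_eq hS]
  nth_rewrite 2 [← specFun_id hS]
  rw [specFun_mul, specFun_mul, ← specFun_one hS, specFun_smul, specFun_sub]
  refine specFun_posSemidef _ fun i => ?_
  by_cases h : hS.eigenvalues i ≤ t <;> simp [Set.indicator, h, ht]

/-- The failure of a spectral test on its own state is the weight of the excluded eigenvalues. This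
makes typicality a statement about a classical random variable. -/
lemma pair_one_sub_specProj {S : Matrix ι ι ℂ} (hS : S.IsHermitian) (s : Set ℝ) :
    pair (1 - specProj S s) S = ∑ i, sᶜ.indicator (fun t => t) (hS.eigenvalues i) := by
  unfold pair
  rw [specProj_eq hS]
  nth_rewrite 2 [← specFun_id hS]
  rw [← specFun_one hS, specFun_sub, specFun_mul, trace_specFun, Complex.re_sum]
  refine Finset.sum_congr rfl fun i _ => ?_
  rw [Complex.ofReal_re]
  by_cases h : hS.eigenvalues i ∈ s <;> simp [h]

/-- The test that first applies `P₂`, then `P₁`, then `P₀`. -/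
def sandwich (P₀ P₁ P₂ : Matrix ι ι ℂ) : Matrix ι ι ℂ := P₂ * (P₁ * P₀ * P₁) * P₂

lemma sandwich_isEffect {P₀ P₁ P₂ : Matrix ι ι ℂ} (h₀ : IsEffect P₀) (h₁ : IsEffect P₁)
    (h₂ : IsEffect P₂) : IsEffect (sandwich P₀ P₁ P₂) := by
  have := (h₀.conj h₁.sq).conj h₂.sq
  rwa [h₁.posSemidef.1.eq, h₂.posSemidef.1.eq] at this

/-- The sandwich is `Qᴴ Q` for `Q = P₀ P₁ P₂`, and projections are their own squares, so this is
`gentle_sequence` for three measurements. -/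
lemma pair_one_sub_sandwich_le {P₀ P₁ P₂ ρ : Matrix ι ι ℂ} (h₀ : P₀.IsHermitian)
    (h₁ : P₁.IsHermitian) (h₂ : P₂.IsHermitian) (h₀' : P₀ * P₀ = P₀) (h₁' : P₁ * P₁ = P₁)
    (h₂' : P₂ * P₂ = P₂) (hρ : ρ.PosSemidef) (hρ1 : ρ.trace = 1) :
    pair (1 - sandwich P₀ P₁ P₂) ρ
      ≤ 2 * (√(pair (1 - P₀) ρ) + √(pair (1 - P₁) ρ) + √(pair (1 - P₂) ρ)) := by
  have := gentle_sequence [P₀, P₁, P₂]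
    (by
      intro K hK
      simp only [List.mem_cons, List.not_mem_nil, or_false] at hK
      rcases hK with rfl | rfl | rfl
      exacts [isEffect_of_proj h₀ h₀', isEffect_of_proj h₁ h₁', isEffect_of_proj h₂ h₂'])
    hρ (by simp [hρ1])
  simp only [List.map_cons, List.map_nil, List.sum_cons, List.sum_nil, List.prod_cons,
    List.prod_nil, mul_one, add_zero, h₀', h₁', h₂'] at this
  rw [pair_sub_left, pair_one_left]
  have e : pair (sandwich P₀ P₁ P₂) ρ
      = (P₀ * (P₁ * P₂) * ρ * (P₀ * (P₁ * P₂))ᴴ).trace.re := by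
    have h := pair_conj_left (P₀ * (P₁ * P₂)) 1 ρ
    rw [pair_one_left] at h
    rw [← h]
    congr 1
    rw [Matrix.conjTranspose_mul, Matrix.conjTranspose_mul, h₀.eq, h₁.eq, h₂.eq, mul_one,
      sandwich]
    nth_rewrite 1 [← h₀']
    simp only [mul_assoc]
  rw [e]
  linarith

/-- Moved over to the state, `P₂` caps it at `t`; what remains is the trace of `P₁ P₀ P₁`, which is
at most that of `P₀`. -/
lemma pair_sandwich_le_mul_trace {P₀ P₁ P₂ s : Matrix ι ι ℂ} (h₀ : IsEffect P₀) (h₁ : IsEffect P₁)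
    (h₁' : P₁ * P₁ = P₁) (h₂ : P₂.IsHermitian) {t : ℝ} (ht : 0 ≤ t)
    (h : (t • (1 : Matrix ι ι ℂ) - P₂ * s * P₂).PosSemidef) :
    pair (sandwich P₀ P₁ P₂) s ≤ t * P₀.trace.re := by
  have h1 : (P₁ * P₀ * P₁).PosSemidef := by
    have := h₀.posSemidef.conjTranspose_mul_mul_same P₁
    rwa [h₁.posSemidef.1.eq] at this
  rw [sandwich, pair_conj h₂]
  refine (pair_mono_right h1 h).trans ?_
  rw [pair_smul_right]
  refine mul_le_mul_of_nonneg_left ?_ ht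
  rw [pair_conj h₁.posSemidef.1, mul_one, h₁', pair_comm]
  exact h₁.pair_le_trace h₀.posSemidef

end SpectralProjections


/-! ### Tensor products and windows of two blocks -/

section ProductMatrices

variable {I β : Type*} [Fintype I]

/-- The tensor product of a family of matrices. -/
def piTensor (A : I → Matrix β β ℂ) : Matrix (I → β) (I → β) ℂ :=
  Matrix.of fun s t => ∏ i, A i (s i) (t i)

lemma piTensor_mul [Fintype β] [DecidableEq I] (A B : I → Matrix β β ℂ) :
    piTensor A * piTensor B = piTensor fun i => A i * B i := by
  ext s t
  simp only [piTensor, Matrix.mul_apply, Matrix.of_apply, Finset.prod_univ_sum,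
    Fintype.piFinset_univ, Finset.prod_mul_distrib]

lemma piTensor_conjTranspose (A : I → Matrix β β ℂ) :
    (piTensor A)ᴴ = piTensor fun i => (A i)ᴴ := by
  ext s t
  simp [piTensor, Matrix.conjTranspose_apply]

lemma piTensor_diagonal [DecidableEq β] (d : I → β → ℂ) :
    piTensor (fun i => Matrix.diagonal (d i)) = Matrix.diagonal fun s => ∏ i, d i (s i) := by
  ext s t
  simp only [piTensor, Matrix.of_apply, Matrix.diagonal_apply]
  by_cases h : s = t
  · subst h; simp
  · rw [if_neg h]
    obtain ⟨i, hi⟩ := Function.ne_iff.1 h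
    exact Finset.prod_eq_zero (Finset.mem_univ i) (if_neg hi)

lemma piTensor_one [DecidableEq β] : piTensor (fun _ : I => (1 : Matrix β β ℂ)) = 1 := by
  have := piTensor_diagonal (fun (_ : I) (_ : β) => (1 : ℂ))
  simpa using this

lemma piTensor_posSemidef [Fintype β] [DecidableEq β] {A : I → Matrix β β ℂ}
    (hA : ∀ i, (A i).PosSemidef) : (piTensor A).PosSemidef := by
  classical
  choose K hK hKA using fun i => exists_posSemidef_sqrt (hA i)
  have : piTensor A = (piTensor K)ᴴ * piTensor K := by
    rw [piTensor_conjTranspose, piTensor_mul]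
    congr 1; ext i : 1
    rw [(hK i).1.eq, hKA]
  rw [this]
  exact Matrix.posSemidef_conjTranspose_mul_self _

lemma trace_piTensor [Fintype β] [DecidableEq I] (A : I → Matrix β β ℂ) :
    (piTensor A).trace = ∏ i, (A i).trace := by
  simp only [Matrix.trace, piTensor, Matrix.diag_apply, Matrix.of_apply, Finset.prod_univ_sum,
    Fintype.piFinset_univ]

/-- Averaging a product state over a product distribution averages every factor. -/
lemma sum_smul_piTensor {α : Type*} [Fintype α] [DecidableEq I] (w : I → α → ℝ)
    (σ : I → α → Matrix β β ℂ) :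
    ∑ x : I → α, (∏ i, w i (x i)) • piTensor (fun i => σ i (x i))
      = piTensor fun i => ∑ a, w i a • σ i a := by
  ext s t
  simp only [piTensor, Matrix.sum_apply, Matrix.smul_apply, Matrix.of_apply, Finset.prod_univ_sum,
    Fintype.piFinset_univ, Complex.real_smul, Complex.ofReal_prod, Finset.prod_mul_distrib]

lemma tensorBlocks_eq_piTensor {k : ℕ} (A : Fin k → Matrix β β ℂ) : tensorBlocks A = piTensor A :=
  rfl

end ProductMatrices

section Submatrices

variable {ι κ : Type*} [Fintype ι] [Fintype κ]

lemma pair_submatrix (e : κ ≃ ι) (A B : Matrix ι ι ℂ) :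
    pair (A.submatrix e e) (B.submatrix e e) = pair A B := by
  unfold pair
  rw [Matrix.submatrix_mul_equiv]
  simp only [Matrix.trace, Matrix.diag_apply, Matrix.submatrix_apply]
  rw [Equiv.sum_comp e fun i => (A * B) i i]

lemma IsEffect.submatrix [DecidableEq ι] [DecidableEq κ] {A : Matrix ι ι ℂ} (hA : IsEffect A)
    (e : κ ≃ ι) : IsEffect (A.submatrix e e) := by
  refine ⟨hA.posSemidef.submatrix e, ?_⟩
  have := hA.le_one.submatrix e
  rwa [Matrix.submatrix_sub, Pi.sub_apply, Pi.sub_apply, Matrix.submatrix_one_equiv] at this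

end Submatrices

section Windows

variable {b : ℕ} {β : Type*}

/-- Splits off the blocks `j` and `j + 1`. -/
def windowEquiv (j : Fin b) : (Fin (b + 1) → β) ≃
    (β × β) × ({i : Fin (b + 1) // i ≠ j.castSucc ∧ i ≠ j.succ} → β) where
  toFun s := ((s j.castSucc, s j.succ), fun i => s i)
  invFun q := fun i => if h : i ≠ j.castSucc ∧ i ≠ j.succ then q.2 ⟨i, h⟩ else
    if i = j.castSucc then q.1.1 else q.1.2
  left_inv s := by
    ext i
    dsimp only
    split_ifs with h h2
    · rfl
    · rw [h2]
    · have : i = j.succ := by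
        by_contra h3; exact h ⟨h2, h3⟩
      rw [this]
  right_inv q := by
    have hne : j.succ ≠ j.castSucc := (Fin.castSucc_lt_succ (i := j)).ne'
    refine Prod.ext (Prod.ext ?_ ?_) ?_
    · simp
    · simp [hne]
    · ext i
      simp [i.2.1, i.2.2]

/-- Up to reindexing, a window operator is `A ⊗ 1`, so its algebra is that of Kronecker products. -/
lemma windowOp_eq_submatrix [DecidableEq β] (j : Fin b) (A : Matrix (β × β) (β × β) ℂ) :
    windowOp j A = (A ⊗ₖ (1 : Matrix ({i : Fin (b + 1) // i ≠ j.castSucc ∧ i ≠ j.succ} → β) _ ℂ)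
      ).submatrix (windowEquiv j) (windowEquiv j) := by
  ext s t
  simp only [windowOp, Matrix.of_apply, Matrix.submatrix_apply, Matrix.kroneckerMap_apply,
    Matrix.one_apply, windowEquiv, Equiv.coe_fn_mk, mul_ite, mul_one, mul_zero]
  congr 1
  simp [funext_iff]

lemma windowOp_mul [Fintype β] [DecidableEq β] (j : Fin b) (A B : Matrix (β × β) (β × β) ℂ) :
    windowOp j A * windowOp j B = windowOp j (A * B) := by
  rw [windowOp_eq_submatrix, windowOp_eq_submatrix, windowOp_eq_submatrix,
    Matrix.submatrix_mul_equiv, ← Matrix.mul_kronecker_mul, one_mul]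

lemma windowOp_isEffect [Fintype β] [DecidableEq β] (j : Fin b) {A : Matrix (β × β) (β × β) ℂ}
    (hA : IsEffect A) : IsEffect (windowOp j A) := by
  rw [windowOp_eq_submatrix]
  exact (hA.kronecker IsEffect.one).submatrix _

lemma one_sub_windowOp [DecidableEq β] (j : Fin b) (A : Matrix (β × β) (β × β) ℂ) :
    1 - windowOp j A = windowOp j (1 - A) := by
  rw [windowOp_eq_submatrix, windowOp_eq_submatrix, sub_kronecker', Matrix.one_kronecker_one,
    Matrix.submatrix_sub, Pi.sub_apply, Pi.sub_apply, Matrix.submatrix_one_equiv]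

lemma tensorBlocks_eq_submatrix (ρ : Fin (b + 1) → Matrix β β ℂ) (j : Fin b) :
    tensorBlocks ρ = ((ρ j.castSucc ⊗ₖ ρ j.succ) ⊗ₖ
      piTensor fun i : {i : Fin (b + 1) // i ≠ j.castSucc ∧ i ≠ j.succ} => ρ i).submatrix
        (windowEquiv j) (windowEquiv j) := by
  ext s t
  simp only [tensorBlocks, piTensor, Matrix.of_apply, Matrix.submatrix_apply,
    Matrix.kroneckerMap_apply, windowEquiv, Equiv.coe_fn_mk]
  have hne : j.castSucc ≠ j.succ := (Fin.castSucc_lt_succ (i := j)).ne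
  rw [← Finset.mul_prod_erase _ _ (Finset.mem_univ j.castSucc),
    ← Finset.mul_prod_erase _ _ (Finset.mem_erase.2 ⟨hne.symm, Finset.mem_univ j.succ⟩), mul_assoc]
  congr 2
  refine Finset.prod_subtype _ (fun i => ?_) _
  simp [and_comm]

lemma trace_re_mem {ι : Type*} [Fintype ι] {A : Matrix ι ι ℂ} (hA : A.PosSemidef) :
    A.trace = (A.trace.re : ℂ) ∧ 0 ≤ A.trace.re := by
  have := Complex.le_def.1 hA.trace_nonneg
  exact ⟨Complex.ext rfl (by simpa using this.2.symm), this.1⟩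

lemma trace_piTensor_re {I : Type*} [Fintype I] [DecidableEq I] [Fintype β] {ρ : I → Matrix β β ℂ}
    (hρ : ∀ i, (ρ i).PosSemidef) : (piTensor ρ).trace.re = ∏ i, (ρ i).trace.re := by
  rw [trace_piTensor, Finset.prod_congr rfl fun i _ => (trace_re_mem (hρ i)).1,
    ← Complex.ofReal_prod, Complex.ofReal_re]

/-- The blocks outside the window contribute the product of their traces, which is at most 1 for
subnormalized states. -/
lemma pair_windowOp_le [Fintype β] [DecidableEq β] {ρ : Fin (b + 1) → Matrix β β ℂ}
    (hρ : ∀ i, (ρ i).PosSemidef) (hρ1 : ∀ i, (ρ i).trace.re ≤ 1) (j : Fin b)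
    {A : Matrix (β × β) (β × β) ℂ} (hA : A.PosSemidef) :
    pair (windowOp j A) (tensorBlocks ρ) ≤ pair A (ρ j.castSucc ⊗ₖ ρ j.succ) := by
  have hk := posSemidef_kronecker (hρ j.castSucc) (hρ j.succ)
  rw [windowOp_eq_submatrix, tensorBlocks_eq_submatrix ρ j, pair_submatrix,
    pair_kronecker _ _ _ _ hA.1 hk.1, pair_one_left, trace_piTensor_re
      (ρ := fun i : {i : Fin (b + 1) // i ≠ j.castSucc ∧ i ≠ j.succ} => ρ i) fun i => hρ i]
  refine mul_le_of_le_one_right (pair_nonneg hA hk) ?_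
  exact Finset.prod_le_one (fun i _ => (trace_re_mem (hρ i)).2) fun i _ => hρ1 i

end Windows

/-! ### Effect of the relay's measurement on the destination -/

section RelayMeasurement

lemma marginal_posSemidef {α ι κ : Type*} [Fintype ι] [Fintype κ] (f : α → κ → ι)
    {A : Matrix ι ι ℂ} (hA : A.PosSemidef) : (marginal f A).PosSemidef := by
  have : marginal f A = ∑ k, A.submatrix (fun i => f i k) (fun i => f i k) := by
    ext i j; simp [marginal, Matrix.sum_apply]
  rw [this]
  exact Matrix.posSemidef_sum _ fun k _ => hA.submatrix _

variable {α β : Type*} [Fintype α] [Fintype β]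

lemma trace_marginal_fst (ω : Matrix (α × β) (α × β) ℂ) :
    (marginal (fun (a : α) (b : β) => (a, b)) ω).trace = ω.trace := by
  simp [Matrix.trace, marginal, Fintype.sum_prod_type]

lemma trace_marginal_snd (ω : Matrix (α × β) (α × β) ℂ) :
    (marginal (fun (b : β) (a : α) => (a, b)) ω).trace = ω.trace := by
  simp only [Matrix.trace, marginal, Fintype.sum_prod_type, Matrix.diag_apply, Matrix.of_apply]
  exact Finset.sum_comm

variable [DecidableEq β]

lemma afterRelay_apply (E : Matrix α α ℂ) (ω : Matrix (α × β) (α × β) ℂ) (b b' : β) :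
    afterRelay E ω b b' = ∑ a, ∑ a', E a a' * ω (a', b) (a, b') := by
  simp [afterRelay, marginal, Matrix.mul_apply, Fintype.sum_prod_type, Matrix.one_apply]

lemma afterRelay_sub (E F : Matrix α α ℂ) (ω : Matrix (α × β) (α × β) ℂ) :
    afterRelay (E - F) ω = afterRelay E ω - afterRelay F ω := by
  ext b b'
  simp [afterRelay_apply, sub_mul]

lemma afterRelay_one [DecidableEq α] (ω : Matrix (α × β) (α × β) ℂ) :
    afterRelay 1 ω = marginal (fun (b : β) (a : α) => (a, b)) ω := by
  simp [afterRelay]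

/-- With `E = K²`, one factor `K` can be moved to the other side of `ω`, as the partial trace is
cyclic for operators on the traced system. -/
lemma afterRelay_posSemidef [DecidableEq α] {E : Matrix α α ℂ} {ω : Matrix (α × β) (α × β) ℂ}
    (hE : E.PosSemidef) (hω : ω.PosSemidef) : (afterRelay E ω).PosSemidef := by
  obtain ⟨K, hK, hKE⟩ := exists_posSemidef_sqrt hE
  have hKk : (K ⊗ₖ (1 : Matrix β β ℂ))ᴴ = K ⊗ₖ 1 := by
    rw [Matrix.conjTranspose_kronecker, hK.1.eq, Matrix.conjTranspose_one]
  have h := hω.mul_mul_conjTranspose_same (K ⊗ₖ (1 : Matrix β β ℂ))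
  have : afterRelay E ω = marginal (fun (b : β) (a : α) => (a, b))
      ((K ⊗ₖ (1 : Matrix β β ℂ)) * ω * (K ⊗ₖ (1 : Matrix β β ℂ))ᴴ) := by
    rw [hKk, afterRelay, ← hKE, ← one_mul (1 : Matrix β β ℂ), Matrix.mul_kronecker_mul, mul_assoc,
      one_mul]
    generalize (K ⊗ₖ (1 : Matrix β β ℂ)) * ω = M
    ext b b'
    simp only [marginal, Matrix.of_apply, Matrix.mul_apply, Fintype.sum_prod_type,
      Matrix.kroneckerMap_apply, Matrix.one_apply, mul_ite, mul_one, mul_zero, ite_mul, zero_mul,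
      Finset.sum_ite_eq, Finset.sum_ite_eq', Finset.mem_univ, if_true]
    rw [Finset.sum_comm]
    exact Finset.sum_congr rfl fun a _ => Finset.sum_congr rfl fun a' _ => mul_comm _ _
  rw [this]
  exact marginal_posSemidef _ h

lemma trace_afterRelay_re (E : Matrix α α ℂ) (ω : Matrix (α × β) (α × β) ℂ) :
    (afterRelay E ω).trace.re = pair E (marginal (fun (a : α) (b : β) => (a, b)) ω) := by
  unfold pair
  congr 1
  simp only [Matrix.trace, Matrix.diag_apply, afterRelay_apply, Matrix.mul_apply, marginal,
    Matrix.of_apply, Finset.mul_sum]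
  rw [Finset.sum_comm]
  exact Finset.sum_congr rfl fun a _ => Finset.sum_comm

end RelayMeasurement

/-- A union bound, by induction from `x + y - 1 ≤ x y` on the unit interval. -/
lemma one_sub_sum_le_prod {I : Type*} (s : Finset I) (x : I → ℝ) (h0 : ∀ i, 0 ≤ x i)
    (h1 : ∀ i, x i ≤ 1) : 1 - ∑ i ∈ s, (1 - x i) ≤ ∏ i ∈ s, x i := by
  classical
  induction s using Finset.induction_on with
  | empty => simp
  | insert a s ha ih =>
    rw [Finset.sum_insert ha, Finset.prod_insert ha]
    have : ∏ i ∈ s, x i ≤ 1 := Finset.prod_le_one (fun i _ => h0 i) fun i _ => h1 i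
    nlinarith [h0 a, h1 a]

/-! ### Success probability of a code -/

section Outputs

variable {X X₁ B₁ B : Type*} [Fintype B₁] [Fintype B] (N : RelayChannel X X₁ B₁ B)

lemma blockState_eq_submatrix {n : ℕ} (x : Fin n → X) (x₁ : Fin n → X₁) :
    blockState N x x₁ = (piTensor fun i => N.state (x i) (x₁ i)).submatrix
      (Equiv.arrowProdEquivProdArrow (Fin n) (fun _ => B₁) (fun _ => B)).symm
      (Equiv.arrowProdEquivProdArrow (Fin n) (fun _ => B₁) (fun _ => B)).symm := by
  ext s t; rfl

lemma trace_blockState {n : ℕ} (x : Fin n → X) (x₁ : Fin n → X₁) :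
    (blockState N x x₁).trace = 1 := by
  have : (blockState N x x₁).trace = (piTensor fun i => N.state (x i) (x₁ i)).trace := by
    rw [blockState_eq_submatrix]
    simp only [Matrix.trace, Matrix.diag_apply, Matrix.submatrix_apply]
    exact Equiv.sum_comp _ fun i => (piTensor fun i => N.state (x i) (x₁ i)) i i
  rw [this, trace_piTensor]
  simp [N.trace_eq_one]

/-- The output state at the destination of a block. -/
def destOut {n : ℕ} (x : Fin n → X) (x₁ : Fin n → X₁) : Matrix (Fin n → B) (Fin n → B) ℂ :=
  marginal (fun (t : Fin n → B) (s : Fin n → B₁) => (s, t)) (blockState N x x₁)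

/-- The output state at the relay of a block. -/
def relayOut {n : ℕ} (x : Fin n → X) (x₁ : Fin n → X₁) : Matrix (Fin n → B₁) (Fin n → B₁) ℂ :=
  marginal (fun (s : Fin n → B₁) (t : Fin n → B) => (s, t)) (blockState N x x₁)

lemma trace_destOut {n : ℕ} (x : Fin n → X) (x₁ : Fin n → X₁) : (destOut N x x₁).trace = 1 := by
  rw [destOut, trace_marginal_snd, trace_blockState]

lemma trace_relayOut {n : ℕ} (x : Fin n → X) (x₁ : Fin n → X₁) : (relayOut N x x₁).trace = 1 := by
  rw [relayOut, trace_marginal_fst, trace_blockState]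

end Outputs

section CodeError

variable {X X₁ B₁ B : Type*} [Fintype B₁] [Fintype B] [DecidableEq B₁] [DecidableEq B]
  (N : RelayChannel X X₁ B₁ B)

lemma blockState_posSemidef {n : ℕ} (x : Fin n → X) (x₁ : Fin n → X₁) :
    (blockState N x x₁).PosSemidef := by
  rw [blockState_eq_submatrix]
  exact (piTensor_posSemidef fun i => N.posSemidef _ _).submatrix _

lemma destOut_posSemidef {n : ℕ} (x : Fin n → X) (x₁ : Fin n → X₁) :
    (destOut N x x₁).PosSemidef := marginal_posSemidef _ (blockState_posSemidef N x x₁)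

lemma relayOut_posSemidef {n : ℕ} (x : Fin n → X) (x₁ : Fin n → X₁) :
    (relayOut N x x₁).PosSemidef := marginal_posSemidef _ (blockState_posSemidef N x x₁)

namespace PDFCode

variable {n b : ℕ} (c : PDFCode X X₁ B₁ B n b)

lemma relayEffect_isEffect (lhat : Fin b → Fin c.cardL) (j : Fin (b + 1)) :
    IsEffect (c.relayEffect lhat j) := by
  refine Fin.lastCases ?_ (fun j => ?_) j
  · simpa [relayEffect] using IsEffect.one
  · simp only [relayEffect, Fin.snoc_castSucc]
    refine ⟨c.relayPOVM_posSemidef _ _ _, ?_⟩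
    rw [← c.relayPOVM_sum j (c.prevL lhat j.castSucc),
      ← Finset.sum_erase_eq_sub (Finset.mem_univ (lhat j))]
    exact Matrix.posSemidef_sum _ fun i _ => c.relayPOVM_posSemidef _ _ _

lemma destState_posSemidef (m : Fin b → Fin c.cardM) (l lhat : Fin b → Fin c.cardL) :
    (c.destState N m l lhat).PosSemidef :=
  piTensor_posSemidef fun _ => afterRelay_posSemidef (c.relayEffect_isEffect _ _).posSemidef
    (blockState_posSemidef N _ _)

lemma outcomeProb_nonneg (m : Fin b → Fin c.cardM) (l lhat : Fin b → Fin c.cardL)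
    (d : Fin b → Fin c.cardM × Fin c.cardL) : 0 ≤ c.outcomeProb N m l lhat d :=
  (trace_re_mem ((c.destState_posSemidef N m l lhat).mul_mul_conjTranspose_same _)).2

/-- The word of the source in block `j` when nothing goes wrong. -/
def sentSource (m : Fin b → Fin c.cardM) (l : Fin b → Fin c.cardL) (j : Fin (b + 1)) : Fin n → X :=
  c.sourceWord j (c.curM m j) (c.curL l j) (c.prevL l j)

/-- The word of the relay in block `j` when nothing goes wrong. -/
def sentRelay (l : Fin b → Fin c.cardL) (j : Fin (b + 1)) : Fin n → X₁ :=
  c.relayWord j (c.prevL l j)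

/-- All estimates are correct with high probability if each of them, considered on its own, is. -/
lemma le_outcomeProb (hK : ∀ j ℓ' d, IsEffect (c.destKraus j ℓ' d)) (m : Fin b → Fin c.cardM)
    (l : Fin b → Fin c.cardL) :
    1 - (∑ j : Fin b, (pair (1 - c.relayPOVM j (c.prevL l j.castSucc) (l j))
          (relayOut N (c.sentSource m l j.castSucc) (c.sentRelay l j.castSucc))
        + 2 * √(pair (1 - c.destKraus j (c.prevL l j.castSucc) (m j, l j)
              * c.destKraus j (c.prevL l j.castSucc) (m j, l j))
            (destOut N (c.sentSource m l j.castSucc) (c.sentRelay l j.castSucc) ⊗ₖ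
              destOut N (c.sentSource m l j.succ) (c.sentRelay l j.succ)))))
      ≤ c.outcomeProb N m l l fun j => (m j, l j) := by
  set ω := fun j => blockState N (c.sentSource m l j) (c.sentRelay l j) with hω
  -- These states are subnormalized: the trace of `ρ j` is the probability that the relay's outcome
  -- in block `j` is correct when its previous estimate is.
  set ρ := fun j => afterRelay (c.relayEffect l j) (ω j) with hρdef
  have hωp : ∀ j, (ω j).PosSemidef := fun j => blockState_posSemidef N _ _
  have hρ : ∀ j, (ρ j).PosSemidef := fun j =>
    afterRelay_posSemidef (c.relayEffect_isEffect _ _).posSemidef (hωp j)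
  have htr : ∀ j, 1 - (ρ j).trace.re = pair (1 - c.relayEffect l j)
      (relayOut N (c.sentSource m l j) (c.sentRelay l j)) := by
    intro j
    rw [hρdef, trace_afterRelay_re, pair_sub_left, pair_one_left, trace_relayOut, Complex.one_re]
    rfl
  have hρ1 : ∀ j, (ρ j).trace.re ≤ 1 := fun j => by
    have := pair_nonneg (c.relayEffect_isEffect l j).le_one
      (relayOut_posSemidef N (c.sentSource m l j) (c.sentRelay l j))
    linarith [htr j]
  have hstate : c.destState N m l l = tensorBlocks ρ := rfl
  have hstate_tr : (tensorBlocks ρ).trace.re = ∏ j, (ρ j).trace.re := trace_piTensor_re hρ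
  -- Conditioning on one outcome of the relay only lowers the unnormalized state, so the tests of
  -- the destination may be evaluated on the full output.
  have hle : ∀ j, (destOut N (c.sentSource m l j) (c.sentRelay l j) - ρ j).PosSemidef := by
    intro j
    have := afterRelay_posSemidef (c.relayEffect_isEffect l j).le_one (hωp j)
    rwa [afterRelay_sub, afterRelay_one] at this
  set K := fun j : Fin b => c.destKraus j (c.prevL l j.castSucc) (m j, l j) with hKdef
  have hgentle := gentle_sequence (List.ofFn fun j : Fin b => windowOp j (K j)).reverse
    (by
      intro A hA
      rw [List.mem_reverse, List.mem_ofFn] at hA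
      obtain ⟨j, rfl⟩ := hA
      exact windowOp_isEffect j (hK _ _ _))
    (piTensor_posSemidef hρ) (by
      rw [trace_piTensor_re hρ]
      exact Finset.prod_le_one (fun j _ => (trace_re_mem (hρ j)).2) fun j _ => hρ1 j)
  have hsum : ((List.ofFn fun j : Fin b => windowOp j (K j)).reverse.map
      fun A => √(pair (1 - A * A) (tensorBlocks ρ))).sum
      ≤ ∑ j, √(pair (1 - K j * K j)
        (destOut N (c.sentSource m l j.castSucc) (c.sentRelay l j.castSucc) ⊗ₖ
              destOut N (c.sentSource m l j.succ) (c.sentRelay l j.succ))) := by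
    rw [List.map_reverse, List.sum_reverse, List.map_ofFn, List.sum_ofFn]
    refine Finset.sum_le_sum fun j _ => Real.sqrt_le_sqrt ?_
    have hKK : (1 - K j * K j).PosSemidef := by
      have := (hK j (c.prevL l j.castSucc) (m j, l j)).sq
      rwa [(hK j (c.prevL l j.castSucc) (m j, l j)).posSemidef.1.eq] at this
    dsimp only [Function.comp]
    rw [windowOp_mul, one_sub_windowOp]
    refine (pair_windowOp_le hρ hρ1 j hKK).trans (pair_mono_right hKK ?_)
    have := (posSemidef_kronecker (hle j.castSucc) (hρ j.succ)).add
      (posSemidef_kronecker (destOut_posSemidef N (c.sentSource m l j.castSucc)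
        (c.sentRelay l j.castSucc)) (hle j.succ))
    convert this using 1
    rw [sub_kronecker', kronecker_sub']; abel
  have hprod : 1 - ∑ j : Fin b, pair (1 - c.relayPOVM j (c.prevL l j.castSucc) (l j))
      (relayOut N (c.sentSource m l j.castSucc) (c.sentRelay l j.castSucc))
      ≤ (tensorBlocks ρ).trace.re := by
    rw [hstate_tr]
    refine le_trans (le_of_eq ?_) (one_sub_sum_le_prod Finset.univ _
      (fun j => (trace_re_mem (hρ j)).2) hρ1)
    simp only [htr]
    -- The effect of the relay in the last block is 1 and contributes no error.
    rw [Fin.sum_univ_castSucc]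
    simp [relayEffect, pair]
  have hop : c.destOp (fun j => (m j, l j)) =
      (List.ofFn fun j : Fin b => windowOp j (K j)).reverse.prod :=
    rfl
  rw [outcomeProb, hstate, hop]
  rw [Finset.sum_add_distrib, ← Finset.mul_sum]
  rw [← tensorBlocks_eq_piTensor] at hgentle
  linarith

/-- Joint correctness implies correctness at the relay and at the destination, so each of the two
errors is at most the probability that anything fails. -/
lemma error_le : c.error N ≤ 2 * (1 - (∑ m : Fin b → Fin c.cardM, ∑ l : Fin b → Fin c.cardL,
    c.outcomeProb N m l l fun j => (m j, l j)) / ((c.cardM : ℝ) * c.cardL) ^ b) := by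
  have h1 : ∑ m : Fin b → Fin c.cardM, ∑ l : Fin b → Fin c.cardL,
      (c.outcomeProb N m l l fun j => (m j, l j))
      ≤ ∑ m : Fin b → Fin c.cardM, ∑ l : Fin b → Fin c.cardL, ∑ d, c.outcomeProb N m l l d :=
    Finset.sum_le_sum fun m _ => Finset.sum_le_sum fun l _ =>
      Finset.single_le_sum (f := fun d => c.outcomeProb N m l l d)
        (fun d _ => c.outcomeProb_nonneg N m l l d) (Finset.mem_univ _)
  have h2 : ∑ m : Fin b → Fin c.cardM, ∑ l : Fin b → Fin c.cardL,
      (c.outcomeProb N m l l fun j => (m j, l j))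
      ≤ ∑ m : Fin b → Fin c.cardM, ∑ l : Fin b → Fin c.cardL, ∑ lhat,
        c.outcomeProb N m l lhat fun j => (m j, l j) :=
    Finset.sum_le_sum fun m _ => Finset.sum_le_sum fun l _ =>
      Finset.single_le_sum (f := fun lhat => c.outcomeProb N m l lhat fun j => (m j, l j))
        (fun lhat _ => c.outcomeProb_nonneg N m l lhat _) (Finset.mem_univ _)
  have hc : (0 : ℝ) ≤ ((c.cardM : ℝ) * c.cardL) ^ b := by positivity
  have h3 := div_le_div_of_nonneg_right h1 hc
  have h4 := div_le_div_of_nonneg_right h2 hc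
  unfold error relayError destError
  linarith

end PDFCode

end CodeError


/-! ### Finite probability and random superposition codebooks -/

section WeightedSums

/-- `w` is a probability distribution on a finite set. -/
structure IsProb {α : Type*} [Fintype α] (w : α → ℝ) : Prop where
  nonneg : ∀ a, 0 ≤ w a
  sum_eq_one : ∑ a, w a = 1

/-- The expectation of `g` for the distribution `w`. -/
def wsum {α : Type*} [Fintype α] (w g : α → ℝ) : ℝ := ∑ a, w a * g a

/-- The product distribution on functions. -/
def prodWeight {I α : Type*} [Fintype I] (w : I → α → ℝ) (f : I → α) : ℝ := ∏ i, w i (f i)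

variable {I α β : Type*} [Fintype I] [Fintype α] [Fintype β]

lemma wsum_const {w : α → ℝ} (hw : IsProb w) (k : ℝ) : wsum w (fun _ => k) = k := by
  rw [wsum, ← Finset.sum_mul, hw.sum_eq_one, one_mul]

lemma wsum_mono {w : α → ℝ} (hw : IsProb w) {g h : α → ℝ} (hgh : ∀ a, g a ≤ h a) :
    wsum w g ≤ wsum w h :=
  Finset.sum_le_sum fun a _ => mul_le_mul_of_nonneg_left (hgh a) (hw.nonneg a)

lemma wsum_le {w : α → ℝ} (hw : IsProb w) {g : α → ℝ} {k : ℝ} (hg : ∀ a, g a ≤ k) :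
    wsum w g ≤ k := (wsum_mono hw hg).trans (wsum_const hw k).le

lemma wsum_nonneg {w : α → ℝ} (hw : IsProb w) {g : α → ℝ} (hg : ∀ a, 0 ≤ g a) : 0 ≤ wsum w g :=
  Finset.sum_nonneg fun a _ => mul_nonneg (hw.nonneg a) (hg a)

lemma wsum_add (w g h : α → ℝ) : wsum w (fun a => g a + h a) = wsum w g + wsum w h := by
  simp [wsum, mul_add, Finset.sum_add_distrib]

lemma wsum_mul_left (w g : α → ℝ) (k : ℝ) : wsum w (fun a => k * g a) = k * wsum w g := by
  simp only [wsum, Finset.mul_sum]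
  exact Finset.sum_congr rfl fun a _ => by ring

lemma wsum_sum {γ : Type*} (s : Finset γ) (w : α → ℝ) (g : γ → α → ℝ) :
    wsum w (fun a => ∑ c ∈ s, g c a) = ∑ c ∈ s, wsum w (g c) := by
  simp only [wsum, Finset.mul_sum]
  exact Finset.sum_comm

lemma wsum_comm (v : α → ℝ) (w : β → ℝ) (g : α → β → ℝ) :
    wsum v (fun a => wsum w fun b => g a b) = wsum w fun b => wsum v fun a => g a b := by
  simp only [wsum, Finset.mul_sum]
  rw [Finset.sum_comm]
  exact Finset.sum_congr rfl fun a _ => Finset.sum_congr rfl fun b _ => by ring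

/-- This extracts one good choice of codebooks from a bound on the average. -/
lemma exists_le_wsum {w : α → ℝ} (hw : IsProb w) (g : α → ℝ) : ∃ a, g a ≤ wsum w g := by
  by_contra! h
  have hpos : ∃ a, 0 < w a := by
    by_contra! h0
    have := Finset.sum_nonpos (s := Finset.univ) fun a _ => h0 a
    linarith [hw.sum_eq_one]
  obtain ⟨a, ha⟩ := hpos
  have : wsum w (fun _ => wsum w g) < wsum w g :=
    Finset.sum_lt_sum (fun a _ => mul_le_mul_of_nonneg_left (h a).le (hw.nonneg a))
      ⟨a, Finset.mem_univ a, mul_lt_mul_of_pos_left (h a) ha⟩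
  rw [wsum_const hw] at this
  exact lt_irrefl _ this

lemma wsum_sqrt_le {w : α → ℝ} (hw : IsProb w) {g : α → ℝ} (hg : ∀ a, 0 ≤ g a) :
    wsum w (fun a => √(g a)) ≤ √(wsum w g) := by
  have := Real.strictConcaveOn_sqrt.concaveOn.le_map_sum (t := Finset.univ) (w := w) (p := g)
    (fun a _ => hw.nonneg a) hw.sum_eq_one fun a _ => hg a
  simpa [wsum] using this

variable [DecidableEq I]

lemma sum_prod_apply (k : I → α → ℝ) : ∑ f : I → α, ∏ i, k i (f i) = ∏ i, ∑ a, k i a := by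
  rw [Finset.prod_univ_sum, Fintype.piFinset_univ]

lemma IsProb.prodWeight {w : I → α → ℝ} (hw : ∀ i, IsProb (w i)) :
    IsProb (QRelay.prodWeight w) := by
  refine ⟨fun f => Finset.prod_nonneg fun i _ => (hw i).nonneg _, ?_⟩
  simp only [QRelay.prodWeight]
  rw [sum_prod_apply]
  simp [(hw _).sum_eq_one]

lemma wsum_prodWeight_mul {w : I → α → ℝ} (hw : ∀ i, IsProb (w i)) {i j : I} (hij : i ≠ j)
    (g h : α → ℝ) :
    wsum (prodWeight w) (fun f => g (f i) * h (f j)) = wsum (w i) g * wsum (w j) h := by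
  have h1 : ∀ f : I → α, prodWeight w f * (g (f i) * h (f j))
      = ∏ k, w k (f k) * ((if k = i then g (f k) else 1) * if k = j then h (f k) else 1) := by
    intro f
    rw [Finset.prod_mul_distrib, Finset.prod_mul_distrib, Finset.prod_ite_eq', Finset.prod_ite_eq']
    simp [prodWeight]
  have h2 : ∀ k, ∑ a, w k a * ((if k = i then g a else 1) * if k = j then h a else 1)
      = (if k = i then wsum (w k) g else 1) * if k = j then wsum (w k) h else 1 := by
    intro k
    by_cases hki : k = i
    · subst hki
      simp [hij, wsum]
    · by_cases hkj : k = j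
      · subst hkj
        simp [hki, wsum]
      · simp [hki, hkj, (hw k).sum_eq_one]
  rw [wsum, Finset.sum_congr rfl fun f _ => h1 f,
    sum_prod_apply fun k a => w k a * ((if k = i then g a else 1) * if k = j then h a else 1),
    Finset.prod_congr rfl fun k _ => h2 k, Finset.prod_mul_distrib, Finset.prod_ite_eq',
    Finset.prod_ite_eq']
  simp

lemma wsum_prodWeight_apply {w : I → α → ℝ} (hw : ∀ i, IsProb (w i)) (i : I) (g : α → ℝ) :
    wsum (prodWeight w) (fun f => g (f i)) = wsum (w i) g := by
  have h1 : ∀ f : I → α, prodWeight w f * g (f i)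
      = ∏ k, w k (f k) * (if k = i then g (f k) else 1) := by
    intro f
    rw [Finset.prod_mul_distrib, Finset.prod_ite_eq']
    simp [prodWeight]
  have h2 : ∀ k, ∑ a, w k a * (if k = i then g a else 1)
      = if k = i then wsum (w k) g else 1 := by
    intro k
    by_cases hki : k = i
    · simp [hki, wsum]
    · simp [hki, (hw k).sum_eq_one]
  rw [wsum, Finset.sum_congr rfl fun f _ => h1 f,
    sum_prod_apply fun k a => w k a * (if k = i then g a else 1),
    Finset.prod_congr rfl fun k _ => h2 k, Finset.prod_ite_eq']
  simp

lemma wsum_prodWeight_apply₂ {w : I → α → ℝ} (hw : ∀ i, IsProb (w i)) {i j : I} (hij : i ≠ j)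
    (g : α → α → ℝ) :
    wsum (prodWeight w) (fun f => g (f i) (f j))
      = wsum (w i) fun a => wsum (w j) fun b => g a b := by
  classical
  -- Splitting by the value of `f i` makes every term a product of functions of single coordinates.
  have h1 : ∀ f : I → α, g (f i) (f j)
      = ∑ c, (if f i = c then 1 else 0) * g c (f j) := fun f => by simp
  simp only [h1]
  rw [wsum_sum]
  rw [Finset.sum_congr rfl fun c _ =>
    wsum_prodWeight_mul hw hij (fun a => if a = c then (1 : ℝ) else 0) (g c)]
  simp [wsum]

lemma IsProb.posSemidef_sum {ι : Type*} {w : α → ℝ} (hw : IsProb w) {s : α → Matrix ι ι ℂ}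
    (hs : ∀ a, (s a).PosSemidef) : (∑ a, w a • s a).PosSemidef :=
  Matrix.posSemidef_sum _ fun a _ => (hs a).smul (hw.nonneg a)

variable {ι : Type*} [Fintype ι]

lemma wsum_pair_right (w : α → ℝ) (T : Matrix ι ι ℂ) (s : α → Matrix ι ι ℂ) :
    wsum w (fun a => pair T (s a)) = pair T (∑ a, w a • s a) := by
  simp [wsum, pair_sum_right, pair_smul_right]

lemma IsProb.trace_sum {w : α → ℝ} (hw : IsProb w) {s : α → Matrix ι ι ℂ}
    (hs : ∀ a, (s a).trace = 1) : (∑ a, w a • s a).trace = 1 := by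
  rw [Matrix.trace_sum]
  simp only [Matrix.trace_smul, hs, Complex.real_smul, mul_one]
  rw [← Complex.ofReal_sum, hw.sum_eq_one, Complex.ofReal_one]

end WeightedSums

/-- A distribution of a symbol `a₁` of the relay, an auxiliary symbol `a₂` and a symbol `a₃` of the
source, factored as `p(a₁) p(a₂|a₁) p(a₃|a₁,a₂)`. -/
structure Ensemble (A₁ A₂ A₃ : Type*) [Fintype A₁] [Fintype A₂] [Fintype A₃] where
  w₁ : A₁ → ℝ
  w₂ : A₁ → A₂ → ℝ
  w₃ : A₁ → A₂ → A₃ → ℝ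
  isProb₁ : IsProb w₁
  isProb₂ : ∀ a₁, IsProb (w₂ a₁)
  isProb₃ : ∀ a₁ a₂, IsProb (w₃ a₁ a₂)

namespace Ensemble

variable {A₁ A₂ A₃ : Type*} [Fintype A₁] [Fintype A₂] [Fintype A₃] (E : Ensemble A₁ A₂ A₃)

/-- The expectation over the symbols. -/
def mean (g : A₁ → A₂ → A₃ → ℝ) : ℝ :=
  wsum E.w₁ fun a₁ => wsum (E.w₂ a₁) fun a₂ => wsum (E.w₃ a₁ a₂) fun a₃ => g a₁ a₂ a₃

lemma mean_mono {g h : A₁ → A₂ → A₃ → ℝ} (hgh : ∀ a₁ a₂ a₃, g a₁ a₂ a₃ ≤ h a₁ a₂ a₃) :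
    E.mean g ≤ E.mean h :=
  wsum_mono E.isProb₁ fun _ => wsum_mono (E.isProb₂ _) fun _ => wsum_mono (E.isProb₃ _ _) fun _ =>
    hgh _ _ _

lemma mean_add (g h : A₁ → A₂ → A₃ → ℝ) :
    E.mean (fun a₁ a₂ a₃ => g a₁ a₂ a₃ + h a₁ a₂ a₃) = E.mean g + E.mean h := by
  simp only [mean, wsum_add]

lemma mean_mul_left (k : ℝ) (g : A₁ → A₂ → A₃ → ℝ) :
    E.mean (fun a₁ a₂ a₃ => k * g a₁ a₂ a₃) = k * E.mean g := by
  simp only [mean, wsum_mul_left]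

lemma mean_sqrt_le {g : A₁ → A₂ → A₃ → ℝ} (hg : ∀ a₁ a₂ a₃, 0 ≤ g a₁ a₂ a₃) :
    E.mean (fun a₁ a₂ a₃ => √(g a₁ a₂ a₃)) ≤ √(E.mean g) := by
  have h3 := fun a₁ a₂ => wsum_nonneg (E.isProb₃ a₁ a₂) (hg a₁ a₂)
  have h2 := fun a₁ => wsum_nonneg (E.isProb₂ a₁) (h3 a₁)
  refine le_trans ?_ (wsum_sqrt_le E.isProb₁ h2)
  refine wsum_mono E.isProb₁ fun a₁ => ?_
  refine le_trans ?_ (wsum_sqrt_le (E.isProb₂ a₁) (h3 a₁))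
  exact wsum_mono (E.isProb₂ a₁) fun a₂ => wsum_sqrt_le (E.isProb₃ a₁ a₂) (hg a₁ a₂)

section States

variable {ι : Type*} (s : A₁ → A₃ → Matrix ι ι ℂ)

/-- The average output given `a₁` and `a₂`. -/
def out₂ (a₁ : A₁) (a₂ : A₂) : Matrix ι ι ℂ := ∑ a₃, E.w₃ a₁ a₂ a₃ • s a₁ a₃

/-- The average output given `a₁`. -/
def out₁ (a₁ : A₁) : Matrix ι ι ℂ := ∑ a₂, E.w₂ a₁ a₂ • E.out₂ s a₁ a₂

/-- The average output. -/
def out₀ : Matrix ι ι ℂ := ∑ a₁, E.w₁ a₁ • E.out₁ s a₁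

variable {s}

lemma out₂_posSemidef (hs : ∀ a₁ a₃, (s a₁ a₃).PosSemidef) (a₁ : A₁) (a₂ : A₂) :
    (E.out₂ s a₁ a₂).PosSemidef := (E.isProb₃ a₁ a₂).posSemidef_sum (hs a₁)

lemma out₁_posSemidef (hs : ∀ a₁ a₃, (s a₁ a₃).PosSemidef) (a₁ : A₁) :
    (E.out₁ s a₁).PosSemidef := (E.isProb₂ a₁).posSemidef_sum (E.out₂_posSemidef hs a₁)

lemma out₀_posSemidef (hs : ∀ a₁ a₃, (s a₁ a₃).PosSemidef) : (E.out₀ s).PosSemidef :=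
  E.isProb₁.posSemidef_sum (E.out₁_posSemidef hs)

variable [Fintype ι]

lemma trace_out₂ (hs : ∀ a₁ a₃, (s a₁ a₃).trace = 1) (a₁ : A₁) (a₂ : A₂) :
    (E.out₂ s a₁ a₂).trace = 1 := (E.isProb₃ a₁ a₂).trace_sum (hs a₁)

lemma trace_out₁ (hs : ∀ a₁ a₃, (s a₁ a₃).trace = 1) (a₁ : A₁) :
    (E.out₁ s a₁).trace = 1 := (E.isProb₂ a₁).trace_sum (E.trace_out₂ hs a₁)

lemma trace_out₀ (hs : ∀ a₁ a₃, (s a₁ a₃).trace = 1) : (E.out₀ s).trace = 1 :=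
  E.isProb₁.trace_sum (E.trace_out₁ hs)

variable (s)

lemma mean_pair₂ (T : A₁ → A₂ → Matrix ι ι ℂ) :
    E.mean (fun a₁ a₂ a₃ => pair (T a₁ a₂) (s a₁ a₃))
      = wsum E.w₁ fun a₁ => wsum (E.w₂ a₁) fun a₂ => pair (T a₁ a₂) (E.out₂ s a₁ a₂) := by
  simp only [mean, wsum_pair_right, out₂]

lemma mean_pair₁ (T : A₁ → Matrix ι ι ℂ) :
    E.mean (fun a₁ _ a₃ => pair (T a₁) (s a₁ a₃))
      = wsum E.w₁ fun a₁ => pair (T a₁) (E.out₁ s a₁) := by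
  simp only [mean_pair₂ E s fun a₁ _ => T a₁, wsum_pair_right, out₁]

lemma mean_pair₀ (T : Matrix ι ι ℂ) :
    E.mean (fun a₁ _ a₃ => pair T (s a₁ a₃)) = pair T (E.out₀ s) := by
  simp only [mean_pair₁ E s fun _ => T, wsum_pair_right, out₀]

end States

end Ensemble

/-- The words of the relay, the auxiliary words and the words of the source in one block. They are
indexed by `ℓ'`, by `(ℓ, ℓ')` and by `(m, ℓ, ℓ')`, where `ℓ'` belongs to the block before. -/
abbrev Codebook (M L A₁ A₂ A₃ : Type*) := (L → A₁) × (L × L → A₂) × (M × L × L → A₃)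

namespace Ensemble

variable {A₁ A₂ A₃ M L : Type*} [Fintype A₁] [Fintype A₂] [Fintype A₃] [Fintype M] [Fintype L]
  (E : Ensemble A₁ A₂ A₃)

/-- The distribution of the auxiliary words, given those of the relay. -/
def auxWeight (x₁ : L → A₁) : (L × L → A₂) → ℝ := prodWeight fun q => E.w₂ (x₁ q.2)

/-- The distribution of the words of the source, given the other words. -/
def sourceWeight (x₁ : L → A₁) (u : L × L → A₂) : (M × L × L → A₃) → ℝ :=
  prodWeight fun r => E.w₃ (x₁ r.2.2) (u r.2)

/-- The distribution of the superposition codebook. -/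
def bookWeight (C : Codebook M L A₁ A₂ A₃) : ℝ :=
  prodWeight (fun _ => E.w₁) C.1 * (E.auxWeight C.1 C.2.1 * E.sourceWeight C.1 C.2.1 C.2.2)

variable [DecidableEq M] [DecidableEq L]

lemma isProb_relayWeight : IsProb (prodWeight fun _ : L => E.w₁) :=
  IsProb.prodWeight fun _ => E.isProb₁

lemma isProb_auxWeight (x₁ : L → A₁) : IsProb (E.auxWeight x₁) :=
  IsProb.prodWeight fun _ => E.isProb₂ _

lemma isProb_sourceWeight (x₁ : L → A₁) (u : L × L → A₂) :
    IsProb (E.sourceWeight (M := M) x₁ u) := IsProb.prodWeight fun _ => E.isProb₃ _ _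

lemma wsum_bookWeight (g : Codebook M L A₁ A₂ A₃ → ℝ) :
    wsum E.bookWeight g = wsum (prodWeight fun _ => E.w₁) fun x₁ => wsum (E.auxWeight x₁) fun u =>
      wsum (E.sourceWeight x₁ u) fun x => g (x₁, u, x) := by
  simp only [wsum, bookWeight, Fintype.sum_prod_type, Finset.mul_sum]
  exact Finset.sum_congr rfl fun _ _ => Finset.sum_congr rfl fun _ _ =>
    Finset.sum_congr rfl fun _ _ => by ring

lemma isProb_bookWeight : IsProb (E.bookWeight (M := M) (L := L)) := by
  refine ⟨fun C => ?_, ?_⟩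
  · exact mul_nonneg (E.isProb_relayWeight.nonneg _)
      (mul_nonneg ((E.isProb_auxWeight _).nonneg _) ((E.isProb_sourceWeight _ _).nonneg _))
  · have := E.wsum_bookWeight (M := M) (L := L) (fun _ => 1)
    simp only [wsum_const (E.isProb_sourceWeight _ _), wsum_const (E.isProb_auxWeight _),
      wsum_const E.isProb_relayWeight] at this
    simpa [wsum] using this

/-- The words that belong to one message are distributed according to the ensemble. -/
lemma wsum_bookWeight_words (g : A₁ → A₂ → A₃ → ℝ) (m : M) (l l' : L) :
    wsum E.bookWeight (fun C : Codebook M L A₁ A₂ A₃ => g (C.1 l') (C.2.1 (l, l')) (C.2.2 (m, l, l')))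
      = E.mean g := by
  rw [wsum_bookWeight]
  have h3 : ∀ (x₁ : L → A₁) (u : L × L → A₂),
      wsum (E.sourceWeight x₁ u) (fun x : M × L × L → A₃ => g (x₁ l') (u (l, l')) (x (m, l, l')))
        = wsum (E.w₃ (x₁ l') (u (l, l'))) (g (x₁ l') (u (l, l'))) := fun x₁ u =>
    wsum_prodWeight_apply (fun r : M × L × L => E.isProb₃ (x₁ r.2.2) (u r.2)) (m, l, l') _
  simp only [h3]
  have h2 : ∀ x₁ : L → A₁, wsum (E.auxWeight x₁) (fun u =>
      wsum (E.w₃ (x₁ l') (u (l, l'))) (g (x₁ l') (u (l, l'))))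
      = wsum (E.w₂ (x₁ l')) fun a₂ => wsum (E.w₃ (x₁ l') a₂) (g (x₁ l') a₂) := fun x₁ =>
    wsum_prodWeight_apply (fun q : L × L => E.isProb₂ (x₁ q.2)) (l, l')
      fun a₂ => wsum (E.w₃ (x₁ l') a₂) (g (x₁ l') a₂)
  simp only [h2]
  exact wsum_prodWeight_apply (fun _ : L => E.isProb₁) l'
    fun a₁ => wsum (E.w₂ a₁) fun a₂ => wsum (E.w₃ a₁ a₂) (g a₁ a₂)

variable {ι : Type*} [Fintype ι] (s : A₁ → A₃ → Matrix ι ι ℂ)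

/-- A source word is independent of the one of a message that differs in `m`. -/
lemma wsum_bookWeight_ne_m (T : A₁ → A₂ → A₃ → Matrix ι ι ℂ) {m m' : M} (hm : m' ≠ m)
    (l l' : L) {k : ℝ}
    (hT : ∀ a₁ a₂, wsum (E.w₃ a₁ a₂) (fun a₃ => pair (T a₁ a₂ a₃) (E.out₂ s a₁ a₂)) ≤ k) :
    wsum E.bookWeight (fun C : Codebook M L A₁ A₂ A₃ =>
      pair (T (C.1 l') (C.2.1 (l, l')) (C.2.2 (m', l, l'))) (s (C.1 l') (C.2.2 (m, l, l')))) ≤ k := by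
  rw [wsum_bookWeight]
  refine wsum_le E.isProb_relayWeight fun x₁ => wsum_le (E.isProb_auxWeight x₁) fun u => ?_
  have h := wsum_prodWeight_apply₂ (fun r : M × L × L => E.isProb₃ (x₁ r.2.2) (u r.2))
    (i := (m', l, l')) (j := (m, l, l')) (by simp [hm])
    (fun a b => pair (T (x₁ l') (u (l, l')) a) (s (x₁ l') b))
  simp only [wsum_pair_right] at h
  exact h.trans_le (hT _ _)

/-- Source and auxiliary words are independent, given the relay word, of those of a message that
differs in `ℓ`. -/
lemma wsum_bookWeight_ne_l (T : A₁ → A₂ → A₃ → Matrix ι ι ℂ) (m m' : M) {l₀ l : L} (hl : l₀ ≠ l)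
    (l' : L) {k : ℝ}
    (hT : ∀ a₁ a₂, wsum (E.w₃ a₁ a₂) (fun a₃ => pair (T a₁ a₂ a₃) (E.out₁ s a₁)) ≤ k) :
    wsum E.bookWeight (fun C : Codebook M L A₁ A₂ A₃ =>
      pair (T (C.1 l') (C.2.1 (l₀, l')) (C.2.2 (m', l₀, l'))) (s (C.1 l') (C.2.2 (m, l, l'))))
      ≤ k := by
  rw [wsum_bookWeight]
  refine wsum_le E.isProb_relayWeight fun x₁ => ?_
  -- With the relay word fixed, the sent source word averages to `out₂`; averaging its auxiliary
  -- word then gives `out₁`. Both are independent of the tested words.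
  have h3 : ∀ u : L × L → A₂, wsum (E.sourceWeight x₁ u) (fun x : M × L × L → A₃ =>
      pair (T (x₁ l') (u (l₀, l')) (x (m', l₀, l'))) (s (x₁ l') (x (m, l, l'))))
      = wsum (E.w₃ (x₁ l') (u (l₀, l'))) fun a₃ =>
        pair (T (x₁ l') (u (l₀, l')) a₃) (E.out₂ s (x₁ l') (u (l, l'))) := by
    intro u
    have h := wsum_prodWeight_apply₂ (fun r : M × L × L => E.isProb₃ (x₁ r.2.2) (u r.2))
      (i := (m', l₀, l')) (j := (m, l, l')) (by simp [hl])
      (fun a b => pair (T (x₁ l') (u (l₀, l')) a) (s (x₁ l') b))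
    simp only [wsum_pair_right] at h
    exact h
  simp only [h3]
  have h2 := wsum_prodWeight_apply₂ (fun q : L × L => E.isProb₂ (x₁ q.2))
    (i := (l₀, l')) (j := (l, l')) (by simp [hl])
    (fun a b => wsum (E.w₃ (x₁ l') a) fun a₃ => pair (T (x₁ l') a a₃) (E.out₂ s (x₁ l') b))
  refine h2.trans_le (wsum_le (E.isProb₂ _) fun a₂ => ?_)
  rw [wsum_comm]
  simp only [wsum_pair_right]
  exact hT _ _

/-- The words of a message are independent of the relay word of another one. -/
lemma wsum_bookWeight_ne_relay (T : A₁ → Matrix ι ι ℂ) (m : M) (l : L) {l₀ l' : L} (hl : l₀ ≠ l')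
    {k : ℝ} (hT : ∀ a₁, pair (T a₁) (E.out₀ s) ≤ k) :
    wsum E.bookWeight (fun C : Codebook M L A₁ A₂ A₃ =>
      pair (T (C.1 l₀)) (s (C.1 l') (C.2.2 (m, l, l')))) ≤ k := by
  rw [wsum_bookWeight]
  have h3 : ∀ (x₁ : L → A₁) (u : L × L → A₂),
      wsum (E.sourceWeight x₁ u) (fun x : M × L × L → A₃ =>
        pair (T (x₁ l₀)) (s (x₁ l') (x (m, l, l'))))
      = pair (T (x₁ l₀)) (E.out₂ s (x₁ l') (u (l, l'))) := by
    intro x₁ u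
    have h := wsum_prodWeight_apply (fun r : M × L × L => E.isProb₃ (x₁ r.2.2) (u r.2))
      (m, l, l') (fun b => pair (T (x₁ l₀)) (s (x₁ l') b))
    exact h.trans (wsum_pair_right _ _ _)
  simp only [h3]
  have h2 : ∀ x₁ : L → A₁, wsum (E.auxWeight x₁) (fun u =>
      pair (T (x₁ l₀)) (E.out₂ s (x₁ l') (u (l, l'))))
      = pair (T (x₁ l₀)) (E.out₁ s (x₁ l')) := by
    intro x₁
    have h := wsum_prodWeight_apply (fun q : L × L => E.isProb₂ (x₁ q.2))
      (l, l') (fun b => pair (T (x₁ l₀)) (E.out₂ s (x₁ l') b))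
    exact h.trans (wsum_pair_right _ _ _)
  simp only [h2]
  have h1 := wsum_prodWeight_apply₂ (fun _ : L => E.isProb₁) hl
    (fun a b => pair (T a) (E.out₁ s b))
  simp only [wsum_pair_right] at h1
  exact h1.trans_le (wsum_le E.isProb₁ hT)

end Ensemble


/-! ### Acceptance and false acceptance of the tests -/

namespace Ensemble

variable {A₁ A₂ A₃ : Type*} [Fintype A₁] [Fintype A₂] [Fintype A₃] (E : Ensemble A₁ A₂ A₃)
  {ι : Type*} [Fintype ι] [DecidableEq ι] (s : A₁ → A₃ → Matrix ι ι ℂ)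

/-- The test of the destination for the words of a message in the block of this message. -/
def blockTest (t₀ t₁ t₂ : ℝ) (a₁ : A₁) (a₂ : A₂) (a₃ : A₃) : Matrix ι ι ℂ :=
  sandwich (specProj (s a₁ a₃) (Set.Ici t₀)) (specProj (E.out₂ s a₁ a₂) (Set.Iic t₁))
    (specProj (E.out₁ s a₁) (Set.Iic t₂))

/-- The test of the relay for an auxiliary word. -/
def relayTest (t₀ t₁ : ℝ) (a₁ : A₁) (a₂ : A₂) : Matrix ι ι ℂ :=
  sandwich (specProj (E.out₂ s a₁ a₂) (Set.Ici t₀)) 1 (specProj (E.out₁ s a₁) (Set.Iic t₁))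

/-- The test of the destination for a relay word in the block after that of the message. -/
def nextTest (t₀ t₁ : ℝ) (a₁ : A₁) : Matrix ι ι ℂ :=
  sandwich (specProj (E.out₁ s a₁) (Set.Ici t₀)) 1 (specProj (E.out₀ s) (Set.Iic t₁))

lemma blockTest_isEffect (t₀ t₁ t₂ : ℝ) (a₁ : A₁) (a₂ : A₂) (a₃ : A₃) :
    IsEffect (E.blockTest s t₀ t₁ t₂ a₁ a₂ a₃) :=
  sandwich_isEffect (specProj_isEffect _ _) (specProj_isEffect _ _) (specProj_isEffect _ _)

lemma relayTest_isEffect (t₀ t₁ : ℝ) (a₁ : A₁) (a₂ : A₂) :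
    IsEffect (E.relayTest s t₀ t₁ a₁ a₂) :=
  sandwich_isEffect (specProj_isEffect _ _) IsEffect.one (specProj_isEffect _ _)

lemma nextTest_isEffect (t₀ t₁ : ℝ) (a₁ : A₁) : IsEffect (E.nextTest s t₀ t₁ a₁) :=
  sandwich_isEffect (specProj_isEffect _ _) IsEffect.one (specProj_isEffect _ _)

/-- The eigenvalues of a state sum to 1, so at most `1 / t` of them reach `t`. -/
lemma trace_specProj_Ici_le {S : Matrix ι ι ℂ} (hS : S.PosSemidef) (hS1 : S.trace = 1) {t : ℝ}
    (ht : 0 < t) : (specProj S (Set.Ici t)).trace.re ≤ t⁻¹ := by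
  have := pair_specProj_Ici_le hS Matrix.PosSemidef.one ht
  rw [pair_comm, pair_one_left, pair_comm, pair_one_left, hS1, Complex.one_re, mul_one] at this
  exact this

variable {s} (hs : ∀ a₁ a₃, (s a₁ a₃).PosSemidef) (hs1 : ∀ a₁ a₃, (s a₁ a₃).trace = 1)
include hs hs1

/-- The block test rarely accepts a source word that is independent, given the other words, of the
one that was sent. -/
lemma wsum_blockTest_out₂_le {t₀ t₁ : ℝ} (t₂ : ℝ) (h₀ : 0 < t₀) (h₁ : 0 ≤ t₁) (a₁ : A₁) (a₂ : A₂) :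
    wsum (E.w₃ a₁ a₂) (fun a₃ => pair (E.blockTest s t₀ t₁ t₂ a₁ a₂ a₃) (E.out₂ s a₁ a₂))
      ≤ t₁ / t₀ := by
  set S := E.out₂ s a₁ a₂ with hSdef
  have hS : S.PosSemidef := E.out₂_posSemidef hs a₁ a₂
  have hS1 : S.trace = 1 := E.trace_out₂ hs1 a₁ a₂
  set P₁ := specProj S (Set.Iic t₁) with hP₁
  set P₂ := specProj (E.out₁ s a₁) (Set.Iic t₂) with hP₂
  have hP₁h : P₁.IsHermitian := specProj_isHermitian _ _
  have hP₂h : P₂.IsHermitian := specProj_isHermitian _ _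
  have hZ : (P₂ * S * P₂).PosSemidef := by
    have := hS.conjTranspose_mul_mul_same P₂
    rwa [hP₂h.eq] at this
  have hY : (P₁ * (P₂ * S * P₂) * P₁).PosSemidef := by
    have := hZ.conjTranspose_mul_mul_same P₁
    rwa [hP₁h.eq] at this
  -- `P₂` stands between `P₁` and the state and need not commute with it, so `P₁` cannot cap the
  -- state directly. Bounding the lower cut by `t₀⁻¹ s a₁ a₃` and averaging over `a₃` brings a
  -- second copy of `S` next to `P₁`.
  have h1 : ∀ a₃, pair (E.blockTest s t₀ t₁ t₂ a₁ a₂ a₃) S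
      ≤ t₀⁻¹ * pair (P₁ * (P₂ * S * P₂) * P₁) (s a₁ a₃) := by
    intro a₃
    rw [blockTest, sandwich, pair_conj hP₂h, pair_conj hP₁h, pair_comm _ (s a₁ a₃)]
    exact pair_specProj_Ici_le (hs a₁ a₃) hY h₀
  refine (wsum_mono (E.isProb₃ a₁ a₂) h1).trans ?_
  rw [wsum_mul_left, wsum_pair_right, div_eq_inv_mul]
  refine mul_le_mul_of_nonneg_left ?_ (inv_nonneg.2 h₀.le)
  change pair (P₁ * (P₂ * S * P₂) * P₁) S ≤ t₁
  rw [pair_conj hP₁h]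
  -- Now `P₁ S P₁ ≤ t₁`, and the remaining `P₂ S P₂` has trace at most 1.
  refine (pair_mono_right hZ (specProj_Iic_conj_le hS.1 h₁)).trans ?_
  rw [pair_smul_right, pair_conj hP₂h, mul_one, specProj_mul_self, pair_comm]
  have := (specProj_isEffect (E.out₁ s a₁) (Set.Iic t₂)).pair_le_trace hS
  rw [hS1, Complex.one_re] at this
  exact mul_le_of_le_one_right h₁ this

/-- The block test rarely accepts words that are independent of the words that were sent, given
the relay word. -/
lemma wsum_blockTest_out₁_le {t₀ t₂ : ℝ} (t₁ : ℝ) (h₀ : 0 < t₀) (h₂ : 0 ≤ t₂) (a₁ : A₁) (a₂ : A₂) :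
    wsum (E.w₃ a₁ a₂) (fun a₃ => pair (E.blockTest s t₀ t₁ t₂ a₁ a₂ a₃) (E.out₁ s a₁))
      ≤ t₂ / t₀ := by
  refine wsum_le (E.isProb₃ a₁ a₂) fun a₃ => ?_
  refine (pair_sandwich_le_mul_trace (specProj_isEffect _ _) (specProj_isEffect _ _)
    (specProj_mul_self _ _) (specProj_isHermitian _ _) h₂
    (specProj_Iic_conj_le (E.out₁_posSemidef hs a₁).1 h₂)).trans ?_
  rw [div_eq_mul_inv]
  exact mul_le_mul_of_nonneg_left (trace_specProj_Ici_le (hs a₁ a₃) (hs1 a₁ a₃) h₀) h₂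

/-- The upper cut caps the averaged state at `t₁`, and the lower cut has rank at most `1 / t₀`. The
ratio will yield the exponent `I(U;B₁|X₁)`. -/
lemma pair_relayTest_out₁_le {t₀ t₁ : ℝ} (h₀ : 0 < t₀) (h₁ : 0 ≤ t₁) (a₁ : A₁) (a₂ : A₂) :
    pair (E.relayTest s t₀ t₁ a₁ a₂) (E.out₁ s a₁) ≤ t₁ / t₀ := by
  refine (pair_sandwich_le_mul_trace (specProj_isEffect _ _) IsEffect.one
    (one_mul _) (specProj_isHermitian _ _) h₁
    (specProj_Iic_conj_le (E.out₁_posSemidef hs a₁).1 h₁)).trans ?_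
  rw [div_eq_mul_inv]
  exact mul_le_mul_of_nonneg_left (trace_specProj_Ici_le (E.out₂_posSemidef hs a₁ a₂)
    (E.trace_out₂ hs1 a₁ a₂) h₀) h₁

lemma pair_nextTest_out₀_le {t₀ t₁ : ℝ} (h₀ : 0 < t₀) (h₁ : 0 ≤ t₁) (a₁ : A₁) :
    pair (E.nextTest s t₀ t₁ a₁) (E.out₀ s) ≤ t₁ / t₀ := by
  refine (pair_sandwich_le_mul_trace (specProj_isEffect _ _) IsEffect.one
    (one_mul _) (specProj_isHermitian _ _) h₁
    (specProj_Iic_conj_le (E.out₀_posSemidef hs).1 h₁)).trans ?_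
  rw [div_eq_mul_inv]
  exact mul_le_mul_of_nonneg_left (trace_specProj_Ici_le (E.out₁_posSemidef hs a₁)
    (E.trace_out₁ hs1 a₁) h₀) h₁

/-- If the three projections are likely to accept, so is the test composed of them. -/
lemma mean_one_sub_sandwich_le (P₀ P₁ P₂ : A₁ → A₂ → A₃ → Matrix ι ι ℂ)
    (h₀ : ∀ a₁ a₂ a₃, (P₀ a₁ a₂ a₃).IsHermitian) (h₁ : ∀ a₁ a₂ a₃, (P₁ a₁ a₂ a₃).IsHermitian)
    (h₂ : ∀ a₁ a₂ a₃, (P₂ a₁ a₂ a₃).IsHermitian)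
    (h₀' : ∀ a₁ a₂ a₃, P₀ a₁ a₂ a₃ * P₀ a₁ a₂ a₃ = P₀ a₁ a₂ a₃)
    (h₁' : ∀ a₁ a₂ a₃, P₁ a₁ a₂ a₃ * P₁ a₁ a₂ a₃ = P₁ a₁ a₂ a₃)
    (h₂' : ∀ a₁ a₂ a₃, P₂ a₁ a₂ a₃ * P₂ a₁ a₂ a₃ = P₂ a₁ a₂ a₃) {ε : ℝ}
    (he₀ : E.mean (fun a₁ a₂ a₃ => pair (1 - P₀ a₁ a₂ a₃) (s a₁ a₃)) ≤ ε)
    (he₁ : E.mean (fun a₁ a₂ a₃ => pair (1 - P₁ a₁ a₂ a₃) (s a₁ a₃)) ≤ ε)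
    (he₂ : E.mean (fun a₁ a₂ a₃ => pair (1 - P₂ a₁ a₂ a₃) (s a₁ a₃)) ≤ ε) :
    E.mean (fun a₁ a₂ a₃ =>
      pair (1 - sandwich (P₀ a₁ a₂ a₃) (P₁ a₁ a₂ a₃) (P₂ a₁ a₂ a₃)) (s a₁ a₃)) ≤ 6 * √ε := by
  have hroot : ∀ P : A₁ → A₂ → A₃ → Matrix ι ι ℂ, (∀ a₁ a₂ a₃, (P a₁ a₂ a₃).IsHermitian) →
      (∀ a₁ a₂ a₃, P a₁ a₂ a₃ * P a₁ a₂ a₃ = P a₁ a₂ a₃) →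
      E.mean (fun a₁ a₂ a₃ => pair (1 - P a₁ a₂ a₃) (s a₁ a₃)) ≤ ε →
      E.mean (fun a₁ a₂ a₃ => √(pair (1 - P a₁ a₂ a₃) (s a₁ a₃))) ≤ √ε := by
    intro P hP hPP he
    refine (E.mean_sqrt_le fun a₁ a₂ a₃ => ?_).trans (Real.sqrt_le_sqrt he)
    exact pair_nonneg (isEffect_of_proj (hP _ _ _) (hPP _ _ _)).le_one (hs _ _)
  refine (E.mean_mono fun a₁ a₂ a₃ => pair_one_sub_sandwich_le (h₀ a₁ a₂ a₃) (h₁ a₁ a₂ a₃)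
    (h₂ a₁ a₂ a₃) (h₀' a₁ a₂ a₃) (h₁' a₁ a₂ a₃) (h₂' a₁ a₂ a₃) (hs a₁ a₃) (hs1 a₁ a₃)).trans ?_
  rw [mean_mul_left, mean_add, mean_add]
  have := hroot P₀ h₀ h₀' he₀
  have := hroot P₁ h₁ h₁' he₁
  have := hroot P₂ h₂ h₂' he₂
  linarith

/-- A cut that ignores some of the words sees only the output averaged over them, so each of the
three failures is that of a spectral projection on its own state. -/
lemma mean_one_sub_blockTest_le {t₀ t₁ t₂ ε : ℝ}
    (he₀ : E.mean (fun a₁ _ a₃ => pair (1 - specProj (s a₁ a₃) (Set.Ici t₀)) (s a₁ a₃)) ≤ ε)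
    (he₁ : wsum E.w₁ (fun a₁ => wsum (E.w₂ a₁) fun a₂ =>
      pair (1 - specProj (E.out₂ s a₁ a₂) (Set.Iic t₁)) (E.out₂ s a₁ a₂)) ≤ ε)
    (he₂ : wsum E.w₁ (fun a₁ =>
      pair (1 - specProj (E.out₁ s a₁) (Set.Iic t₂)) (E.out₁ s a₁)) ≤ ε) :
    E.mean (fun a₁ a₂ a₃ => pair (1 - E.blockTest s t₀ t₁ t₂ a₁ a₂ a₃) (s a₁ a₃)) ≤ 6 * √ε := by
  refine E.mean_one_sub_sandwich_le hs hs1 _ _ _ (fun _ _ _ => specProj_isHermitian _ _)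
    (fun _ _ _ => specProj_isHermitian _ _) (fun _ _ _ => specProj_isHermitian _ _)
    (fun _ _ _ => specProj_mul_self _ _) (fun _ _ _ => specProj_mul_self _ _)
    (fun _ _ _ => specProj_mul_self _ _) he₀ ?_ ?_
  · rwa [E.mean_pair₂ s fun a₁ a₂ => 1 - specProj (E.out₂ s a₁ a₂) (Set.Iic t₁)]
  · rwa [E.mean_pair₁ s fun a₁ => 1 - specProj (E.out₁ s a₁) (Set.Iic t₂)]

lemma mean_one_sub_relayTest_le {t₀ t₁ ε : ℝ}
    (he₀ : wsum E.w₁ (fun a₁ => wsum (E.w₂ a₁) fun a₂ =>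
      pair (1 - specProj (E.out₂ s a₁ a₂) (Set.Ici t₀)) (E.out₂ s a₁ a₂)) ≤ ε)
    (he₁ : wsum E.w₁ (fun a₁ =>
      pair (1 - specProj (E.out₁ s a₁) (Set.Iic t₁)) (E.out₁ s a₁)) ≤ ε) (hε : 0 ≤ ε) :
    E.mean (fun a₁ a₂ a₃ => pair (1 - E.relayTest s t₀ t₁ a₁ a₂) (s a₁ a₃)) ≤ 6 * √ε := by
  refine E.mean_one_sub_sandwich_le hs hs1 _ (fun _ _ _ => 1) _
    (fun _ _ _ => specProj_isHermitian _ _)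
    (fun _ _ _ => Matrix.isHermitian_one) (fun _ _ _ => specProj_isHermitian _ _)
    (fun _ _ _ => specProj_mul_self _ _) (fun _ _ _ => one_mul _)
    (fun _ _ _ => specProj_mul_self _ _) ?_ ?_ ?_
  · rwa [E.mean_pair₂ s fun a₁ a₂ => 1 - specProj (E.out₂ s a₁ a₂) (Set.Ici t₀)]
  · rw [E.mean_pair₀ s]
    simpa [pair] using hε
  · rwa [E.mean_pair₁ s fun a₁ => 1 - specProj (E.out₁ s a₁) (Set.Iic t₁)]

lemma mean_one_sub_nextTest_le {t₀ t₁ ε : ℝ}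
    (he₀ : wsum E.w₁ (fun a₁ =>
      pair (1 - specProj (E.out₁ s a₁) (Set.Ici t₀)) (E.out₁ s a₁)) ≤ ε)
    (he₁ : pair (1 - specProj (E.out₀ s) (Set.Iic t₁)) (E.out₀ s) ≤ ε) (hε : 0 ≤ ε) :
    E.mean (fun a₁ _ a₃ => pair (1 - E.nextTest s t₀ t₁ a₁) (s a₁ a₃)) ≤ 6 * √ε := by
  refine E.mean_one_sub_sandwich_le hs hs1 _ (fun _ _ _ => 1) _
    (fun _ _ _ => specProj_isHermitian _ _)
    (fun _ _ _ => Matrix.isHermitian_one) (fun _ _ _ => specProj_isHermitian _ _)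
    (fun _ _ _ => specProj_mul_self _ _) (fun _ _ _ => one_mul _)
    (fun _ _ _ => specProj_mul_self _ _) ?_ ?_ ?_
  · rwa [E.mean_pair₁ s fun a₁ => 1 - specProj (E.out₁ s a₁) (Set.Ici t₀)]
  · rw [E.mean_pair₀ s]
    simpa [pair] using hε
  · rwa [E.mean_pair₀ s]

end Ensemble


/-! ### Packing bounds for the two decoders -/

namespace Ensemble

variable {A₁ A₂ A₃ M L : Type*} [Fintype A₁] [Fintype A₂] [Fintype A₃] [Fintype M] [Fintype L]
  [DecidableEq M] [DecidableEq L] [Nonempty L] (E : Ensemble A₁ A₂ A₃)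
  {ι : Type*} [Fintype ι] [DecidableEq ι] {s : A₁ → A₃ → Matrix ι ι ℂ}

/-- Packing at the relay. -/
lemma exists_relayDecoder (hs : ∀ a₁ a₃, (s a₁ a₃).PosSemidef)
    (T : A₁ → A₂ → Matrix ι ι ℂ) (hT : ∀ a₁ a₂, IsEffect (T a₁ a₂)) {c k : ℝ}
    (hc : E.mean (fun a₁ a₂ a₃ => pair (1 - T a₁ a₂) (s a₁ a₃)) ≤ c)
    (hk : ∀ a₁ a₂, pair (T a₁ a₂) (E.out₁ s a₁) ≤ k) :
    ∃ Γ : Codebook M L A₁ A₂ A₃ → L → L → Matrix ι ι ℂ,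
      (∀ C l' l, (Γ C l' l).PosSemidef) ∧ (∀ C l', ∑ l, Γ C l' l = 1) ∧
      ∀ m l l', wsum E.bookWeight (fun C : Codebook M L A₁ A₂ A₃ =>
        pair (1 - Γ C l' l) (s (C.1 l') (C.2.2 (m, l, l'))))
          ≤ 2 * c + 4 * (((Fintype.card L : ℝ) - 1) * k) := by
  choose Γ h1 h2 h3 using fun (C : Codebook M L A₁ A₂ A₃) (l' : L) =>
    exists_povm (fun l => T (C.1 l') (C.2.1 (l, l'))) fun l => hT _ _
  refine ⟨Γ, h1, h2, fun m l l' => ?_⟩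
  refine (wsum_mono E.isProb_bookWeight fun C => h3 C l' l _ (hs _ _)).trans ?_
  rw [wsum_add, wsum_mul_left, wsum_mul_left, wsum_sum]
  have e1 := E.wsum_bookWeight_words (fun a₁ a₂ a₃ => pair (1 - T a₁ a₂) (s a₁ a₃)) m l l'
  refine add_le_add (mul_le_mul_of_nonneg_left (e1.trans_le hc) two_pos.le)
    (mul_le_mul_of_nonneg_left ?_ four_pos.le)
  refine (Finset.sum_le_card_nsmul _ _ k fun l₀ hl₀ => ?_).trans_eq ?_
  · refine E.wsum_bookWeight_ne_l s (fun a₁ a₂ _ => T a₁ a₂) m m (Finset.ne_of_mem_erase hl₀) l'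
      fun a₁ a₂ => ?_
    rw [wsum_const (E.isProb₃ _ _)]
    exact hk a₁ a₂
  · rw [Finset.card_erase_of_mem (Finset.mem_univ l), Finset.card_univ, nsmul_eq_mul,
      Nat.cast_sub Fintype.card_pos, Nat.cast_one]

/-- Simultaneous packing at the destination: the pair `(m, ℓ)` is decoded from two consecutive
blocks with independent codebooks. -/
lemma exists_destDecoder [Nonempty M] (hs : ∀ a₁ a₃, (s a₁ a₃).PosSemidef) (hs1 : ∀ a₁ a₃, (s a₁ a₃).trace = 1)
    (T : A₁ → A₂ → A₃ → Matrix ι ι ℂ) (hT : ∀ a₁ a₂ a₃, IsEffect (T a₁ a₂ a₃))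
    (S : A₁ → Matrix ι ι ℂ) (hS : ∀ a₁, IsEffect (S a₁)) {c d k₁ k₂ k₃ : ℝ}
    (hc : E.mean (fun a₁ a₂ a₃ => pair (1 - T a₁ a₂ a₃) (s a₁ a₃)) ≤ c)
    (hd : E.mean (fun a₁ _ a₃ => pair (1 - S a₁) (s a₁ a₃)) ≤ d)
    (hk₁ : ∀ a₁ a₂, wsum (E.w₃ a₁ a₂) (fun a₃ => pair (T a₁ a₂ a₃) (E.out₂ s a₁ a₂)) ≤ k₁)
    (hk₂ : ∀ a₁ a₂, wsum (E.w₃ a₁ a₂) (fun a₃ => pair (T a₁ a₂ a₃) (E.out₁ s a₁)) ≤ k₂)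
    (hk₃ : ∀ a₁, pair (S a₁) (E.out₀ s) ≤ k₃) (hk₃0 : 0 ≤ k₃) :
    ∃ K : Codebook M L A₁ A₂ A₃ → Codebook M L A₁ A₂ A₃ → L → M × L → Matrix (ι × ι) (ι × ι) ℂ,
      (∀ C C' l' q, IsEffect (K C C' l' q)) ∧
      (∀ C C' l', ∑ q, (K C C' l' q)ᴴ * K C C' l' q = 1) ∧
      ∀ m l l' m₂ l₂, wsum E.bookWeight (fun C : Codebook M L A₁ A₂ A₃ =>
        wsum E.bookWeight (fun C' : Codebook M L A₁ A₂ A₃ =>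
          pair (1 - K C C' l' (m, l) * K C C' l' (m, l))
            (s (C.1 l') (C.2.2 (m, l, l')) ⊗ₖ s (C'.1 l) (C'.2.2 (m₂, l₂, l)))))
          ≤ 2 * (c + d) + 4 * (((Fintype.card M : ℝ) - 1) * k₁
            + Fintype.card M * ((Fintype.card L : ℝ) - 1) * (k₂ * k₃)) := by
  choose Λ h1 h2 h3 using fun (C C' : Codebook M L A₁ A₂ A₃) (l' : L) =>
    exists_povm (fun q : M × L =>
      T (C.1 l') (C.2.1 (q.2, l')) (C.2.2 (q.1, q.2, l')) ⊗ₖ S (C'.1 q.2))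
      fun q => (hT _ _ _).kronecker (hS _)
  have hΛ : ∀ C C' l' q, IsEffect (Λ C C' l' q) := fun C C' l' q => ⟨h1 C C' l' q, by
    rw [← h2 C C' l', ← Finset.sum_erase_eq_sub (Finset.mem_univ q)]
    exact Matrix.posSemidef_sum _ fun i _ => h1 _ _ _ _⟩
  -- The positive square roots are taken as measurement operators, because `gentle_sequence` needs
  -- operators that are effects themselves.
  choose K hK hKΛ using fun C C' l' q => (hΛ C C' l' q).exists_sqrt
  refine ⟨K, hK, fun C C' l' => ?_, fun m l l' m₂ l₂ => ?_⟩
  · rw [← h2 C C' l']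
    exact Finset.sum_congr rfl fun q _ => by rw [(hK _ _ _ _).posSemidef.1.eq, hKΛ]
  set σ := fun C : Codebook M L A₁ A₂ A₃ => s (C.1 l') (C.2.2 (m, l, l')) with hσ
  set τ := fun C : Codebook M L A₁ A₂ A₃ => s (C.1 l) (C.2.2 (m₂, l₂, l)) with hτ
  set α := fun (q : M × L) (C : Codebook M L A₁ A₂ A₃) =>
    pair (T (C.1 l') (C.2.1 (q.2, l')) (C.2.2 (q.1, q.2, l'))) (σ C) with hα
  set γ := fun (q : M × L) (C : Codebook M L A₁ A₂ A₃) => pair (S (C.1 q.2)) (τ C) with hγ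
  have hσp : ∀ C, (σ C).PosSemidef := fun C => hs _ _
  have hτp : ∀ C, (τ C).PosSemidef := fun C => hs _ _
  have hα0 : ∀ q C, 0 ≤ α q C := fun q C => pair_nonneg (hT _ _ _).posSemidef (hσp C)
  have hγ0 : ∀ q C, 0 ≤ γ q C := fun q C => pair_nonneg (hS _).posSemidef (hτp C)
  have hα1 : ∀ q C, α q C ≤ 1 := fun q C => by
    have := (hT (C.1 l') (C.2.1 (q.2, l')) (C.2.2 (q.1, q.2, l'))).pair_le_trace (hσp C)
    simpa [hσ, hs1] using this
  have hγ1 : ∀ q C, γ q C ≤ 1 := fun q C => by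
    have := (hS (C.1 q.2)).pair_le_trace (hτp C)
    simpa [hτ, hs1] using this
  -- For the sent pair, `1 - α γ ≤ (1 - α) + (1 - γ)` on the unit interval; for a wrong pair,
  -- acceptance is a product of one factor for each block.
  have hkey : ∀ C C', pair (1 - K C C' l' (m, l) * K C C' l' (m, l)) (σ C ⊗ₖ τ C')
      ≤ 2 * ((1 - α (m, l) C) + (1 - γ (m, l) C'))
        + 4 * ∑ q ∈ Finset.univ.erase (m, l), α q C * γ q C' := by
    intro C C'
    rw [hKΛ]
    have hk := posSemidef_kronecker (hσp C) (hτp C')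
    have htr : (σ C ⊗ₖ τ C').trace = 1 := by
      rw [Matrix.trace_kronecker, hσ, hτ]; simp [hs1]
    refine (h3 C C' l' (m, l) _ hk).trans ?_
    have hp : ∀ q : M × L, pair (T (C.1 l') (C.2.1 (q.2, l')) (C.2.2 (q.1, q.2, l')) ⊗ₖ S (C'.1 q.2))
        (σ C ⊗ₖ τ C') = α q C * γ q C' := fun q =>
      pair_kronecker _ _ _ _ (hT _ _ _).posSemidef.1 (hσp C).1
    simp only [pair_sub_left, pair_one_left, htr, hp, Complex.one_re]
    have h0 := hp (m, l)
    simp only at h0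
    rw [h0]
    have := mul_nonneg (sub_nonneg.2 (hα1 (m, l) C)) (sub_nonneg.2 (hγ1 (m, l) C'))
    linarith
  refine (wsum_mono E.isProb_bookWeight fun C => wsum_mono E.isProb_bookWeight (hkey C)).trans ?_
  have hB := E.isProb_bookWeight (M := M) (L := L)
  simp only [wsum_add, wsum_mul_left, wsum_sum, wsum_const hB]
  have e1 : wsum E.bookWeight (fun C => 1 - α (m, l) C) ≤ c := by
    have := E.wsum_bookWeight_words (fun a₁ a₂ a₃ => pair (1 - T a₁ a₂ a₃) (s a₁ a₃)) m l l'
    simp only [pair_sub_left, pair_one_left, hs1, Complex.one_re] at this hc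
    exact this.trans_le hc
  have e2 : wsum E.bookWeight (fun C => 1 - γ (m, l) C) ≤ d := by
    have := E.wsum_bookWeight_words (fun a₁ _ a₃ => pair (1 - S a₁) (s a₁ a₃)) m₂ l₂ l
    simp only [pair_sub_left, pair_one_left, hs1, Complex.one_re] at this hd
    exact this.trans_le hd
  have hαw : ∀ q, 0 ≤ wsum E.bookWeight (α q) := fun q => wsum_nonneg hB (hα0 q)
  have e3 : ∑ q ∈ Finset.univ.erase (m, l),
      wsum E.bookWeight (fun C => α q C * wsum E.bookWeight (γ q))
      ≤ ∑ q ∈ Finset.univ.erase (m, l), if q.2 = l then k₁ else k₂ * k₃ := by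
    refine Finset.sum_le_sum fun q hq => ?_
    have hcomm : wsum E.bookWeight (fun C => α q C * wsum E.bookWeight (γ q))
        = wsum E.bookWeight (γ q) * wsum E.bookWeight (α q) := by
      rw [← wsum_mul_left]; congr 1; ext C; ring
    rw [hcomm]
    -- With the right `ℓ` the test of the next block gives no protection and is bounded by 1. With a
    -- wrong `ℓ` both tests have to fail to reject, and the independence of the codebooks multiplies
    -- their bounds.
    split_ifs with hql
    · have hqm : q.1 ≠ m := fun h => Finset.ne_of_mem_erase hq (Prod.ext h hql)
      have h := E.wsum_bookWeight_ne_m s T hqm l l' hk₁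
      have h' : wsum E.bookWeight (α q) ≤ k₁ := by simpa only [hα, hql] using h
      exact (mul_le_of_le_one_left (hαw q) (wsum_le hB (hγ1 q))).trans h'
    · have h := E.wsum_bookWeight_ne_l s T m q.1 hql l' hk₂
      have h' := E.wsum_bookWeight_ne_relay s S m₂ l₂ hql hk₃
      rw [mul_comm k₂]
      exact mul_le_mul h' h (hαw q) hk₃0
  have e4 : ∑ q ∈ Finset.univ.erase (m, l), (if q.2 = l then k₁ else k₂ * k₃)
      = ((Fintype.card M : ℝ) - 1) * k₁
            + Fintype.card M * ((Fintype.card L : ℝ) - 1) * (k₂ * k₃) := by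
    rw [Finset.sum_erase_eq_sub (Finset.mem_univ _), Fintype.sum_prod_type]
    have : ∑ l₀ : L, (if l₀ = l then k₁ else k₂ * k₃)
        = k₁ + ((Fintype.card L : ℝ) - 1) * (k₂ * k₃) := by
      rw [← Finset.add_sum_erase _ _ (Finset.mem_univ l), if_pos rfl]
      congr 1
      rw [Finset.sum_congr rfl fun x hx => if_neg (Finset.ne_of_mem_erase hx), Finset.sum_const,
        Finset.card_erase_of_mem (Finset.mem_univ l), Finset.card_univ, nsmul_eq_mul,
        Nat.cast_sub Fintype.card_pos, Nat.cast_one]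
    simp only [this, Finset.sum_const, Finset.card_univ, nsmul_eq_mul, if_true]
    ring
  linarith

end Ensemble

/-! ### From random codebooks to a fixed code -/

section RandomCode

variable {X X₁ B₁ B A₂ : Type*} [Fintype B₁] [Fintype B] [DecidableEq B₁] [DecidableEq B]
  {n b M L : ℕ}

/-- The code with the codebooks `Cs` and given decoders. -/
def bookCode [NeZero M] [NeZero L]
    (Cs : Fin (b + 1) → Codebook (Fin M) (Fin L) (Fin n → X₁) A₂ (Fin n → X))
    (Γ : Codebook (Fin M) (Fin L) (Fin n → X₁) A₂ (Fin n → X) → Fin L → Fin L →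
      Matrix (Fin n → B₁) (Fin n → B₁) ℂ)
    (hΓ : ∀ C l' l, (Γ C l' l).PosSemidef) (hΓ1 : ∀ C l', ∑ l, Γ C l' l = 1)
    (K : Codebook (Fin M) (Fin L) (Fin n → X₁) A₂ (Fin n → X) →
      Codebook (Fin M) (Fin L) (Fin n → X₁) A₂ (Fin n → X) → Fin L → Fin M × Fin L →
      Matrix ((Fin n → B) × (Fin n → B)) ((Fin n → B) × (Fin n → B)) ℂ)
    (hK1 : ∀ C C' l', ∑ q, (K C C' l' q)ᴴ * K C C' l' q = 1) : PDFCode X X₁ B₁ B n b where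
  cardM := M
  cardL := L
  m₀ := 0
  ℓ₀ := 0
  sourceWord j m l l' := (Cs j).2.2 (m, l, l')
  relayWord j l' := (Cs j).1 l'
  relayPOVM j l' l := Γ (Cs j.castSucc) l' l
  relayPOVM_posSemidef _ _ _ := hΓ _ _ _
  relayPOVM_sum _ _ := hΓ1 _ _
  destKraus j l' q := K (Cs j.castSucc) (Cs j.succ) l' q
  destKraus_sum _ _ := hK1 _ _ _

variable [Fintype X] [Fintype X₁] [Fintype A₂] (N : RelayChannel X X₁ B₁ B)

/-- Some codebook of the random superposition code is good. -/
lemma exists_bookCode (E : Ensemble (Fin n → X₁) A₂ (Fin n → X)) [NeZero M] [NeZero L]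
    (Γ : Codebook (Fin M) (Fin L) (Fin n → X₁) A₂ (Fin n → X) → Fin L → Fin L →
      Matrix (Fin n → B₁) (Fin n → B₁) ℂ)
    (hΓ : ∀ C l' l, (Γ C l' l).PosSemidef) (hΓ1 : ∀ C l', ∑ l, Γ C l' l = 1)
    (K : Codebook (Fin M) (Fin L) (Fin n → X₁) A₂ (Fin n → X) →
      Codebook (Fin M) (Fin L) (Fin n → X₁) A₂ (Fin n → X) → Fin L → Fin M × Fin L →
      Matrix ((Fin n → B) × (Fin n → B)) ((Fin n → B) × (Fin n → B)) ℂ)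
    (hK : ∀ C C' l' q, IsEffect (K C C' l' q))
    (hK1 : ∀ C C' l', ∑ q, (K C C' l' q)ᴴ * K C C' l' q = 1) {rel dst : ℝ}
    (hrel : ∀ m l l', wsum E.bookWeight (fun C : Codebook (Fin M) (Fin L) _ A₂ _ =>
        pair (1 - Γ C l' l) (relayOut N (C.2.2 (m, l, l')) (C.1 l'))) ≤ rel)
    (hdst : ∀ m l l' m₂ l₂, wsum E.bookWeight (fun C : Codebook (Fin M) (Fin L) _ A₂ _ =>
        wsum E.bookWeight (fun C' : Codebook (Fin M) (Fin L) _ A₂ _ =>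
          pair (1 - K C C' l' (m, l) * K C C' l' (m, l))
            (destOut N (C.2.2 (m, l, l')) (C.1 l') ⊗ₖ
              destOut N (C'.2.2 (m₂, l₂, l)) (C'.1 l)))) ≤ dst) :
    ∃ Cs, (bookCode (b := b) Cs Γ hΓ hΓ1 K hK1).error N ≤ 2 * (b * (rel + 2 * √dst)) := by
  -- The bound of `le_outcomeProb` on the failure probability, as a function of the codebooks and
  -- the messages.
  set bad := fun (Cs : Fin (b + 1) → Codebook (Fin M) (Fin L) (Fin n → X₁) A₂ (Fin n → X))
      (m : Fin b → Fin M) (l : Fin b → Fin L) =>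
    ∑ j : Fin b, (pair (1 - Γ (Cs j.castSucc) ((Fin.cons 0 l : Fin (b + 1) → Fin L) j.castSucc) (l j))
          (relayOut N ((Cs j.castSucc).2.2 (m j, l j, (Fin.cons 0 l : Fin (b + 1) → Fin L) j.castSucc))
            ((Cs j.castSucc).1 ((Fin.cons 0 l : Fin (b + 1) → Fin L) j.castSucc)))
        + 2 * √(pair (1 - K (Cs j.castSucc) (Cs j.succ)
                ((Fin.cons 0 l : Fin (b + 1) → Fin L) j.castSucc) (m j, l j)
              * K (Cs j.castSucc) (Cs j.succ)
                ((Fin.cons 0 l : Fin (b + 1) → Fin L) j.castSucc) (m j, l j))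
            (destOut N ((Cs j.castSucc).2.2
                (m j, l j, (Fin.cons 0 l : Fin (b + 1) → Fin L) j.castSucc))
                ((Cs j.castSucc).1 ((Fin.cons 0 l : Fin (b + 1) → Fin L) j.castSucc)) ⊗ₖ
              destOut N ((Cs j.succ).2.2 ((Fin.snoc m 0 : Fin (b + 1) → Fin M) j.succ,
                (Fin.snoc l 0 : Fin (b + 1) → Fin L) j.succ, l j)) ((Cs j.succ).1 (l j)))))
    with hbad
  have hB := E.isProb_bookWeight (M := Fin M) (L := Fin L)
  have hW := IsProb.prodWeight (I := Fin (b + 1)) fun _ => hB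
  have hmean : ∀ m l, wsum (prodWeight fun _ => E.bookWeight) (fun Cs => bad Cs m l)
      ≤ b * (rel + 2 * √dst) := by
    intro m l
    rw [hbad, wsum_sum]
    refine (Finset.sum_le_card_nsmul _ _ (rel + 2 * √dst) fun j _ => ?_).trans_eq
      (by rw [Finset.card_univ, Fintype.card_fin, nsmul_eq_mul])
    rw [wsum_add, wsum_mul_left]
    -- The two blocks of a window use different coordinates of the product distribution, hence
    -- independent codebooks.
    have hne : j.castSucc ≠ j.succ := (Fin.castSucc_lt_succ (i := j)).ne
    generalize (Fin.cons 0 l : Fin (b + 1) → Fin L) j.castSucc = l'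
    refine add_le_add ?_ (mul_le_mul_of_nonneg_left ?_ two_pos.le)
    · refine (wsum_prodWeight_apply (fun _ => hB) j.castSucc (fun C =>
        pair (1 - Γ C l' (l j)) (relayOut N (C.2.2 (m j, l j, l')) (C.1 l')))).trans_le ?_
      exact hrel _ _ _
    · refine (wsum_sqrt_le hW fun Cs => ?_).trans (Real.sqrt_le_sqrt ?_)
      · refine pair_nonneg ?_ (posSemidef_kronecker (destOut_posSemidef N _ _)
          (destOut_posSemidef N _ _))
        have h := hK (Cs j.castSucc) (Cs j.succ) l' (m j, l j)
        have := h.sq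
        rwa [h.posSemidef.1.eq] at this
      · generalize (Fin.snoc m 0 : Fin (b + 1) → Fin M) j.succ = m₂
        generalize (Fin.snoc l 0 : Fin (b + 1) → Fin L) j.succ = l₂
        refine (wsum_prodWeight_apply₂ (fun _ => hB) hne (fun C C' =>
          pair (1 - K C C' l' (m j, l j) * K C C' l' (m j, l j))
            (destOut N (C.2.2 (m j, l j, l')) (C.1 l') ⊗ₖ
              destOut N (C'.2.2 (m₂, l₂, l j)) (C'.1 (l j))))).trans_le ?_
        exact hdst _ _ _ _ _
  have hlow : ∀ Cs m l, 1 - bad Cs m l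
      ≤ (bookCode (b := b) Cs Γ hΓ hΓ1 K hK1).outcomeProb N m l l fun j => (m j, l j) := by
    intro Cs m l
    have h := (bookCode (b := b) Cs Γ hΓ hΓ1 K hK1).le_outcomeProb N (fun _ _ _ => hK _ _ _ _) m l
    refine le_trans (le_of_eq ?_) h
    rw [hbad]
    congr 1
    refine Finset.sum_congr rfl fun j _ => ?_
    have e1 : (bookCode (b := b) Cs Γ hΓ hΓ1 K hK1).curM m j.castSucc = m j :=
      Fin.snoc_castSucc (α := fun _ => Fin M) _ _ _
    have e2 : (bookCode (b := b) Cs Γ hΓ hΓ1 K hK1).curL l j.castSucc = l j :=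
      Fin.snoc_castSucc (α := fun _ => Fin L) _ _ _
    have e3 : (bookCode (b := b) Cs Γ hΓ hΓ1 K hK1).prevL l j.succ = l j := Fin.cons_succ _ _ _
    simp only [PDFCode.sentSource, PDFCode.sentRelay, e1, e2, e3]
    rfl
  have hcard : (0 : ℝ) < ((M : ℝ) * L) ^ b := by
    have h1 : (0 : ℝ) < M := Nat.cast_pos.2 (NeZero.pos M)
    have h2 : (0 : ℝ) < L := Nat.cast_pos.2 (NeZero.pos L)
    positivity
  obtain ⟨Cs, hCs⟩ := exists_le_wsum hW fun Cs =>
    ∑ m : Fin b → Fin M, ∑ l : Fin b → Fin L, bad Cs m l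
  have hsum : ∀ k : ℝ, ∑ _m : Fin b → Fin M, ∑ _l : Fin b → Fin L, k = ((M : ℝ) * L) ^ b * k := by
    intro k
    simp [mul_pow, mul_assoc]
  have hle : ∑ m : Fin b → Fin M, ∑ l : Fin b → Fin L, bad Cs m l
      ≤ ((M : ℝ) * L) ^ b * (b * (rel + 2 * √dst)) := by
    refine hCs.trans ?_
    rw [wsum_sum, ← hsum]
    refine Finset.sum_le_sum fun m _ => ?_
    rw [wsum_sum]
    exact Finset.sum_le_sum fun l _ => hmean m l
  refine ⟨Cs, ((bookCode (b := b) Cs Γ hΓ hΓ1 K hK1).error_le N).trans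
    (mul_le_mul_of_nonneg_left ?_ two_pos.le)⟩
  rw [sub_le_iff_le_add, add_comm, ← sub_le_iff_le_add]
  refine (le_div_iff₀ hcard).2 ?_
  calc (1 - b * (rel + 2 * √dst)) * ((M : ℝ) * L) ^ b
      ≤ ∑ m : Fin b → Fin M, ∑ l : Fin b → Fin L, (1 - bad Cs m l) := by
        simp only [Finset.sum_sub_distrib]
        rw [hsum]
        linarith
    _ ≤ _ := Finset.sum_le_sum fun m _ => Finset.sum_le_sum fun l _ => hlow Cs m l

/-- The performance of superposition coding in terms of the thresholds of the tests. -/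
lemma exists_code (E : Ensemble (Fin n → X₁) A₂ (Fin n → X)) (hM : 0 < M)
    (hL : 0 < L) {t₀ t₁ t₂ t₃ t₄ t₅ t₆ ε : ℝ} (ht₀ : 0 < t₀) (ht₁ : 0 ≤ t₁) (ht₂ : 0 ≤ t₂)
    (ht₃ : 0 < t₃) (ht₄ : 0 ≤ t₄) (ht₅ : 0 < t₅) (ht₆ : 0 ≤ t₆) (hε : 0 ≤ ε)
    (s : (Fin n → X₁) → (Fin n → X) → Matrix (Fin n → B) (Fin n → B) ℂ)
    (hsdef : s = fun x₁ x => destOut N x x₁)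
    (r : (Fin n → X₁) → (Fin n → X) → Matrix (Fin n → B₁) (Fin n → B₁) ℂ)
    (hrdef : r = fun x₁ x => relayOut N x x₁)
    (he₀ : E.mean (fun a₁ _ a₃ => pair (1 - specProj (s a₁ a₃) (Set.Ici t₀)) (s a₁ a₃)) ≤ ε)
    (he₁ : wsum E.w₁ (fun a₁ => wsum (E.w₂ a₁) fun a₂ =>
      pair (1 - specProj (E.out₂ s a₁ a₂) (Set.Iic t₁)) (E.out₂ s a₁ a₂)) ≤ ε)
    (he₂ : wsum E.w₁ (fun a₁ =>
      pair (1 - specProj (E.out₁ s a₁) (Set.Iic t₂)) (E.out₁ s a₁)) ≤ ε)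
    (he₃ : wsum E.w₁ (fun a₁ =>
      pair (1 - specProj (E.out₁ s a₁) (Set.Ici t₃)) (E.out₁ s a₁)) ≤ ε)
    (he₄ : pair (1 - specProj (E.out₀ s) (Set.Iic t₄)) (E.out₀ s) ≤ ε)
    (he₅ : wsum E.w₁ (fun a₁ => wsum (E.w₂ a₁) fun a₂ =>
      pair (1 - specProj (E.out₂ r a₁ a₂) (Set.Ici t₅)) (E.out₂ r a₁ a₂)) ≤ ε)
    (he₆ : wsum E.w₁ (fun a₁ =>
      pair (1 - specProj (E.out₁ r a₁) (Set.Iic t₆)) (E.out₁ r a₁)) ≤ ε) (b : ℕ) :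
    ∃ c : PDFCode X X₁ B₁ B n b, c.cardM = M ∧ c.cardL = L ∧
      c.error N ≤ 2 * (b * ((2 * (6 * √ε) + 4 * (((L : ℝ) - 1) * (t₆ / t₅)))
        + 2 * √(2 * (6 * √ε + 6 * √ε) + 4 * (((M : ℝ) - 1) * (t₁ / t₀)
            + M * ((L : ℝ) - 1) * (t₂ / t₀ * (t₄ / t₃)))))) := by
  have hs : ∀ a₁ a₃, (s a₁ a₃).PosSemidef := fun _ _ => hsdef ▸ destOut_posSemidef N _ _
  have hs1 : ∀ a₁ a₃, (s a₁ a₃).trace = 1 := fun _ _ => hsdef ▸ trace_destOut N _ _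
  have hr : ∀ a₁ a₃, (r a₁ a₃).PosSemidef := fun _ _ => hrdef ▸ relayOut_posSemidef N _ _
  have hr1 : ∀ a₁ a₃, (r a₁ a₃).trace = 1 := fun _ _ => hrdef ▸ trace_relayOut N _ _
  have : NeZero M := ⟨hM.ne'⟩
  have : NeZero L := ⟨hL.ne'⟩
  obtain ⟨Γ, hΓ, hΓ1, hΓ2⟩ := E.exists_relayDecoder (M := Fin M) (L := Fin L) hr _
    (E.relayTest_isEffect r t₅ t₆) (E.mean_one_sub_relayTest_le hr hr1 he₅ he₆ hε)
    (E.pair_relayTest_out₁_le hr hr1 ht₅ ht₆)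
  obtain ⟨K, hK, hK1, hK2⟩ := E.exists_destDecoder (M := Fin M) (L := Fin L) hs hs1 _
    (E.blockTest_isEffect s t₀ t₁ t₂) _ (E.nextTest_isEffect s t₃ t₄)
    (E.mean_one_sub_blockTest_le hs hs1 he₀ he₁ he₂)
    (E.mean_one_sub_nextTest_le hs hs1 he₃ he₄ hε)
    (E.wsum_blockTest_out₂_le hs hs1 t₂ ht₀ ht₁) (E.wsum_blockTest_out₁_le hs hs1 t₁ ht₀ ht₂)
    (E.pair_nextTest_out₀_le hs hs1 ht₃ ht₄) (div_nonneg ht₄ ht₃.le)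
  rw [Fintype.card_fin] at hΓ2
  rw [Fintype.card_fin, Fintype.card_fin] at hK2
  subst hsdef hrdef
  obtain ⟨Cs, hCs⟩ := exists_bookCode (b := b) N E Γ hΓ hΓ1 K hK hK1 hΓ2 hK2
  exact ⟨_, rfl, rfl, hCs⟩

end RandomCode


/-! ### Law of large numbers and typical eigenvalues -/

section LawOfLargeNumbers

variable {α : Type*} [Fintype α]

/-- The variance of a sum of independent identically distributed variables. -/
lemma wsum_sq_sum {q : α → ℝ} (hq : IsProb q) (g : α → ℝ) (hg : wsum q g = 0) (n : ℕ) :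
    wsum (prodWeight fun _ : Fin n => q) (fun a => (∑ i, g (a i)) ^ 2)
      = n * wsum q (fun a => g a ^ 2) := by
  have h1 : ∀ a : Fin n → α, (∑ i, g (a i)) ^ 2 = ∑ i, ∑ j, g (a i) * g (a j) := fun a => by
    rw [sq, Finset.sum_mul_sum]
  simp only [h1, wsum_sum]
  have h2 : ∀ i j : Fin n, wsum (prodWeight fun _ : Fin n => q) (fun a => g (a i) * g (a j))
      = if i = j then wsum q (fun a => g a ^ 2) else 0 := by
    intro i j
    split_ifs with h
    · subst h
      have := wsum_prodWeight_apply (fun _ : Fin n => hq) i (fun x => g x ^ 2)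
      simpa only [sq] using this
    · rw [wsum_prodWeight_mul (fun _ : Fin n => hq) h, hg, zero_mul]
  simp [h2]

/-- The joint distribution of two symbols. -/
def jointWeight {β : Type*} (p : α → ℝ) (k : α → β → ℝ) (z : α × β) : ℝ := p z.1 * k z.1 z.2

variable {β : Type*} [Fintype β]

lemma wsum_jointWeight (p : α → ℝ) (k : α → β → ℝ) (g : α × β → ℝ) :
    wsum (jointWeight p k) g = wsum p fun a => wsum (k a) fun b => g (a, b) := by
  simp only [wsum, jointWeight, Fintype.sum_prod_type, Finset.mul_sum, mul_assoc]

lemma IsProb.jointWeight {p : α → ℝ} (hp : IsProb p) {k : α → β → ℝ} (hk : ∀ a, IsProb (k a)) :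
    IsProb (QRelay.jointWeight p k) := by
  refine ⟨fun z => mul_nonneg (hp.nonneg _) ((hk _).nonneg _), ?_⟩
  have := wsum_jointWeight p k fun _ => 1
  simp only [wsum_const (hk _), wsum_const hp] at this
  simpa [wsum] using this

/-- Drawing a word and then a second word letter by letter is the same as drawing independent pairs
of letters. This reduces superposition sampling to the law of large numbers. -/
lemma wsum_prodWeight_jointWeight {n : ℕ} (p : α → ℝ) (k : α → β → ℝ)
    (F : (Fin n → α × β) → ℝ) :
    wsum (prodWeight fun _ => p) (fun z => wsum (prodWeight fun i => k (z i)) fun y =>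
      F fun i => (z i, y i)) = wsum (prodWeight fun _ => jointWeight p k) F := by
  have h : wsum (prodWeight fun _ => jointWeight p k) F
      = ∑ z : (Fin n → α) × (Fin n → β), (∏ i, p (z.1 i) * k (z.1 i) (z.2 i)) *
        F fun i => (z.1 i, z.2 i) :=
    (Equiv.sum_comp (Equiv.arrowProdEquivProdArrow (Fin n) (fun _ => α) (fun _ => β)).symm _).symm
  rw [h, Fintype.sum_prod_type]
  simp only [wsum, prodWeight, Finset.mul_sum, Finset.prod_mul_distrib, mul_assoc]

end LawOfLargeNumbers

section Typicality

variable {β : Type*} [Fintype β] [DecidableEq β]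

lemma isProb_eigenvalues {A : Matrix β β ℂ} (hA : A.PosSemidef) (hA1 : A.trace = 1) :
    IsProb hA.1.eigenvalues := by
  refine ⟨hA.eigenvalues_nonneg, ?_⟩
  have := hA.1.trace_eq_sum_eigenvalues
  rw [hA1] at this
  have h := congrArg Complex.re this
  simpa using h.symm

lemma entropy_eq {A : Matrix β β ℂ} (hA : A.IsHermitian) :
    entropy A = ∑ i, hA.eigenvalues i * -Real.logb 2 (hA.eigenvalues i) := by
  unfold entropy
  rw [dif_pos hA]
  refine Finset.sum_congr rfl fun i _ => ?_
  rw [Real.negMulLog, Real.logb]; ring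

/-- A symmetric function of the eigenvalues of a product state. -/
lemma sum_eigenvalues_piTensor {n : ℕ} {A : Fin n → Matrix β β ℂ} (hA : ∀ i, (A i).IsHermitian)
    (h : (piTensor A).IsHermitian) (f : ℝ → ℝ) :
    ∑ i, f (h.eigenvalues i) = ∑ k : Fin n → β, f (∏ i, (hA i).eigenvalues (k i)) := by
  set U := fun i => ((hA i).eigenvectorUnitary : Matrix β β ℂ) with hU
  refine sum_eigenvalues_eq h (piTensor U) (piTensor fun i => (U i)ᴴ) ?_ _ ?_ f
  · rw [piTensor_mul, ← piTensor_one]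
    congr 1; ext i : 1
    rw [hU, ← Matrix.star_eq_conjTranspose]
    exact Unitary.coe_star_mul_self _
  · have : (Matrix.diagonal fun k : Fin n → β => ((∏ i, (hA i).eigenvalues (k i) : ℝ) : ℂ))
        = piTensor fun i => Matrix.diagonal fun k => ((hA i).eigenvalues k : ℂ) := by
      rw [piTensor_diagonal]
      congr 1; ext k; simp
    rw [this, piTensor_mul, piTensor_mul]
    congr 1; ext i : 1
    conv_lhs => rw [(hA i).spectral_theorem, Unitary.conjStarAlgAut_apply]
    rfl

variable {Z : Type*} [Fintype Z]

/-- Chebyshev's inequality: eigenvalues of a product state are products of eigenvalues, so for a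
random word and a random eigenvector, chosen with its eigenvalue as probability, `-log₂` of the
eigenvalue is a sum of `n` independent variables with the average entropy as mean. `V` is their
variance divided by `δ²`. -/
lemma wsum_one_sub_specProj_le {p : Z → ℝ} (hp : IsProb p) {σ : Z → Matrix β β ℂ}
    (hσ : ∀ z, (σ z).PosSemidef) (hσ1 : ∀ z, (σ z).trace = 1) {δ : ℝ} (hδ : 0 < δ) :
    ∃ V : ℝ, ∀ n : ℕ, 0 < n → ∀ s : Set ℝ,
      (∀ x : ℝ, 0 < x → |(-Real.logb 2 x) - n * wsum p (fun z => entropy (σ z))| < n * δ → x ∈ s) →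
      wsum (prodWeight fun _ : Fin n => p) (fun z =>
        pair (1 - specProj (piTensor fun i => σ (z i)) s) (piTensor fun i => σ (z i)))
        ≤ V / n := by
  set ev := fun z => (hσ z).1.eigenvalues with hev
  set f : Z × β → ℝ := fun z => -Real.logb 2 (ev z.1 z.2) with hf
  set μ := wsum p (fun z => entropy (σ z)) with hμ
  set q := jointWeight p ev with hqdef
  have hevp : ∀ z, IsProb (ev z) := fun z => isProb_eigenvalues (hσ z) (hσ1 z)
  have hq : IsProb q := hp.jointWeight hevp
  have hμq : wsum q f = μ := by
    rw [hqdef, wsum_jointWeight, hμ]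
    congr 1; ext z
    rw [entropy_eq (hσ z).1]
    rfl
  have hg : wsum q (fun a => f a - μ) = 0 := by
    have := wsum_add q f fun _ => -μ
    rw [wsum_const hq, hμq] at this
    simpa [sub_eq_add_neg] using this
  refine ⟨wsum q (fun a => (f a - μ) ^ 2) / δ ^ 2, fun n hn s hs => ?_⟩
  have hn' : (0 : ℝ) < n := Nat.cast_pos.2 hn
  have hstep : ∀ z : Fin n → Z,
      pair (1 - specProj (piTensor fun i => σ (z i)) s) (piTensor fun i => σ (z i))
      ≤ wsum (prodWeight fun i => ev (z i)) fun k =>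
        ((n * δ) ^ 2)⁻¹ * (∑ i, (f (z i, k i) - μ)) ^ 2 := by
    intro z
    have hS := piTensor_posSemidef fun i => hσ (z i)
    rw [pair_one_sub_specProj hS.1, sum_eigenvalues_piTensor (fun i => (hσ (z i)).1) hS.1]
    refine Finset.sum_le_sum fun k _ => ?_
    set x := ∏ i, (hσ (z i)).1.eigenvalues (k i) with hx
    have hxp : prodWeight (fun i => ev (z i)) k = x := rfl
    rw [hxp]
    have hx0 : 0 ≤ x := Finset.prod_nonneg fun i _ => (hσ (z i)).eigenvalues_nonneg _
    by_cases hxs : x ∈ s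
    · rw [Set.indicator_of_notMem (by simpa using hxs)]
      positivity
    rw [Set.indicator_of_mem (by simpa using hxs)]
    -- A zero eigenvalue carries no weight, so the default value of its logarithm is harmless.
    rcases hx0.eq_or_lt with h0 | hpos
    · rw [← h0]; simp
    refine le_mul_of_one_le_right hx0 ?_
    have hlog : -Real.logb 2 x = ∑ i, f (z i, k i) := by
      rw [hx, Real.logb_prod _ _ fun i _ => (Finset.prod_ne_zero_iff.1 hpos.ne') i (Finset.mem_univ i)]
      simp [hf, hev]
    have hbig : n * δ ≤ |∑ i, (f (z i, k i) - μ)| := by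
      by_contra! hlt
      refine hxs (hs x hpos ?_)
      rw [hlog]
      simpa using hlt
    beta_reduce
    rw [inv_mul_eq_div, one_le_div (by positivity), ← sq_abs (∑ i, (f (z i, k i) - μ))]
    exact pow_le_pow_left₀ (by positivity) hbig 2
  refine (wsum_mono (IsProb.prodWeight fun _ => hp) hstep).trans (le_of_eq ?_)
  rw [wsum_prodWeight_jointWeight p ev fun a => ((n * δ) ^ 2)⁻¹ * (∑ i, (f (a i) - μ)) ^ 2,
    wsum_mul_left, wsum_sq_sum hq (fun a => f a - μ) hg]
  field_simp

/-- Product states have eigenvalues close to `2 ^ (-n H)`. -/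
lemma eventually_typical {p : Z → ℝ} (hp : IsProb p) {σ : Z → Matrix β β ℂ}
    (hσ : ∀ z, (σ z).PosSemidef) (hσ1 : ∀ z, (σ z).trace = 1) {δ ε : ℝ} (hδ : 0 < δ) (hε : 0 < ε)
    {H : ℝ} (hH : wsum p (fun z => entropy (σ z)) = H) :
    ∀ᶠ n : ℕ in Filter.atTop,
      wsum (prodWeight fun _ : Fin n => p) (fun z =>
        pair (1 - specProj (piTensor fun i => σ (z i)) (Set.Ici (2 ^ (-(n * (H + δ))))))
          (piTensor fun i => σ (z i))) ≤ ε ∧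
      wsum (prodWeight fun _ : Fin n => p) (fun z =>
        pair (1 - specProj (piTensor fun i => σ (z i)) (Set.Iic (2 ^ (-(n * (H - δ))))))
          (piTensor fun i => σ (z i))) ≤ ε := by
  obtain ⟨V, hV⟩ := wsum_one_sub_specProj_le hp hσ hσ1 hδ
  have hlim : Filter.Tendsto (fun n : ℕ => V / n) Filter.atTop (nhds 0) :=
    tendsto_const_div_atTop_nhds_zero_nat V
  filter_upwards [hlim.eventually (ge_mem_nhds hε), Filter.eventually_gt_atTop 0] with n hn hn0
  refine ⟨(hV n hn0 _ fun x hx h => ?_).trans hn, (hV n hn0 _ fun x hx h => ?_).trans hn⟩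
  · rw [hH, abs_lt] at h
    rw [Set.mem_Ici, ← Real.le_logb_iff_rpow_le one_lt_two hx]
    linarith [h.2]
  · rw [hH, abs_lt] at h
    rw [Set.mem_Iic, ← Real.logb_le_iff_le_rpow one_lt_two hx]
    linarith [h.1]

end Typicality

/-! ### Product ensembles and their typicality -/

section ProductEnsemble

variable {X X₁ U : Type*} [Fintype X] [Fintype X₁] [Fintype U]

/-- The ensemble of words whose letters are independent. -/
def Ensemble.pow (e : Ensemble X₁ U X) (n : ℕ) :
    Ensemble (Fin n → X₁) (Fin n → U) (Fin n → X) where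
  w₁ := prodWeight fun _ => e.w₁
  w₂ x₁ := prodWeight fun i => e.w₂ (x₁ i)
  w₃ x₁ u := prodWeight fun i => e.w₃ (x₁ i) (u i)
  isProb₁ := IsProb.prodWeight fun _ => e.isProb₁
  isProb₂ _ := IsProb.prodWeight fun _ => e.isProb₂ _
  isProb₃ _ _ := IsProb.prodWeight fun _ => e.isProb₃ _ _

variable (e : Ensemble X₁ U X) {β : Type*} (σ : X₁ → X → Matrix β β ℂ) {n : ℕ}

lemma Ensemble.pow_out₂ (x₁ : Fin n → X₁) (u : Fin n → U) :
    (e.pow n).out₂ (fun x₁ x => piTensor fun i => σ (x₁ i) (x i)) x₁ u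
      = piTensor fun i => e.out₂ σ (x₁ i) (u i) :=
  sum_smul_piTensor (fun i => e.w₃ (x₁ i) (u i)) fun i => σ (x₁ i)

lemma Ensemble.pow_out₁ (x₁ : Fin n → X₁) :
    (e.pow n).out₁ (fun x₁ x => piTensor fun i => σ (x₁ i) (x i)) x₁
      = piTensor fun i => e.out₁ σ (x₁ i) := by
  unfold Ensemble.out₁
  simp only [Ensemble.pow_out₂]
  exact sum_smul_piTensor (fun i => e.w₂ (x₁ i)) fun i => e.out₂ σ (x₁ i)

lemma Ensemble.pow_out₀ :
    (e.pow n).out₀ (fun x₁ x => piTensor fun i => σ (x₁ i) (x i))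
      = piTensor fun _ => e.out₀ σ := by
  unfold Ensemble.out₀
  simp only [Ensemble.pow_out₁]
  exact sum_smul_piTensor (fun _ => e.w₁) fun _ => e.out₁ σ

end ProductEnsemble

section Letters

variable {X X₁ B₁ B : Type*} [Fintype B₁] [Fintype B] (N : RelayChannel X X₁ B₁ B) {n : ℕ}

/-- The output of the destination for one channel use. -/
def destLetter (x₁ : X₁) (x : X) : Matrix B B ℂ :=
  marginal (fun (t : B) (s : B₁) => (s, t)) (N.state x x₁)

/-- The output of the relay for one channel use. -/
def relayLetter (x₁ : X₁) (x : X) : Matrix B₁ B₁ ℂ :=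
  marginal (fun (s : B₁) (t : B) => (s, t)) (N.state x x₁)

lemma destOut_eq_piTensor :
    (fun (x₁ : Fin n → X₁) (x : Fin n → X) => destOut N x x₁)
      = fun x₁ x => piTensor fun i => destLetter N (x₁ i) (x i) := by
  ext x₁ x t t'
  simp only [destOut, marginal, blockState, piTensor, destLetter, Matrix.of_apply,
    Finset.prod_univ_sum, Fintype.piFinset_univ]

lemma relayOut_eq_piTensor :
    (fun (x₁ : Fin n → X₁) (x : Fin n → X) => relayOut N x x₁)
      = fun x₁ x => piTensor fun i => relayLetter N (x₁ i) (x i) := by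
  ext x₁ x t t'
  simp only [relayOut, marginal, blockState, piTensor, relayLetter, Matrix.of_apply,
    Finset.prod_univ_sum, Fintype.piFinset_univ]

end Letters


namespace Ensemble

variable {X X₁ U : Type*} [Fintype X] [Fintype X₁] [Fintype U] (e : Ensemble X₁ U X)
  {β : Type*} [Fintype β] [DecidableEq β] {σ : X₁ → X → Matrix β β ℂ}
  (hσ : ∀ x₁ x, (σ x₁ x).PosSemidef) (hσ1 : ∀ x₁ x, (σ x₁ x).trace = 1) {δ ε : ℝ} (hδ : 0 < δ)
  (hε : 0 < ε)
include hσ hσ1 hδ hε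

/-- The state ignores `a₂`, but the source word is drawn through it, so the triple of letters is
treated as one independent letter. -/
lemma eventually_typical₃ : ∀ᶠ n : ℕ in Filter.atTop,
    (e.pow n).mean (fun a₁ _ a₃ =>
      pair (1 - specProj (piTensor fun i => σ (a₁ i) (a₃ i))
        (Set.Ici (2 ^ (-(n * (e.mean (fun a₁ _ a₃ => entropy (σ a₁ a₃)) + δ))))))
        (piTensor fun i => σ (a₁ i) (a₃ i))) ≤ ε := by
  have h := eventually_typical (p := jointWeight (jointWeight e.w₁ e.w₂) fun z => e.w₃ z.1 z.2)
    ((e.isProb₁.jointWeight e.isProb₂).jointWeight fun z => e.isProb₃ _ _)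
    (σ := fun z => σ z.1.1 z.2) (fun z => hσ _ _) (fun z => hσ1 _ _) hδ hε rfl
  filter_upwards [h] with n hn
  refine le_trans (le_of_eq ?_) hn.1
  rw [wsum_jointWeight, wsum_jointWeight, ← wsum_prodWeight_jointWeight,
    ← wsum_prodWeight_jointWeight]
  rfl

lemma eventually_typical₂ : ∀ᶠ n : ℕ in Filter.atTop,
    wsum (e.pow n).w₁ (fun a₁ => wsum ((e.pow n).w₂ a₁) fun a₂ =>
      pair (1 - specProj (piTensor fun i => e.out₂ σ (a₁ i) (a₂ i)) (Set.Ici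
        (2 ^ (-(n * (wsum e.w₁ (fun a₁ => wsum (e.w₂ a₁) fun a₂ => entropy (e.out₂ σ a₁ a₂))
          + δ)))))) (piTensor fun i => e.out₂ σ (a₁ i) (a₂ i))) ≤ ε ∧
    wsum (e.pow n).w₁ (fun a₁ => wsum ((e.pow n).w₂ a₁) fun a₂ =>
      pair (1 - specProj (piTensor fun i => e.out₂ σ (a₁ i) (a₂ i)) (Set.Iic
        (2 ^ (-(n * (wsum e.w₁ (fun a₁ => wsum (e.w₂ a₁) fun a₂ => entropy (e.out₂ σ a₁ a₂))
          - δ)))))) (piTensor fun i => e.out₂ σ (a₁ i) (a₂ i))) ≤ ε := by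
  have h := eventually_typical (p := jointWeight e.w₁ e.w₂)
    (e.isProb₁.jointWeight e.isProb₂) (σ := fun z => e.out₂ σ z.1 z.2)
    (fun z => e.out₂_posSemidef hσ _ _) (fun z => e.trace_out₂ hσ1 _ _) hδ hε rfl
  filter_upwards [h] with n hn
  rw [wsum_jointWeight, ← wsum_prodWeight_jointWeight, ← wsum_prodWeight_jointWeight] at hn
  exact hn

lemma eventually_typical₁ : ∀ᶠ n : ℕ in Filter.atTop,
    wsum (e.pow n).w₁ (fun a₁ =>
      pair (1 - specProj (piTensor fun i => e.out₁ σ (a₁ i)) (Set.Ici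
        (2 ^ (-(n * (wsum e.w₁ (fun a₁ => entropy (e.out₁ σ a₁)) + δ))))))
          (piTensor fun i => e.out₁ σ (a₁ i))) ≤ ε ∧
    wsum (e.pow n).w₁ (fun a₁ =>
      pair (1 - specProj (piTensor fun i => e.out₁ σ (a₁ i)) (Set.Iic
        (2 ^ (-(n * (wsum e.w₁ (fun a₁ => entropy (e.out₁ σ a₁)) - δ))))))
          (piTensor fun i => e.out₁ σ (a₁ i))) ≤ ε :=
  eventually_typical e.isProb₁ (e.out₁_posSemidef hσ) (e.trace_out₁ hσ1) hδ hε rfl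

lemma eventually_typical₀ : ∀ᶠ n : ℕ in Filter.atTop,
    pair (1 - specProj (piTensor fun _ : Fin n => e.out₀ σ) (Set.Iic
      (2 ^ (-(n * (entropy (e.out₀ σ) - δ)))))) (piTensor fun _ : Fin n => e.out₀ σ) ≤ ε := by
  -- A single state is the case of a one-point alphabet.
  have hp : IsProb fun _ : Unit => (1 : ℝ) := ⟨fun _ => zero_le_one, by simp⟩
  have h := eventually_typical hp (σ := fun _ => e.out₀ σ)
    (fun _ => e.out₀_posSemidef hσ) (fun _ => e.trace_out₀ hσ1) hδ hε (wsum_const hp _)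
  filter_upwards [h] with n hn
  rw [wsum_const (IsProb.prodWeight fun _ => hp)] at hn
  exact (wsum_const (IsProb.prodWeight fun _ : Fin n => hp) _).symm.trans_le hn.2

end Ensemble

/-! ### Entropies of classical-quantum states -/

section BlockEntropy

/-- The entropy of a classical-quantum state. -/
lemma entropy_blocks {ι β Z : Type*} [Fintype ι] [DecidableEq ι] [Fintype β] [DecidableEq β]
    [Fintype Z] [DecidableEq Z] (f : ι ≃ β × Z) {p : Z → ℝ} {σ : Z → Matrix β β ℂ}
    (hσ : ∀ z, (σ z).PosSemidef) (hσ1 : ∀ z, (σ z).trace = 1) {A : Matrix ι ι ℂ}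
    (hA : ∀ i j, A i j = if (f i).2 = (f j).2 then
      (p (f i).2 : ℂ) * σ (f i).2 (f i).1 (f j).1 else 0) :
    entropy A = ∑ z, Real.negMulLog (p z) / Real.log 2 + wsum p fun z => entropy (σ z) := by
  set U := fun z => ((hσ z).1.eigenvectorUnitary : Matrix β β ℂ) with hU
  set d : β × Z → ℝ := fun q => p q.2 * (hσ q.2).1.eigenvalues q.1 with hd
  have hUU : ∀ z, (U z)ᴴ * U z = 1 := fun z => by
    rw [← Matrix.star_eq_conjTranspose]
    exact Unitary.coe_star_mul_self _
  have hUσ : ∀ z, σ z = U z * Matrix.diagonal (fun k => ((hσ z).1.eigenvalues k : ℂ)) * (U z)ᴴ := by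
    intro z
    conv_lhs => rw [(hσ z).1.spectral_theorem, Unitary.conjStarAlgAut_apply]
    rfl
  have hblock : A = (Matrix.blockDiagonal fun z => (p z : ℂ) • σ z).submatrix f f := by
    ext i j
    rw [hA, Matrix.submatrix_apply, Matrix.blockDiagonal_apply]
    simp
  have hdiag : (Matrix.blockDiagonal fun z => (p z : ℂ) • σ z)
      = Matrix.blockDiagonal U * Matrix.diagonal (fun q => (d q : ℂ))
        * Matrix.blockDiagonal fun z => (U z)ᴴ := by
    have : Matrix.diagonal (fun q => (d q : ℂ))
        = Matrix.blockDiagonal fun z => Matrix.diagonal fun k => (d (k, z) : ℂ) := by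
      rw [Matrix.blockDiagonal_diagonal]
    rw [this, ← Matrix.blockDiagonal_mul, ← Matrix.blockDiagonal_mul]
    congr 1; ext z : 1
    have h2 : (Matrix.diagonal fun k => (d (k, z) : ℂ))
        = (p z : ℂ) • Matrix.diagonal (fun k => ((hσ z).1.eigenvalues k : ℂ)) := by
      ext i j; by_cases hij : i = j <;> simp [Matrix.diagonal, hd, hij]
    rw [h2, Matrix.mul_smul, Matrix.smul_mul, ← hUσ]
  have hAh : A.IsHermitian := by
    rw [hblock]
    refine Matrix.IsHermitian.submatrix ?_ f
    rw [Matrix.IsHermitian, Matrix.blockDiagonal_conjTranspose]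
    congr 1; ext z : 1
    rw [Matrix.conjTranspose_smul, (hσ z).1.eq]
    simp
  have hsum := sum_eigenvalues_eq hAh ((Matrix.blockDiagonal U).submatrix f f)
    ((Matrix.blockDiagonal fun z => (U z)ᴴ).submatrix f f)
    (by
      rw [Matrix.submatrix_mul_equiv, ← Matrix.blockDiagonal_mul]
      simp only [hUU]
      have : (Matrix.blockDiagonal fun _ : Z => (1 : Matrix β β ℂ)) = 1 := Matrix.blockDiagonal_one
      rw [this, Matrix.submatrix_one_equiv])
    (d ∘ f)
    (by
      have : Matrix.diagonal (fun i => ((d ∘ f) i : ℂ))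
          = (Matrix.diagonal (fun q => (d q : ℂ))).submatrix f f := by
        rw [Matrix.submatrix_diagonal_equiv]; rfl
      rw [this, Matrix.submatrix_mul_equiv, Matrix.submatrix_mul_equiv, ← hdiag, hblock])
    fun x => Real.negMulLog x / Real.log 2
  unfold entropy
  rw [dif_pos hAh, hsum]
  have h3 : ∑ i, Real.negMulLog ((d ∘ f) i) / Real.log 2 = ∑ q, Real.negMulLog (d q) / Real.log 2 :=
    Equiv.sum_comp f fun q => Real.negMulLog (d q) / Real.log 2
  rw [h3, Fintype.sum_prod_type_right, wsum, ← Finset.sum_add_distrib]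
  refine Finset.sum_congr rfl fun z _ => ?_
  rw [dif_pos (hσ z).1, Finset.mul_sum]
  -- The product rule of `-x log x` separates the entropy of `p` from the average entropy; it holds
  -- for all reals, so no sign of `p` is needed.
  simp only [hd, Real.negMulLog_mul, add_div, Finset.sum_add_distrib]
  congr 1
  · rw [← Finset.sum_div, ← Finset.sum_mul, (isProb_eigenvalues (hσ z) (hσ1 z)).sum_eq_one, one_mul]
  · exact Finset.sum_congr rfl fun k _ => by ring

lemma entropy_classical {ι : Type*} [Fintype ι] [DecidableEq ι] {p : ι → ℝ} {A : Matrix ι ι ℂ}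
    (hA : ∀ i j, A i j = if i = j then (p i : ℂ) else 0) :
    entropy A = ∑ i, Real.negMulLog (p i) / Real.log 2 := by
  have hAd : A = Matrix.diagonal fun i => (p i : ℂ) := by
    ext i j; rw [hA, Matrix.diagonal_apply]
  have hAh : A.IsHermitian := by
    rw [hAd, Matrix.isHermitian_diagonal_iff]
    intro i; simp [isSelfAdjoint_iff]
  unfold entropy
  rw [dif_pos hAh]
  exact sum_eigenvalues_eq hAh 1 1 (one_mul 1) p (by rw [hAd]; simp)
    fun x => Real.negMulLog x / Real.log 2

variable {α β γ : Type*} [Fintype α] [Fintype β] [Fintype γ] [DecidableEq α] [DecidableEq β]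
  [DecidableEq γ]

/-- The mutual information of a classical-quantum state is its Holevo information. -/
lemma mutualInfo_classical {p : α → ℝ} {τ : α → Matrix β β ℂ}
    (hτ : ∀ a, (τ a).PosSemidef) (hτ1 : ∀ a, (τ a).trace = 1) {σ : Matrix (α × β) (α × β) ℂ}
    (hσ : ∀ i j, σ i j = if i.1 = j.1 then (p i.1 : ℂ) * τ i.1 i.2 j.2 else 0) :
    mutualInfo σ = entropy (∑ a, p a • τ a) - wsum p fun a => entropy (τ a) := by
  have h1 := entropy_classical (p := p) (A := marginal (fun (a : α) (b : β) => (a, b)) σ) (by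
    intro a a'
    simp only [marginal, Matrix.of_apply, hσ]
    split_ifs with h
    · subst h
      rw [← Finset.mul_sum]
      have : ∑ b, τ a b b = 1 := hτ1 a
      rw [this, mul_one]
    · simp)
  have h2 := entropy_blocks (Equiv.prodComm α β) hτ hτ1 (p := p) (A := σ) (fun i j => hσ i j)
  have h3 : marginal (fun (b : β) (a : α) => (a, b)) σ = ∑ a, p a • τ a := by
    ext b b'
    simp [marginal, hσ, Matrix.sum_apply]
  rw [mutualInfo, h1, h2, h3]
  ring

/-- The conditional mutual information of a state that is classical on `A` and `C`. -/
lemma condMutualInfo_classical {p : γ → ℝ} {k : γ → α → ℝ} (hk : ∀ c, IsProb (k c))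
    {τ : γ → α → Matrix β β ℂ} (hτ : ∀ c a, (τ c a).PosSemidef) (hτ1 : ∀ c a, (τ c a).trace = 1)
    {σ : Matrix (α × β × γ) (α × β × γ) ℂ}
    (hσ : ∀ i j, σ i j = if i.1 = j.1 ∧ i.2.2 = j.2.2 then
      ((p i.2.2 * k i.2.2 i.1 : ℝ) : ℂ) * τ i.2.2 i.1 i.2.1 j.2.1 else 0) :
    condMutualInfo σ = wsum p (fun c => entropy (∑ a, k c a • τ c a))
      - wsum p fun c => wsum (k c) fun a => entropy (τ c a) := by
  have h1 := entropy_classical (p := fun i : α × γ => p i.2 * k i.2 i.1)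
    (A := marginal (fun (i : α × γ) (b : β) => (i.1, b, i.2)) σ) (by
    intro i j
    simp only [marginal, Matrix.of_apply, hσ, Prod.ext_iff]
    split_ifs with h
    · rw [← Finset.mul_sum]
      have : ∑ b, τ i.2 i.1 b b = 1 := hτ1 i.2 i.1
      rw [this, mul_one]
    · simp)
  have h2 := entropy_blocks (Equiv.refl (β × γ)) (p := p) (σ := fun c => ∑ a, k c a • τ c a)
    (fun c => (hk c).posSemidef_sum (hτ c)) (fun c => (hk c).trace_sum (hτ1 c))
    (A := marginal (fun (i : β × γ) (a : α) => (a, i.1, i.2)) σ) (by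
    intro i j
    simp only [marginal, Matrix.of_apply, hσ, Equiv.refl_apply, true_and]
    by_cases h : i.2 = j.2
    · simp only [h, if_true, Matrix.sum_apply, Matrix.smul_apply, Complex.real_smul,
        Finset.mul_sum, mul_assoc, Complex.ofReal_mul]
    · simp only [h, if_false, Finset.sum_const_zero])
  have h3 := entropy_blocks (ι := α × β × γ) (β := β) (Z := α × γ)
    ⟨fun i => (i.2.1, i.1, i.2.2), fun i => (i.2.1, i.1, i.2.2), fun _ => rfl, fun _ => rfl⟩
    (p := fun i : α × γ => p i.2 * k i.2 i.1) (σ := fun i => τ i.2 i.1)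
    (fun i => hτ _ _) (fun i => hτ1 _ _) (A := σ) (by
    intro i j
    simp only [hσ, Equiv.coe_fn_mk, Prod.ext_iff])
  have h4 := entropy_classical (p := p)
    (A := marginal (fun (c : γ) (i : α × β) => (i.1, i.2, c)) σ) (by
    intro c c'
    simp only [marginal, Matrix.of_apply, hσ, true_and]
    split_ifs with h
    · rw [Fintype.sum_prod_type]
      have : ∀ a, ∑ b, τ c a b b = 1 := hτ1 c
      simp only [← Finset.mul_sum, this, mul_one]
      rw [← Complex.ofReal_sum, ← Finset.mul_sum, (hk c).sum_eq_one, mul_one]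
    · simp)
  -- The classical entropy of `AC` cancels against that in `ABC`, and the one of `C` against that in
  -- `BC`.
  rw [condMutualInfo, h1, h2, h3, h4]
  have h5 : wsum (fun i : α × γ => p i.2 * k i.2 i.1) (fun i => entropy (τ i.2 i.1))
      = wsum p fun c => wsum (k c) fun a => entropy (τ c a) := by
    simp only [wsum, Fintype.sum_prod_type_right, Finset.mul_sum, mul_assoc]
  rw [h5]
  ring

end BlockEntropy

/-! ### Conditional distributions and information quantities -/

section Kernels

/-- Where the marginal vanishes, so does `q` by nonnegativity, and the uniform distribution serves
as the conditional one. -/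
lemma exists_kernel {Z Y : Type*} [Fintype Y] [Nonempty Y] (q : Z → Y → ℝ)
    (hq : ∀ z y, 0 ≤ q z y) :
    ∃ k : Z → Y → ℝ, (∀ z, IsProb (k z)) ∧ ∀ z y, q z y = (∑ y, q z y) * k z y := by
  refine ⟨fun z y => if ∑ y, q z y = 0 then (Fintype.card Y : ℝ)⁻¹ else q z y / ∑ y, q z y,
    fun z => ⟨fun y => ?_, ?_⟩, fun z y => ?_⟩
  · have := Finset.sum_nonneg fun y (_ : y ∈ Finset.univ) => hq z y
    have := hq z y
    dsimp only
    split_ifs <;> positivity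
  · by_cases h : ∑ y, q z y = 0
    · simp [h]
    · simp only [h, if_false]
      rw [← Finset.sum_div, div_self h]
  · by_cases h : ∑ y, q z y = 0
    · rw [h, zero_mul]
      exact (Finset.sum_eq_zero_iff_of_nonneg fun y _ => hq z y).1 h y (Finset.mem_univ y)
    · simp only [h, if_false]
      rw [mul_div_cancel₀ _ h]

/-- Every joint distribution factors into conditional distributions. -/
lemma exists_ensemble {U X X₁ : Type*} [Fintype U] [Fintype X] [Fintype X₁]
    {p : U × X × X₁ → ℝ} (hp : IsProb p) :
    ∃ e : Ensemble X₁ U X, ∀ u x x₁, p (u, x, x₁) = e.w₁ x₁ * e.w₂ x₁ u * e.w₃ x₁ u x := by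
  have hne : Nonempty (U × X × X₁) := by
    by_contra h
    rw [not_nonempty_iff] at h
    have := hp.sum_eq_one
    simp at this
  obtain ⟨u₀, x₀, -⟩ := hne
  have : Nonempty U := ⟨u₀⟩
  have : Nonempty X := ⟨x₀⟩
  obtain ⟨k₃, hk₃, h₃⟩ := exists_kernel (fun (z : X₁ × U) x => p (z.2, x, z.1))
    fun _ _ => hp.nonneg _
  obtain ⟨k₂, hk₂, h₂⟩ := exists_kernel (fun (x₁ : X₁) u => ∑ x, p (u, x, x₁))
    fun _ _ => Finset.sum_nonneg fun _ _ => hp.nonneg _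
  refine ⟨⟨fun x₁ => ∑ u, ∑ x, p (u, x, x₁), k₂, fun x₁ u => k₃ (x₁, u),
    ⟨fun _ => Finset.sum_nonneg fun _ _ => Finset.sum_nonneg fun _ _ => hp.nonneg _, ?_⟩, hk₂,
    fun _ _ => hk₃ _⟩, fun u x x₁ => ?_⟩
  · rw [← hp.sum_eq_one, Fintype.sum_prod_type, Finset.sum_comm]
    refine Finset.sum_congr rfl fun u _ => ?_
    rw [Finset.sum_comm, Fintype.sum_prod_type]
  · exact (h₃ (x₁, u) x).trans (by rw [← h₂ x₁ u])

end Kernels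

section Rates

variable {X X₁ U B₁ B : Type*} [Fintype X] [Fintype X₁] [Fintype U] [Fintype B₁] [Fintype B]
  [DecidableEq X] [DecidableEq X₁] [DecidableEq U]
  (N : RelayChannel X X₁ B₁ B)

lemma destLetter_posSemidef {X X₁ B₁ B : Type*} [Fintype B₁] [Fintype B]
    (N : RelayChannel X X₁ B₁ B) (x₁ : X₁) (x : X) : (destLetter N x₁ x).PosSemidef :=
  marginal_posSemidef _ (N.posSemidef _ _)

lemma relayLetter_posSemidef {X X₁ B₁ B : Type*} [Fintype B₁] [Fintype B]
    (N : RelayChannel X X₁ B₁ B) (x₁ : X₁) (x : X) : (relayLetter N x₁ x).PosSemidef :=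
  marginal_posSemidef _ (N.posSemidef _ _)

lemma trace_destLetter {X X₁ B₁ B : Type*} [Fintype B₁] [Fintype B]
    (N : RelayChannel X X₁ B₁ B) (x₁ : X₁) (x : X) : (destLetter N x₁ x).trace = 1 := by
  rw [destLetter, trace_marginal_snd, N.trace_eq_one]

lemma trace_relayLetter {X X₁ B₁ B : Type*} [Fintype B₁] [Fintype B]
    (N : RelayChannel X X₁ B₁ B) (x₁ : X₁) (x : X) : (relayLetter N x₁ x).trace = 1 := by
  rw [relayLetter, trace_marginal_fst, N.trace_eq_one]

variable {p : U × X × X₁ → ℝ} (e : Ensemble X₁ U X)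
  (hp : ∀ u x x₁, p (u, x, x₁) = e.w₁ x₁ * e.w₂ x₁ u * e.w₃ x₁ u x)
include hp

/-- This and the next two lemmas express the information quantities by the average entropies that
set the thresholds of the tests. -/
lemma infoXX₁B_eq [DecidableEq B] : infoXX₁B N p = entropy (e.out₀ (destLetter N))
    - e.mean fun x₁ _ x => entropy (destLetter N x₁ x) := by
  rw [infoXX₁B, mutualInfo_classical (p := fun a : X × X₁ => ∑ u, p (u, a.1, a.2))
    (τ := fun a => destLetter N a.2 a.1) (fun _ => destLetter_posSemidef N _ _)
    (fun _ => trace_destLetter N _ _)]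
  · congr 1
    · congr 1
      simp only [Ensemble.out₀, Ensemble.out₁, Ensemble.out₂, Fintype.sum_prod_type_right,
        Finset.smul_sum, Finset.sum_smul, hp, smul_smul, mul_assoc]
      refine Finset.sum_congr rfl fun x₁ _ => ?_
      exact Finset.sum_comm
    · simp only [wsum, Ensemble.mean, Fintype.sum_prod_type_right, Finset.mul_sum, Finset.sum_mul,
        hp, mul_assoc]
      refine Finset.sum_congr rfl fun x₁ _ => ?_
      exact Finset.sum_comm
  · intro i j
    simp only [marginal, Matrix.of_apply, codeState, true_and, Fintype.sum_prod_type]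
    by_cases h : i.1 = j.1
    · have h' : i.1.1 = j.1.1 ∧ i.1.2 = j.1.2 := Prod.ext_iff.1 h
      simp only [h, and_self, if_true, destLetter, marginal, Matrix.of_apply]
      push_cast
      simp only [Finset.mul_sum, Finset.sum_mul]
      exact Finset.sum_comm
    · have h' : ¬ (i.1.1 = j.1.1 ∧ i.1.2 = j.1.2) := fun h' => h (Prod.ext h'.1 h'.2)
      simp [h, h']

lemma infoUB₁_eq [DecidableEq B₁] : infoUB₁ N p
    = wsum e.w₁ (fun x₁ => entropy (e.out₁ (relayLetter N) x₁))
      - wsum e.w₁ fun x₁ => wsum (e.w₂ x₁) fun u => entropy (e.out₂ (relayLetter N) x₁ u) := by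
  rw [infoUB₁, condMutualInfo_classical (p := e.w₁) (k := e.w₂) e.isProb₂
    (τ := e.out₂ (relayLetter N)) (e.out₂_posSemidef (relayLetter_posSemidef N))
    (e.trace_out₂ (trace_relayLetter N))]
  · rfl
  · intro i j
    simp only [marginal, Matrix.of_apply, codeState, true_and, Fintype.sum_prod_type]
    split_ifs with h
    · simp only [Ensemble.out₂, relayLetter, marginal, Matrix.sum_apply, Matrix.smul_apply,
        Matrix.of_apply, Finset.mul_sum, hp, Complex.real_smul]
      push_cast
      exact Finset.sum_congr rfl fun x _ => Finset.sum_congr rfl fun y _ => by ring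
    · simp

lemma infoXB_eq [DecidableEq B] : infoXB N p
    = wsum e.w₁ (fun x₁ => wsum (e.w₂ x₁) fun u => entropy (e.out₂ (destLetter N) x₁ u))
      - e.mean fun x₁ _ x => entropy (destLetter N x₁ x) := by
  rw [infoXB, condMutualInfo_classical (p := jointWeight e.w₁ e.w₂)
    (k := fun z : X₁ × U => e.w₃ z.1 z.2) (fun z => e.isProb₃ _ _)
    (τ := fun z x => destLetter N z.1 x) (fun _ _ => destLetter_posSemidef N _ _)
    (fun _ _ => trace_destLetter N _ _), wsum_jointWeight, wsum_jointWeight]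
  · rfl
  · intro i j
    simp only [marginal, Matrix.of_apply, codeState]
    by_cases h : i.1 = j.1 ∧ i.2.2 = j.2.2
    · have h' : i.2.2.2 = j.2.2.2 ∧ i.1 = j.1 ∧ i.2.2.1 = j.2.2.1 := by simp [h.1, h.2]
      rw [if_pos h]
      simp only [h', and_self, if_true]
      rw [← h'.1, ← h'.2.1, ← h'.2.2, ← Finset.mul_sum, hp]
      rfl
    · have h' : ¬ (i.2.2.2 = j.2.2.2 ∧ i.1 = j.1 ∧ i.2.2.1 = j.2.2.1) := fun h' =>
        h ⟨h'.2.1, Prod.ext h'.2.2 h'.1⟩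
      simp only [h, h', if_false, Finset.sum_const_zero]

end Rates


/-! ### Exponents and splitting of the rate -/

section Exponents

open Filter Topology

/-- The number of messages at rate `r` and block length `n`. -/
def numMessages (r : ℝ) (n : ℕ) : ℕ := ⌈(2 : ℝ) ^ (n * r)⌉₊

lemma numMessages_pos (r : ℝ) (n : ℕ) : 0 < numMessages r n :=
  Nat.ceil_pos.2 (by positivity)

/-- A part of rate zero has no wrong messages, so its error terms vanish without any sign condition
on the information quantities. -/
lemma numMessages_zero (n : ℕ) : numMessages 0 n = 1 := by
  simp [numMessages]

lemma numMessages_sub_one_le (r : ℝ) (n : ℕ) : (numMessages r n : ℝ) - 1 ≤ 2 ^ (n * r) := by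
  have := Nat.ceil_lt_add_one (a := (2 : ℝ) ^ (n * r)) (by positivity)
  unfold numMessages
  linarith

lemma numMessages_le {r : ℝ} (hr : 0 ≤ r) (n : ℕ) : (numMessages r n : ℝ) ≤ 2 * 2 ^ (n * r) := by
  have h1 := numMessages_sub_one_le r n
  have h2 : (1 : ℝ) ≤ 2 ^ (n * r) := Real.one_le_rpow (by norm_num) (by positivity)
  linarith

lemma mul_le_logb_numMessages (r : ℝ) (n : ℕ) : n * r ≤ Real.logb 2 (numMessages r n) := by
  rw [Real.le_logb_iff_rpow_le (by norm_num) (Nat.cast_pos.2 (numMessages_pos r n))]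
  exact Nat.le_ceil _

lemma eventually_mul_rpow_le {s : ℝ} (hs : s < 0) (C : ℝ) {η : ℝ} (hη : 0 < η) :
    ∀ᶠ n : ℕ in atTop, C * (2 : ℝ) ^ (n * s) ≤ η := by
  have h : Tendsto (fun n : ℕ => C * ((2 : ℝ) ^ s) ^ n) atTop (𝓝 (C * 0)) :=
    (tendsto_pow_atTop_nhds_zero_of_lt_one (by positivity)
      (Real.rpow_lt_one_of_one_lt_of_neg (by norm_num) hs)).const_mul C
  rw [mul_zero] at h
  filter_upwards [h.eventually_le_const hη] with n hn
  rwa [mul_comm (n : ℝ) s, Real.rpow_mul_natCast (by norm_num)]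

/-- The ratio of the thresholds is `2 ^ (-n (h - g - 2 δ))`, and the slack `4 δ` in the rate more
than covers the loss. -/
lemma eventually_numMessages_mul_le {r g h δ η : ℝ} (hδ : 0 < δ) (hη : 0 < η)
    (hr : r = 0 ∨ r + 4 * δ < h - g) :
    ∀ᶠ n : ℕ in atTop, ((numMessages r n : ℝ) - 1)
      * ((2 : ℝ) ^ (-(n * (h - δ))) / 2 ^ (-(n * (g + δ)))) ≤ η := by
  rcases hr with rfl | hr
  · exact Eventually.of_forall fun n => by simpa [numMessages_zero] using hη.le
  have hs : r - (h - g) + 2 * δ < 0 := by linarith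
  filter_upwards [eventually_mul_rpow_le hs 1 hη] with n hn
  refine le_trans ?_ hn
  rw [← Real.rpow_sub (by norm_num), one_mul]
  refine (mul_le_mul_of_nonneg_right (numMessages_sub_one_le r n) (by positivity)).trans ?_
  rw [← Real.rpow_add (by norm_num)]
  exact le_of_eq (by congr 1; ring)

/-- The entropy `h₁` cancels between the tests of the two blocks. Each of the four thresholds costs
one `δ`, which is the origin of the slack `4 δ`. -/
lemma eventually_numMessages_mul_numMessages_mul_le {r r' h₀ h₁ h₃ δ η : ℝ}
    (hη : 0 < η) (hr : 0 ≤ r) (hr' : r' = 0 ∨ r + r' + 4 * δ < h₀ - h₃) :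
    ∀ᶠ n : ℕ in atTop, (numMessages r n : ℝ) * ((numMessages r' n : ℝ) - 1)
      * ((2 : ℝ) ^ (-(n * (h₁ - δ))) / 2 ^ (-(n * (h₃ + δ)))
        * (2 ^ (-(n * (h₀ - δ))) / 2 ^ (-(n * (h₁ + δ))))) ≤ η := by
  rcases hr' with rfl | hr'
  · exact Eventually.of_forall fun n => by simpa [numMessages_zero] using hη.le
  have hs : r + r' - (h₀ - h₃) + 4 * δ < 0 := by linarith
  filter_upwards [eventually_mul_rpow_le hs 2 hη] with n hn
  refine le_trans ?_ hn
  have h : (numMessages r n : ℝ) * ((numMessages r' n : ℝ) - 1)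
      ≤ (2 * 2 ^ (n * r)) * 2 ^ (n * r') :=
    (mul_le_mul_of_nonneg_left (numMessages_sub_one_le r' n) (Nat.cast_nonneg _)).trans
      (mul_le_mul_of_nonneg_right (numMessages_le hr n) (by positivity))
  refine (mul_le_mul_of_nonneg_right h (by positivity)).trans ?_
  rw [← Real.rpow_sub (by norm_num), ← Real.rpow_sub (by norm_num), ← Real.rpow_add (by norm_num),
    mul_assoc, mul_assoc, ← Real.rpow_add (by norm_num), ← Real.rpow_add (by norm_num)]
  exact le_of_eq (by congr 2; ring)

/-- Stated as an eventuality, so that a common `δ` can be found for all the rate conditions. -/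
lemma eventually_slack {P : Prop} {x y : ℝ} (h : P ∨ x < y) :
    ∀ᶠ δ : ℝ in 𝓝[>] 0, P ∨ x + 4 * δ < y := by
  rcases h with h | h
  · exact Eventually.of_forall fun _ => Or.inl h
  have hc : ContinuousAt (fun δ : ℝ => x + 4 * δ) 0 := by fun_prop
  have := hc.eventually_lt (continuousAt_const (y := y)) (by simpa using h)
  exact (this.filter_mono nhdsWithin_le_nhds).mono fun _ => Or.inr

/-- A rate below `a + c` splits into a rate below `a` and a rate below `c`, unless one of the parts
is not used. -/
lemma exists_rate_split {a c d R : ℝ} (hd : R < d) (hac : R < a + c) :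
    ∃ r r' : ℝ, 0 ≤ r ∧ R ≤ r + r' ∧ (r = 0 ∨ r < c) ∧ (r' = 0 ∨ r' < a) ∧
      (r' = 0 ∨ r + r' < d) := by
  rcases le_or_gt R 0 with h0 | h0
  · exact ⟨0, 0, le_rfl, by simpa using h0, Or.inl rfl, Or.inl rfl, Or.inl rfl⟩
  rcases lt_or_ge R c with hc | hc
  · exact ⟨R, 0, h0.le, by simp, Or.inr hc, Or.inl rfl, Or.inl rfl⟩
  rcases lt_or_ge R a with ha | ha
  · exact ⟨0, R, le_rfl, by simp, Or.inl rfl, Or.inr ha, Or.inr (by simpa using hd)⟩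
  -- Neither part suffices alone. The surplus is shared equally: `c - r` and `a - r'` both equal `(a
  -- + c - R) / 2`.
  · exact ⟨(c - a + R) / 2, (a - c + R) / 2, by linarith, by linarith, Or.inr (by linarith),
      Or.inr (by linarith), Or.inr (by linarith)⟩

end Exponents

/-! ### Achievability -/

section Achievability

open Filter Topology

variable {X X₁ U B₁ B : Type*} [Fintype X] [Fintype X₁] [Fintype U] [Fintype B₁] [Fintype B]
  [DecidableEq B₁] [DecidableEq B] (N : RelayChannel X X₁ B₁ B)

lemma Ensemble.eventually_exists_code (e : Ensemble X₁ U X) {h₃ h₂ h₁ h₀ g₂ g₁ r r' : ℝ}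
    (hh₃ : e.mean (fun a₁ _ a₃ => entropy (destLetter N a₁ a₃)) = h₃)
    (hh₂ : wsum e.w₁ (fun a₁ => wsum (e.w₂ a₁) fun a₂ => entropy (e.out₂ (destLetter N) a₁ a₂))
      = h₂)
    (hh₁ : wsum e.w₁ (fun a₁ => entropy (e.out₁ (destLetter N) a₁)) = h₁)
    (hh₀ : entropy (e.out₀ (destLetter N)) = h₀)
    (hg₂ : wsum e.w₁ (fun a₁ => wsum (e.w₂ a₁) fun a₂ => entropy (e.out₂ (relayLetter N) a₁ a₂))
      = g₂)
    (hg₁ : wsum e.w₁ (fun a₁ => entropy (e.out₁ (relayLetter N) a₁)) = g₁)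
    (hr0 : 0 ≤ r) (hr : r = 0 ∨ r < h₂ - h₃) (hr' : r' = 0 ∨ r' < g₁ - g₂)
    (hrr' : r' = 0 ∨ r + r' < h₀ - h₃) (b : ℕ) {ε : ℝ} (hε : 0 < ε) :
    ∀ᶠ n : ℕ in atTop, ∃ c : PDFCode X X₁ B₁ B n b,
      n * (r + r') ≤ Real.logb 2 ((c.cardM : ℝ) * c.cardL) ∧ c.error N ≤ ε := by
  obtain ⟨δ, ⟨⟨hδr, hδr'⟩, hδrr'⟩, hδ⟩ := (((eventually_slack hr).and
    (eventually_slack hr')).and (eventually_slack hrr')).and self_mem_nhdsWithin |>.exists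
  -- The bound of `exists_code` when all its small quantities are at most `η`. It is continuous and
  -- vanishes at 0, so `η` can be fixed, depending on `b` and `ε`, before `n` grows.
  have hcont : Continuous fun η : ℝ => 2 * (b * ((2 * (6 * √η) + 4 * η)
      + 2 * √(2 * (6 * √η + 6 * √η) + 4 * (η + η)))) := by fun_prop
  have hlim : ∀ᶠ η : ℝ in 𝓝[>] 0, 2 * (b * ((2 * (6 * √η) + 4 * η)
      + 2 * √(2 * (6 * √η + 6 * √η) + 4 * (η + η)))) ≤ ε :=
    (hcont.tendsto 0).eventually_le_const (by simpa using hε) |>.filter_mono nhdsWithin_le_nhds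
  obtain ⟨η, hηε, hη⟩ := (hlim.and self_mem_nhdsWithin).exists
  replace hδ : 0 < δ := hδ
  replace hη : 0 < η := hη
  have hd := destLetter_posSemidef N
  have hd1 := trace_destLetter N
  have hl := relayLetter_posSemidef N
  have hl1 := trace_relayLetter N
  filter_upwards [e.eventually_typical₃ hd hd1 hδ hη, e.eventually_typical₂ hd hd1 hδ hη,
    e.eventually_typical₁ hd hd1 hδ hη, e.eventually_typical₀ hd hd1 hδ hη,
    e.eventually_typical₂ hl hl1 hδ hη, e.eventually_typical₁ hl hl1 hδ hη,
    eventually_numMessages_mul_le hδ hη hδr, eventually_numMessages_mul_le hδ hη hδr',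
    eventually_numMessages_mul_numMessages_mul_le (h₁ := h₁) hη hr0 hδrr']
    with n ht₃ ht₂ ht₁ ht₀ hu₂ hu₁ hm hm' hmm'
  rw [hh₃] at ht₃
  rw [hh₂] at ht₂
  rw [hh₁] at ht₁
  rw [hh₀] at ht₀
  rw [hg₂] at hu₂
  rw [hg₁] at hu₁
  -- Lower cuts are placed at entropy plus `δ` in the exponent, upper cuts at entropy minus `δ`.
  obtain ⟨c, hM, hL, hc⟩ := exists_code N (e.pow n) (numMessages_pos r n) (numMessages_pos r' n)
    (t₀ := 2 ^ (-(n * (h₃ + δ)))) (t₁ := 2 ^ (-(n * (h₂ - δ)))) (t₂ := 2 ^ (-(n * (h₁ - δ))))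
    (t₃ := 2 ^ (-(n * (h₁ + δ)))) (t₄ := 2 ^ (-(n * (h₀ - δ)))) (t₅ := 2 ^ (-(n * (g₂ + δ))))
    (t₆ := 2 ^ (-(n * (g₁ - δ)))) (by positivity) (by positivity) (by positivity) (by positivity)
    (by positivity) (by positivity) (by positivity) hη.le
    (fun x₁ x => piTensor fun i => destLetter N (x₁ i) (x i)) (destOut_eq_piTensor N).symm
    (fun x₁ x => piTensor fun i => relayLetter N (x₁ i) (x i)) (relayOut_eq_piTensor N).symm
    ht₃ (by simpa only [Ensemble.pow_out₂] using ht₂.2)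
    (by simpa only [Ensemble.pow_out₁] using ht₁.2) (by simpa only [Ensemble.pow_out₁] using ht₁.1)
    (by simpa only [Ensemble.pow_out₀] using ht₀) (by simpa only [Ensemble.pow_out₂] using hu₂.1)
    (by simpa only [Ensemble.pow_out₁] using hu₁.2) b
  refine ⟨c, ?_, hc.trans (le_trans ?_ hηε)⟩
  · rw [hM, hL, Real.logb_mul (Nat.cast_pos.2 (numMessages_pos r n)).ne'
      (Nat.cast_pos.2 (numMessages_pos r' n)).ne', mul_add]
    exact add_le_add (mul_le_logb_numMessages r n) (mul_le_logb_numMessages r' n)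
  · gcongr

/-- Every rate below the bound for some input distribution is achievable up to `δ`. -/
lemma eventually_exists_code [DecidableEq X] [DecidableEq X₁] [DecidableEq U]
    {p : U × X × X₁ → ℝ} (hp : IsProb p) {R : ℝ} (hR : R < pdfBound N p) (b : ℕ) {ε : ℝ} (hε : 0 < ε) :
    ∀ᶠ n : ℕ in atTop, ∃ c : PDFCode X X₁ B₁ B n b,
      n * R ≤ Real.logb 2 ((c.cardM : ℝ) * c.cardL) ∧ c.error N ≤ ε := by
  obtain ⟨e, he⟩ := exists_ensemble hp
  rw [pdfBound, lt_min_iff, infoXX₁B_eq N e he, infoUB₁_eq N e he, infoXB_eq N e he] at hR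
  obtain ⟨r, r', hr0, hRr, hr, hr', hrr'⟩ := exists_rate_split hR.1 hR.2
  filter_upwards [e.eventually_exists_code N rfl rfl rfl rfl rfl rfl hr0 hr hr' hrr' b hε]
    with n ⟨c, hc, hc'⟩
  exact ⟨c, (mul_le_mul_of_nonneg_left hRr n.cast_nonneg).trans hc, hc'⟩

end Achievability

end

end QRelay

/-- Every rate up to the maximum, over the distributions `p(u,x,x₁)` with `u` in a finite set, of
`min {I(X X₁; B), I(U; B₁ | X₁) + I(X; B | X₁ U)}` is achievable. The maximum is written as a
supremum of extended reals. -/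
theorem theorem1 {X X₁ B₁ B : Type*} [Fintype X] [Fintype X₁] [Fintype B₁] [Fintype B]
    [DecidableEq X] [DecidableEq X₁] [DecidableEq B₁] [DecidableEq B]
    (N : QRelay.RelayChannel X X₁ B₁ B) (R : ℝ)
    (hR : (R : EReal) ≤ ⨆ (k : ℕ) (p : stdSimplex ℝ (Fin k × X × X₁)),
      ((QRelay.pdfBound N (p : Fin k × X × X₁ → ℝ) : ℝ) : EReal)) :
    QRelay.Achievable N R := by
  intro ε hε δ hδ
  -- One half of `δ` pays for a distribution that only approaches the supremum, the other half for
  -- the last block, which carries no message.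
  have hlt : ((R - δ / 2 : ℝ) : EReal) < ⨆ (k : ℕ) (p : stdSimplex ℝ (Fin k × X × X₁)),
      ((QRelay.pdfBound N (p : Fin k × X × X₁ → ℝ) : ℝ) : EReal) :=
    (EReal.coe_lt_coe_iff.2 (by linarith)).trans_le hR
  simp only [lt_iSup_iff] at hlt
  obtain ⟨k, ⟨p, hp⟩, hpR⟩ := hlt
  -- The inequality `(R - δ) (b + 1) ≤ b (R - δ / 2)` is equivalent to `R - δ ≤ b δ / 2`.
  obtain ⟨b₀, hb₀⟩ := exists_nat_ge ((R - δ) / (δ / 2))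
  refine ⟨b₀, fun b hb => ?_⟩
  obtain ⟨n₀, hn₀⟩ := Filter.eventually_atTop.1 (QRelay.eventually_exists_code N
    (⟨hp.1, hp.2⟩ : QRelay.IsProb p) (EReal.coe_lt_coe_iff.1 hpR) b hε)
  refine ⟨n₀, fun n hn => ?_⟩
  obtain ⟨c, hc, hc'⟩ := hn₀ n hn
  refine ⟨c, ?_, hc'⟩
  rw [div_le_iff₀ (by positivity)] at hb₀
  have hbR : (R - δ) * ((b : ℝ) + 1) ≤ b * (R - δ / 2) := by
    have : (b₀ : ℝ) ≤ b := by exact_mod_cast hb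
    nlinarith
  calc (R - δ) * (((b : ℝ) + 1) * n) = (R - δ) * ((b : ℝ) + 1) * n := by ring
    _ ≤ b * (R - δ / 2) * n := mul_le_mul_of_nonneg_right hbR n.cast_nonneg
    _ = b * (n * (R - δ / 2)) := by ring
    _ ≤ _ := mul_le_mul_of_nonneg_left hc b.cast_nonneg
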